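/- **Setting.** Let $X$ be a connected, non-compact $C^\infty$ Riemannian manifold with Riemannian volume $\nu$, and let $M$ be a connected $C^\infty$ manifold on which a (finite-dimensional, real) Lie group $G$ with unit $e$ and Lie algebra $\mathfrak g$ acts smoothly and transitively, $(g,m)\mapsto gm$ (all manifolds are Hausdorff and second countable, without boundary). Fix an inner product on $\mathfrak g$. Let $\lambda$ be a locally finite Borel measure on $M$ that is quasiinvariant under $G$ and for which there is a differentiable function $p^\lambda$ on $G\times M$ with $p^\lambda(g,\cdot)=d(g^*\lambda)/d\lambda$ for every $g\in G$, where $g^*\lambda$ is the image of $\lambda$ under $m\mapsto gm$. Let $\rho:X\to\mathbb R$ and $p:X\times M\to\mathbb R$ be measurable with $\rho>0$ $\nu$-a.e. and, for $\nu$-a.e. $x$, $p(x,\cdot)>0$ $\lambda$-a.e.; put $q(x,m)=\rho(x)p(x,m)$ and $\tilde\sigma(dx,dm)=q(x,m)\,\nu(dx)\lambda(dm)$. *Differentiation.* Let $\mathfrak a=V_0(X)\times C_0^\infty(X;\mathfrak g)$, where $V_0(X)$ is the set of compactly supported $C^\infty$ vector fields on $X$ and $C_0^\infty(X;\mathfrak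 g)$ the set of compactly supported $C^\infty$ maps $X\to\mathfrak g$. For $(v,u)\in\mathfrak a$ let $\psi^v_t$ be the flow of $v$ and $\eta^u_t(x)=\exp(tu(x))$; they act on $X\times M$ by $(\psi^v_t,\eta^u_t)(x,m)=(\psi^v_t(x),\eta^u_t(\psi^v_t(x))m)$. For a smooth $\varphi:X\times M\to\mathbb R$ let $\nabla^X\varphi$ be the gradient in $x$, let $\widetilde\nabla^M\varphi(x,m)\in\mathfrak g$ be the gradient at $g=e$ of $g\mapsto\varphi(x,gm)$, and $\nabla^{X\times M}=(\nabla^X,\widetilde\nabla^M)$. Let $\mathfrak D$ be the set of all $C^\infty$ functions on $X\times M$ that vanish outside $K\times M$ for some compact $K\subset X$ and are bounded together with all their $\nabla^{X\times M}$-derivatives. *Assumptions on $q$ and $p^\lambda$.* Let $H^{1,2}(X\times M)$ be the closure of $\{\varphi\in\mathfrak D:\|\varphi\|_{1,2}<\infty\}$ in the norm $\|\varphi\|_{1,2}^2=\int(|\nabla^X\varphi|^2+|\widetilde\nabla^M\varphi|^2+|\varphi|^2)\,d\nu\,d\lambda$, and $H^{1,2}_0(X\times M)$ the set of functions that coincide,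 on each $K\times M$ with $K\subset X$ compact, with an element of $H^{1,2}(X\times M)$; gradients are extended to these spaces by $L^2$-limits. Assume that $q^{1/2}\in H^{1,2}_0(X\times M)$, and that $(x,m)\mapsto|\nabla^Gp^\lambda(e,m)|_{\mathfrak g}$ is $\tilde\sigma$-integrable on $K\times M$ for each compact $K\subset X$, where $\nabla^Gp^\lambda(e,m)$ is the gradient at $g=e$ of $g\mapsto p^\lambda(g,m)$. *Marked configurations.* Let $\Omega=\Omega_X^M$ be the set of all $\omega\subset X\times M$ whose distinct elements have distinct first coordinates and whose projection to $X$ is locally finite, with the $\sigma$-algebra generated by the counting functions $\omega\mapsto\#(\omega\cap B)$, $B\subset X\times M$ Borel with relatively compact projection to $X$; write $\langle f,\omega\rangle=\sum_{(x,m)\in\omega}f(x,m)$. Let $\pi=\pi_{\tilde\sigma}$ be the marked Poisson measure: the probability measure on $\Omega$ such that for each relatively compact open $\Lambda\subset X$ the image of $\pi$ under $\omega\mapsto\omega\cap(\Lambda\times M)$ is $e^{-\tilde\sigma(\Lambda\times M)}\sum_{n\ge0}\frac1{n!}\tilde\sigma_{\Lambda,n}$, where $\tilde\sigma_{\Lambda,n}$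 is the image of the $n$-fold product of $\tilde\sigma|_{\Lambda\times M}$ under $((x_1,m_1),\dots,(x_n,m_n))\mapsto\{(x_1,m_1),\dots,(x_n,m_n)\}$. A cylinder function is a function $F(\omega)=g(\langle\varphi_1,\omega\rangle,\dots,\langle\varphi_N,\omega\rangle)$ with $\varphi_i\in\mathfrak D$ and $g\in C^\infty(\mathbb R^N)$ bounded together with all its derivatives. For $(v,u)\in\mathfrak a$ put $(\nabla^\Omega_{(v,u)}F)(\omega)=\frac d{dt}F((\psi^v_t,\eta^u_t)\omega)|_{t=0}$, where $(\psi^v_t,\eta^u_t)\omega$ is the image of the set $\omega$. Let $$\beta_{(v,u)}(x,m)=\Big\langle\frac{\nabla^Xq}{q},v\Big\rangle+\operatorname{div}_\nu v+\Big\langle\frac{\widetilde\nabla^Mq}{q},u\Big\rangle_{\mathfrak g}-\langle\nabla^Gp^\lambda(e,m),u(x)\rangle_{\mathfrak g},\qquad \nabla q:=2q^{1/2}\nabla q^{1/2},$$ and $B_{(v,u)}(\omega)=\langle\beta_{(v,u)},\omega\rangle$. **Theorem.** Let $(v,u)\in\mathfrak a$. 1. For every cylinder function $F$ the derivative $\nabla^\Omega_{(v,u)}F$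 exists at every $\omega\in\Omega$, and $F,\nabla^\Omega_{(v,u)}F\in L^2(\pi)$. 2. For all cylinder functions $F_1,F_2$, the function $F_1F_2B_{(v,u)}$ is $\pi$-integrable and $$\int(\nabla^\Omega_{(v,u)}F_1)F_2\,d\pi=-\int F_1\nabla^\Omega_{(v,u)}F_2\,d\pi-\int F_1F_2B_{(v,u)}\,d\pi.$$ 3. On the cylinder functions, $\nabla^{\Omega*}_{(v,u)}=-\nabla^\Omega_{(v,u)}-B_{(v,u)}$, where $\nabla^{\Omega*}_{(v,u)}$ is the adjoint in $L^2(\pi)$ of $\nabla^\Omega_{(v,u)}$ with domain the cylinder functions: a cylinder function $F$ lies in the domain of $\nabla^{\Omega*}_{(v,u)}$ if and only if $-\nabla^\Omega_{(v,u)}F-B_{(v,u)}F\in L^2(\pi)$, and then $\nabla^{\Omega*}_{(v,u)}F=-\nabla^\Omega_{(v,u)}F-B_{(v,u)}F$ $\pi$-a.e. -/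

import Mathlib

open MeasureTheory Filter Topology Bundle
open scoped Manifold ContDiff Bundle

noncomputable section

namespace MarkedConfig

/-! ### The Riemannian volume and the divergence on the base manifold -/

section Base

variable {d : ℕ} {X : Type*} [TopologicalSpace X] [ChartedSpace (EuclideanSpace ℝ (Fin d)) X]
  [RiemannianBundle (fun x : X => TangentSpace (𝓡 d) x)]

/-- The matrix `(g_ij)` of the Riemannian metric in the preferred chart at `c`, as a function of the
coordinates `y`: the Gram matrix of the coordinate vector fields. -/
def gram (c : X) (y : EuclideanSpace ℝ (Fin d)) : Matrix (Fin d) (Fin d) ℝ :=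
  fun i j => inner ℝ
    (mfderiv (𝓡 d) (𝓡 d) (extChartAt (𝓡 d) c).symm y (EuclideanSpace.single i (1 : ℝ)) :
      TangentSpace (𝓡 d) ((extChartAt (𝓡 d) c).symm y))
    (mfderiv (𝓡 d) (𝓡 d) (extChartAt (𝓡 d) c).symm y (EuclideanSpace.single j (1 : ℝ)))

/-- `√(det g)` in the preferred chart at `c`. -/
def volDensity (c : X) (y : EuclideanSpace ℝ (Fin d)) : ℝ :=
  Real.sqrt (gram c y).det

/-- The Riemannian volume on the domain of the preferred chart at `c` (extended by zero):
`√(det g) dy` in coordinates. -/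
def localVolume [MeasurableSpace X] (c : X) : Measure X :=
  Measure.map (extChartAt (𝓡 d) c).symm
    ((volume.restrict (extChartAt (𝓡 d) c).target).withDensity
      (fun y => ENNReal.ofReal (volDensity c y)))

variable (d X) in
/-- The Riemannian volume. The measures `localVolume c` agree on overlaps of charts, so that
their least upper bound is the measure obtained by glueing them. -/
def riemannianVolume [MeasurableSpace X] : Measure X := ⨆ c : X, localVolume (d := d) c

/-- The components of a vector field in the preferred chart at `c`, as functions of the
coordinates. -/
def coords (v : ∀ x : X, TangentSpace (𝓡 d) x) (c : X) (y : EuclideanSpace ℝ (Fin d)) :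
    EuclideanSpace ℝ (Fin d) :=
  mfderiv (𝓡 d) (𝓡 d) (extChartAt (𝓡 d) c) ((extChartAt (𝓡 d) c).symm y)
    (v ((extChartAt (𝓡 d) c).symm y))

/-- The divergence with respect to the Riemannian volume,
`div v = (√det g)⁻¹ ∑ i, ∂_i (√det g · v^i)`, computed at `x` in the preferred chart at `x`. -/
def divX (v : ∀ x : X, TangentSpace (𝓡 d) x) (x : X) : ℝ :=
  (volDensity x (extChartAt (𝓡 d) x x))⁻¹ *
    ∑ i : Fin d, fderiv ℝ (fun y => volDensity x y * coords v x y i)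
      (extChartAt (𝓡 d) x x) (EuclideanSpace.single i 1)

end Base

/-- The flow of a vector field: `flow v t x` is the value at time `t` of the integral curve of `v`
that starts at `x`. (For the vector fields considered here, the integral curve is defined for
all times and unique; the default value is never used.) -/
def flow {n : ℕ} {Y : Type*} [TopologicalSpace Y] [ChartedSpace (EuclideanSpace ℝ (Fin n)) Y]
    (v : ∀ y : Y, TangentSpace (𝓡 n) y) (t : ℝ) (x : Y) : Y :=
  open Classical in
  if h : ∃ γ : ℝ → Y, γ 0 = x ∧ IsMIntegralCurve (I := 𝓡 n) γ v then h.choose t else x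

/-- The exponential map of a Lie group: the time-one value of the integral curve through the unit
of the left-invariant vector field generated by `Y`. -/
def lieExp {k : ℕ} {G : Type*} [TopologicalSpace G] [ChartedSpace (EuclideanSpace ℝ (Fin k)) G]
    [Group G] (Y : GroupLieAlgebra (𝓡 k) G) : G :=
  flow (mulInvariantVectorField (I := 𝓡 k) Y) 1 1

/-! ### Marked configurations -/

section Configurations

variable {X M : Type*} [TopologicalSpace X]

/-- A subset of `X × M` is a marked configuration if different elements have different positions
and the set of positions is locally finite. -/
def IsConfiguration (ξ : Set (X × M)) : Prop :=
  (∀ z ∈ ξ, ∀ z' ∈ ξ, z ≠ z' → z.1 ≠ z'.1) ∧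
    ∀ K : Set X, IsCompact K → (Prod.fst '' ξ ∩ K).Finite

variable (X M) in
/-- The marked configuration space over `X` with marks from `M`. -/
def Configuration : Type _ := {ξ : Set (X × M) // IsConfiguration ξ}

/-- The `σ`-algebra generated by the counting functions `ξ ↦ #(ξ ∩ B)`, where `B` is a Borel
set whose projection on `X` is relatively compact. -/
instance [MeasurableSpace X] [MeasurableSpace M] : MeasurableSpace (Configuration X M) :=
  ⨆ B : {B : Set (X × M) // MeasurableSet B ∧ ∃ K : Set X, IsCompact K ∧ B ⊆ K ×ˢ Set.univ},
    MeasurableSpace.comap (fun ξ : Configuration X M => (ξ.1 ∩ B.1).ncard) ⊤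

/-- `⟨f, ξ⟩ = ∑_{(x, m) ∈ ξ} f (x, m)`. (Used for `f` that vanish outside of some `K × M` with `K`
compact, so that the sum is finite.) -/
def pairing (f : X × M → ℝ) (ξ : Configuration X M) : ℝ := ∑ᶠ z ∈ ξ.1, f z

open Classical in
/-- The configuration given by a set of points of `X × M` (the empty one if that set is not a
configuration). -/
def toConfiguration (s : Set (X × M)) : Configuration X M :=
  if h : IsConfiguration s then ⟨s, h⟩ else ⟨∅, by simp [IsConfiguration]⟩

/-- The restriction `ξ ↦ ξ ∩ (Λ × M)`. -/
def restrictTo (Λ : Set X) (ξ : Configuration X M) : Configuration X M :=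
  toConfiguration (ξ.1 ∩ Λ ×ˢ Set.univ)

/-- `((x_1, m_1), …, (x_n, m_n)) ↦ {(x_1, m_1), …, (x_n, m_n)}`. It is meant for tuples with
distinct positions; tuples that are not of this kind give the empty configuration or one with
fewer points, and form a null set below. -/
def ofTuple (n : ℕ) (z : Fin n → X × M) : Configuration X M :=
  toConfiguration (Set.range z)

/-- The law of a marked Poisson configuration in `Λ`:
`exp (-σ(Λ × M)) ∑_n (1 / n!) σ^{⊗ n}|_{(Λ × M)^n}`, the `n`-th summand being carried over to
the configurations with `n` points. -/
def localPoisson [MeasurableSpace X] [MeasurableSpace M] (σ : Measure (X × M)) (Λ : Set X) :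
    Measure (Configuration X M) :=
  ENNReal.ofReal (Real.exp (-(σ (Λ ×ˢ Set.univ)).toReal)) •
    Measure.sum (fun n : ℕ => ((n.factorial : ENNReal)⁻¹) •
      Measure.map (ofTuple n)
        (Measure.pi (fun _ : Fin n => σ.restrict (Λ ×ˢ (Set.univ : Set M)))))

/-- `μ` is the marked Poisson measure with Lévy measure `σ`: the probability measure whose
image under the restriction to `Λ` is `localPoisson σ Λ`, for each relatively compact open
`Λ`. (There is exactly one.) -/
structure IsMarkedPoisson [MeasurableSpace X] [MeasurableSpace M] (σ : Measure (X × M))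
    (μ : Measure (Configuration X M)) : Prop where
  prob : IsProbabilityMeasure μ
  map_restrictTo : ∀ Λ : Set X, IsOpen Λ → IsCompact (closure Λ) →
    μ.map (restrictTo Λ) = localPoisson σ Λ

end Configurations

/-! ### Differentiation on `X × M` and on the marked configuration space -/

section Calculus

variable {d e k : ℕ} {X M G : Type*}
  [TopologicalSpace X] [ChartedSpace (EuclideanSpace ℝ (Fin d)) X]
  [TopologicalSpace M] [ChartedSpace (EuclideanSpace ℝ (Fin e)) M]
  [TopologicalSpace G] [ChartedSpace (EuclideanSpace ℝ (Fin k)) G] [Group G]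

variable (d k X G) in
/-- The Lie algebra `V_0(X) × C_0^∞(X; 𝔤)`: pairs of a smooth vector field `v` on `X` and a smooth
map `u` from `X` to the Lie algebra of `G`, both with compact support. -/
structure CurrentAlgebra [IsManifold (𝓡 d) ∞ X] where
  v : ∀ x : X, TangentSpace (𝓡 d) x
  u : X → GroupLieAlgebra (𝓡 k) G
  smooth_v : ContMDiff (𝓡 d) (𝓡 d).tangent ∞
    (fun x => (⟨x, v x⟩ : TangentBundle (𝓡 d) X))
  smooth_u : ContMDiff (𝓡 d) 𝓘(ℝ, EuclideanSpace ℝ (Fin k)) ∞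
    (M' := EuclideanSpace ℝ (Fin k)) u
  compact_support : ∃ K : Set X, IsCompact K ∧ ∀ x ∉ K, v x = 0 ∧ u x = 0

/-- The transformation `(ψ_t^v, η_t^u)` of `X × M`, where `ψ_t^v` is the flow of `v` and
`η_t^u(x) = exp (t u(x))`: `(x, m) ↦ (ψ_t^v(x), η_t^u(ψ_t^v(x)) • m)`. -/
def act [IsManifold (𝓡 d) ∞ X] [SMul G M] (a : CurrentAlgebra d k X G) (t : ℝ)
    (z : X × M) : X × M :=
  (flow a.v t z.1, lieExp (t • a.u (flow a.v t z.1)) • z.2)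

/-- The lifting of `(ψ_t^v, η_t^u)` to the marked configurations, `ξ ↦ {a z | z ∈ ξ}`. -/
def actOmega [IsManifold (𝓡 d) ∞ X] [SMul G M] (a : CurrentAlgebra d k X G) (t : ℝ)
    (ξ : Configuration X M) : Configuration X M :=
  toConfiguration (act a t '' ξ.1)

/-- The directional derivative on the marked configuration space,
`d/dt F((ψ_t^v, η_t^u) ξ)` at `t = 0`. -/
def gradOmega [IsManifold (𝓡 d) ∞ X] [SMul G M] (a : CurrentAlgebra d k X G)
    (F : Configuration X M → ℝ) (ξ : Configuration X M) : ℝ :=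
  deriv (fun t : ℝ => F (actOmega a t ξ)) 0

/-- The differential of `φ` in the `X`-variable. By means of the Riemannian metric it is identified
with the gradient `∇^X φ`. -/
def dX (φ : X × M → ℝ) (z : X × M) : TangentSpace (𝓡 d) z.1 →L[ℝ] ℝ :=
  mfderiv (𝓡 d) 𝓘(ℝ, ℝ) (fun x => φ (x, z.2)) z.1

variable (k G) in
/-- The differential at the unit `e` of `G` of `g ↦ φ (x, g • m)`. By means of an inner product on
the Lie algebra it is identified with the gradient of `φ` in the mark. -/
def dG [SMul G M] (φ : X × M → ℝ) (z : X × M) : GroupLieAlgebra (𝓡 k) G →L[ℝ] ℝ :=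
  mfderiv (𝓡 k) 𝓘(ℝ, ℝ) (fun g : G => φ (z.1, g • z.2)) 1

/-- The directional derivative of a smooth function on `X × M` along `(v, u)`. -/
def gradXM [IsManifold (𝓡 d) ∞ X] [SMul G M] (a : CurrentAlgebra d k X G)
    (φ : X × M → ℝ) (z : X × M) : ℝ :=
  dX φ z (a.v z.1) + dG k G φ z (a.u z.1)

variable (d e k G) in
/-- The class `𝔇` of smooth functions on `X × M` that vanish outside of `K × M` for some compact
`K` and are bounded together with all their derivatives. (As `K` is compact, it amounts to the
same to bound the covariant derivatives of all orders and the iterated derivatives along all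
finite sequences of elements of the Lie algebra `CurrentAlgebra`.) -/
structure IsTest [IsManifold (𝓡 d) ∞ X] [SMul G M] (φ : X × M → ℝ) : Prop where
  smooth : ContMDiff ((𝓡 d).prod (𝓡 e)) 𝓘(ℝ, ℝ) ∞ φ
  support : ∃ K : Set X, IsCompact K ∧ ∀ z : X × M, z.1 ∉ K → φ z = 0
  bounded : ∀ l : List (CurrentAlgebra d k X G), ∃ C : ℝ, ∀ z : X × M,
    |l.foldr (fun a f => gradXM a f) φ z| ≤ C

/-- Smooth functions on `ℝ^N` that are bounded together with all their derivatives. -/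
def IsCbInfty {N : ℕ} (g : (Fin N → ℝ) → ℝ) : Prop :=
  ContDiff ℝ ∞ g ∧ ∀ j : ℕ, ∃ C : ℝ, ∀ r, ‖iteratedFDeriv ℝ j g r‖ ≤ C

variable (d e k G) in
/-- Smooth cylinder functions `F(ξ) = g(⟨φ_1, ξ⟩, …, ⟨φ_N, ξ⟩)` on the marked configuration
space. -/
def IsCylinder [IsManifold (𝓡 d) ∞ X] [SMul G M] (F : Configuration X M → ℝ) : Prop :=
  ∃ (N : ℕ) (φ : Fin N → X × M → ℝ) (g : (Fin N → ℝ) → ℝ),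
    (∀ i, IsTest d e k G (φ i)) ∧ IsCbInfty g ∧
      ∀ ξ, F ξ = g (fun i => pairing (φ i) ξ)

/-! ### Sobolev spaces on `X × M` -/

variable (d k X M G) in
/-- Fields of covectors on `X × M` with values in `(T_x X ∔ 𝔤)*`. -/
structure Covectors where
  onX : ∀ z : X × M, TangentSpace (𝓡 d) z.1 →L[ℝ] ℝ
  onG : X × M → GroupLieAlgebra (𝓡 k) G →L[ℝ] ℝ

/-- The pairing of a field of covectors with `(v, u)`. -/
def Covectors.apply [IsManifold (𝓡 d) ∞ X] (D : Covectors d k X M G) (a : CurrentAlgebra d k X G)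
    (z : X × M) : ℝ :=
  D.onX z (a.v z.1) + D.onG z (a.u z.1)

/-- The square of the Hilbert norm of a covector on the Lie algebra of `G`, for the inner product
on the Lie algebra that makes `b` orthonormal. -/
def normSqG (b : Module.Basis (Fin k) ℝ (GroupLieAlgebra (𝓡 k) G))
    (T : GroupLieAlgebra (𝓡 k) G →L[ℝ] ℝ) : ℝ :=
  ∑ i, (T (b i)) ^ 2

variable [RiemannianBundle (fun x : X => TangentSpace (𝓡 d) x)]
  [MeasurableSpace X] [MeasurableSpace M]

/-- `∫ (|∇^X φ - D_X|² + |∇^M φ - D_G|² + |φ - f|²) dν dlam`, where `ν` is the Riemannian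
volume: the square of the `H^{1,2}`-distance of a smooth `φ` from a function `f` with
gradient `D`. -/
def sobolevDistSq [SMul G M] (lam : Measure M)
    (b : Module.Basis (Fin k) ℝ (GroupLieAlgebra (𝓡 k) G)) (φ f : X × M → ℝ)
    (D : Covectors d k X M G) : ENNReal :=
  ∫⁻ z, ENNReal.ofReal (‖dX φ z - D.onX z‖ ^ 2 + normSqG b (dG k G φ z - D.onG z)
    + (φ z - f z) ^ 2) ∂((riemannianVolume d X).prod lam)

variable (e) in
/-- `f` belongs to the Sobolev space `H^{1,2}(X × M)` and its gradient is `D`: there are functions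
in `𝔇` of finite `H^{1,2}`-norm that converge to `f` in `L²` and whose gradients converge to
`D` in `L²`. -/
structure HasSobolevGradient [IsManifold (𝓡 d) ∞ X] [SMul G M] (lam : Measure M)
    (b : Module.Basis (Fin k) ℝ (GroupLieAlgebra (𝓡 k) G)) (f : X × M → ℝ)
    (D : Covectors d k X M G) : Prop where
  measurable_fun : AEMeasurable f ((riemannianVolume d X).prod lam)
  measurable_grad : ∀ a : CurrentAlgebra d k X G,
    AEMeasurable (D.apply a) ((riemannianVolume d X).prod lam)
  approx : ∃ φ : ℕ → X × M → ℝ, (∀ n, IsTest d e k G (φ n)) ∧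
    (∀ n, sobolevDistSq lam b (φ n) 0 (⟨fun _ => 0, fun _ => 0⟩ : Covectors d k X M G) < ⊤) ∧
    Tendsto (fun n => sobolevDistSq lam b (φ n) f D) atTop (𝓝 0)

variable (e) in
/-- `f` belongs to the local Sobolev space `H_0^{1,2}(X × M)` and its gradient is `D`: on each set
`K × M` with `K` compact, `f` coincides with a function in `H^{1,2}(X × M)`, and `D` with the
gradient of the latter. -/
def HasLocalSobolevGradient [IsManifold (𝓡 d) ∞ X] [SMul G M] (lam : Measure M)
    (b : Module.Basis (Fin k) ℝ (GroupLieAlgebra (𝓡 k) G)) (f : X × M → ℝ)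
    (D : Covectors d k X M G) : Prop :=
  ∀ K : Set X, IsCompact K → ∃ (h : X × M → ℝ) (E : Covectors d k X M G),
    HasSobolevGradient e lam b h E ∧
    ∀ᵐ z ∂((riemannianVolume d X).prod lam), z.1 ∈ K →
      f z = h z ∧ D.onX z = E.onX z ∧ D.onG z = E.onG z

/-! ### The measure on `X × M` and the logarithmic derivatives -/

variable (d) in
/-- The measure `ρ(x) p(x, m) ν(dx) lam(dm)` on `X × M`, where `ν` is the Riemannian volume. -/
def levyMeasure (lam : Measure M) (ρ : X → ℝ) (p : X → M → ℝ) : Measure (X × M) :=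
  ((riemannianVolume d X).prod lam).withDensity
    (fun z => ENNReal.ofReal (ρ z.1 * p z.1 z.2))

/-- `P` is a differentiable version of the Radon-Nikodym density of the translates of `lam`:
`P g m = d(g^* lam)/d lam (m)`, where `g^* lam` is the image of `lam` under `m ↦ g • m`. In
particular, `lam` is quasiinvariant under the action of `G`. -/
structure IsDifferentiableDensity [SMul G M] (lam : Measure M) (P : G → M → ℝ) : Prop where
  differentiable : MDifferentiable ((𝓡 k).prod (𝓡 e)) 𝓘(ℝ, ℝ) (fun y : G × M => P y.1 y.2)
  density : ∀ g : G, lam.map (fun m => g • m) =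
    lam.withDensity (fun m => ENNReal.ofReal (P g m))

/-- The differential of `P (·, m)` at the unit of `G`. -/
def dDensity (P : G → M → ℝ) (m : M) : GroupLieAlgebra (𝓡 k) G →L[ℝ] ℝ :=
  mfderiv (𝓡 k) 𝓘(ℝ, ℝ) (fun g : G => P g m) 1

/-- The logarithmic derivative along `(v, u)` of the measure with density `q` with respect to
`ν ⊗ lam`: the sum of
`β_v = ⟨∇^X q / q, v⟩ + div v` and `β_u = ⟨∇^M q / q, u⟩ + ⟨∇^G P(e, ·), -u⟩`.
Here `D` is the gradient of `q^{1/2}`, so that `∇ q = 2 q^{1/2} D`. -/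
def logDeriv [IsManifold (𝓡 d) ∞ X] (q : X × M → ℝ) (D : Covectors d k X M G) (P : G → M → ℝ)
    (a : CurrentAlgebra d k X G) (z : X × M) : ℝ :=
  (2 * Real.sqrt (q z) * D.onX z (a.v z.1) / q z + divX a.v z.1) +
    (2 * Real.sqrt (q z) * D.onG z (a.u z.1) / q z + dDensity P z.2 (-(a.u z.1)))

/-- The logarithmic derivative of the marked Poisson measure, `B(ξ) = ⟨β, ξ⟩`. -/
def logDerivPoisson [IsManifold (𝓡 d) ∞ X] (q : X × M → ℝ) (D : Covectors d k X M G)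
    (P : G → M → ℝ) (a : CurrentAlgebra d k X G) (ξ : Configuration X M) : ℝ :=
  pairing (logDeriv q D P a) ξ

variable (e) in
/-- `F` belongs to the domain of the adjoint in `L²(μ)` of the directional derivative along `a`
with domain the smooth cylinder functions, and the adjoint maps `F` to `H`. -/
def IsAdjointValue [IsManifold (𝓡 d) ∞ X] [SMul G M] (μ : Measure (Configuration X M))
    (a : CurrentAlgebra d k X G) (F H : Configuration X M → ℝ) : Prop :=
  MemLp F 2 μ ∧ MemLp H 2 μ ∧ ∀ F₁, IsCylinder d e k G F₁ →
    ∫ ξ, gradOmega a F₁ ξ * F ξ ∂μ = ∫ ξ, F₁ ξ * H ξ ∂μ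

end Calculus

end MarkedConfig

end

/-! Everything rests on a one-point formula: if f is smooth and bounded together with its
derivatives along v and u, then ∇f + fβ has integral zero with respect to σ
(`integral_gradXM_add_logDeriv`, abstracted as `IsLogDerivative`). Over the support of (v, u) one
has σ = h² ν ⊗ λ with h in the Sobolev space and 2h∇h = ∇q, and the directions v and u are treated
separately.

Along v, the divergence theorem on X (`integral_mfderiv_add_divX`) is applied to fφ² for a test
function φ and a fixed mark. Since div v is bounded, every term passes to the L² limit φ → h
(`HasSobolevGradient.integral_vPart`).

Along u this passage to the limit breaks down. The derivative of the density P at the unit plays the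
role of the divergence, but it is known to be integrable only against h², not against φ². So x is
fixed, and λ is averaged along the orbits of s ↦ exp(sY) with Y = u(x). The density of the
translates is a multiplicative cocycle; hence, on almost every orbit, w(s) = P(exp(-sY), m) is
positive and differentiable, and its logarithmic derivative is minus the derivative of P at the unit
along Y, taken at the point exp(sY)m (`IsDifferentiableDensity.orbit`). Along almost every orbit a
subsequence of the test functions converges in L¹ of the unit interval together with its
derivatives, so h has an absolutely continuous version there. One-dimensional integration by parts
for χfh²w then holds; in the approximation, squares are replaced by truncated squares that are
dominated by h² itself (`integral_unitInterval_byParts`). The cutoff χ(s) = s(1 - s) removes the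
boundary terms, and integrating over all orbits returns the desired integral multiplied by ∫χ = 1/6
(`IsDifferentiableDensity.integral_byParts`).

The passage to configurations is algebraic. On the n-point sector over a bounded Λ the Poisson law
is a multiple of a product measure, and the derivative of a cylinder function is the sum over the
points of one-point derivatives with the other points frozen. The one-point formula is applied to
one coordinate at a time (`IsLogDerivative.integral_tuple`) and gives that ∇F + FB has integral
zero; the claim is the case F = F₁F₂. A Campbell-type bound makes B integrable, and the second
moment of the number of points in Λ puts ∇F into L².

For the adjoint, B is merely integrable, so density of the cylinder functions in L² would not
suffice. What is used is that an integrable function orthogonal to all cylinder functions vanishes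
(`ae_eq_zero_of_forall_integral_cylinder`). -/

noncomputable section

namespace MarkedConfig

/-! ### One-dimensional integration by parts under weak integrability. -/

section Analysis

/-- Functions whose integrals tend to zero tend to zero almost everywhere along a subsequence. -/
lemma exists_subseq_ae_tendsto_zero {α : Type*} [MeasurableSpace α] {μ : Measure α}
    {f : ℕ → α → ENNReal} (hf : ∀ n, AEMeasurable (f n) μ)
    (h : Tendsto (fun n => ∫⁻ x, f n x ∂μ) atTop (𝓝 0)) :
    ∃ ns : ℕ → ℕ, StrictMono ns ∧ ∀ᵐ x ∂μ, Tendsto (fun j => f (ns j) x) atTop (𝓝 0) := by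
  have hev : ∀ j : ℕ, ∀ᶠ n in atTop, ∫⁻ x, f n x ∂μ ≤ (2⁻¹ : ENNReal) ^ j := fun j =>
    (h.eventually_lt_const (ENNReal.pow_pos (by simp) j)).mono fun n hn => hn.le
  obtain ⟨ns, hns, hle⟩ := extraction_forall_of_eventually' (fun j => (hev j).exists_forall_of_atTop)
  refine ⟨ns, hns, ?_⟩
  -- Borel–Cantelli: the integrals along the subsequence are bounded by a geometric series, so
  -- almost everywhere the values form a convergent series and tend to zero.
  have hsum : ∫⁻ x, ∑' j, f (ns j) x ∂μ ≠ ⊤ := by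
    rw [lintegral_tsum fun j => hf _]
    refine ne_top_of_le_ne_top ?_ (ENNReal.tsum_le_tsum hle)
    rw [ENNReal.tsum_geometric]
    simp
  filter_upwards [ae_lt_top' (AEMeasurable.tsum fun j => hf (ns j)) hsum] with x hx
  exact ENNReal.tendsto_atTop_zero_of_tsum_ne_top hx.ne

/-- A `C¹` approximation of the square, which vanishes near the origin. -/
def softSq (ε y : ℝ) : ℝ := max (y - ε) 0 ^ 2 + max (-y - ε) 0 ^ 2

/-- The derivative of `softSq`. -/
def softSq' (ε y : ℝ) : ℝ := 2 * max (y - ε) 0 - 2 * max (-y - ε) 0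

lemma hasDerivAt_max_zero_sq (y : ℝ) : HasDerivAt (fun y : ℝ => max y 0 ^ 2) (2 * max y 0) y := by
  rcases lt_trichotomy y 0 with hy | hy | hy
  · have : (fun y : ℝ => max y 0 ^ 2) =ᶠ[𝓝 y] fun _ => 0 := by
      filter_upwards [gt_mem_nhds hy] with z hz
      simp [max_eq_right hz.le]
    rw [max_eq_right hy.le, mul_zero]
    exact (hasDerivAt_const y 0).congr_of_eventuallyEq this
  · subst hy
    rw [hasDerivAt_iff_isLittleO_nhds_zero]
    simp only [zero_add, max_self, mul_zero, smul_zero, sub_zero, ne_eq, OfNat.ofNat_ne_zero,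
      not_false_eq_true, zero_pow]
    have h1 : (fun h : ℝ => max h 0 ^ 2) =O[𝓝 0] fun h : ℝ => h ^ 2 := by
      refine Asymptotics.IsBigO.of_bound 1 (Eventually.of_forall fun h => ?_)
      rw [norm_pow, norm_pow, one_mul]
      gcongr
      rcases le_total h 0 with h0 | h0 <;> simp [h0]
    refine h1.trans_isLittleO ?_
    simpa using Asymptotics.isLittleO_pow_id (𝕜 := ℝ) (n := 2) one_lt_two
  · have : (fun y : ℝ => max y 0 ^ 2) =ᶠ[𝓝 y] fun y => y ^ 2 := by
      filter_upwards [lt_mem_nhds hy] with z hz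
      simp [max_eq_left hz.le]
    rw [max_eq_left hy.le]
    simpa using (hasDerivAt_pow 2 y).congr_of_eventuallyEq this

lemma hasDerivAt_softSq (ε y : ℝ) : HasDerivAt (softSq ε) (softSq' ε y) y := by
  have h1 := (hasDerivAt_max_zero_sq (y - ε)).comp y ((hasDerivAt_id y).sub_const ε)
  have h2 := (hasDerivAt_max_zero_sq (-y - ε)).comp y ((hasDerivAt_id y).neg.sub_const ε)
  exact (h1.add h2).congr_deriv (by unfold softSq'; ring)

lemma continuous_softSq : Continuous fun z : ℝ × ℝ => softSq z.1 z.2 := by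
  unfold softSq; fun_prop

lemma continuous_softSq' : Continuous fun z : ℝ × ℝ => softSq' z.1 z.2 := by
  unfold softSq'; fun_prop

lemma softSq_zero (y : ℝ) : softSq 0 y = y ^ 2 := by
  unfold softSq
  rcases le_total y 0 with h | h <;> simp [h]

lemma softSq'_zero (y : ℝ) : softSq' 0 y = 2 * y := by
  unfold softSq'
  rcases le_total y 0 with h | h <;> simp [h]

/-- The truncation level equals the error of approximation: shrinking |y| by δ brings it below |z|.
The squares of the approximants are thus dominated by the square of the limit, with no additive
error left. The next lemma is the same statement for the derivative. -/
lemma abs_softSq_le {δ y z : ℝ} (h : |y - z| ≤ δ) : |softSq δ y| ≤ z ^ 2 := by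
  have h0 : 0 ≤ δ := (abs_nonneg _).trans h
  obtain ⟨h1, h2⟩ := abs_le.1 h
  unfold softSq
  rw [abs_of_nonneg (by positivity)]
  rcases le_total (y - δ) 0 with h3 | h3 <;> rcases le_total (-y - δ) 0 with h4 | h4 <;>
    simp only [h3, h4, max_eq_right, max_eq_left] <;> nlinarith

lemma abs_softSq'_le {δ y z : ℝ} (h : |y - z| ≤ δ) : |softSq' δ y| ≤ 2 * |z| := by
  have h0 : 0 ≤ δ := (abs_nonneg _).trans h
  obtain ⟨h1, h2⟩ := abs_le.1 h
  have h5 := le_abs_self z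
  have h6 := neg_abs_le z
  unfold softSq'
  rcases le_total (y - δ) 0 with h3 | h3 <;> rcases le_total (-y - δ) 0 with h4 | h4 <;>
    simp only [h3, h4, max_eq_right, max_eq_left] <;> rw [abs_le] <;> constructor <;> nlinarith

/-- The primitive of `r'` that approximates `φ` uniformly, with explicit error. -/
lemma abs_sub_primitive_le {φ φ' r r' : ℝ → ℝ} (hφ : ∀ s, HasDerivAt φ (φ' s) s)
    (hφ' : Continuous φ') (hr : IntegrableOn r (Set.Ioc 0 1)) (hr' : IntegrableOn r' (Set.Ioc 0 1))
    {s : ℝ} (hs : s ∈ Set.Icc (0 : ℝ) 1) :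
    |φ s - ((∫ t in (0 : ℝ)..1, (r t - ∫ x in (0 : ℝ)..t, r' x)) + ∫ x in (0 : ℝ)..s, r' x)| ≤
      (∫ t in Set.Ioc (0 : ℝ) 1, |φ t - r t|) + 2 * ∫ t in Set.Ioc (0 : ℝ) 1, |φ' t - r' t| := by
  have hφc : Continuous φ := continuous_iff_continuousAt.2 fun s => (hφ s).continuousAt
  have ir : IntervalIntegrable r volume 0 1 :=
    (intervalIntegrable_iff_integrableOn_Ioc_of_le zero_le_one).2 hr
  have ir' : IntervalIntegrable r' volume 0 1 :=
    (intervalIntegrable_iff_integrableOn_Ioc_of_le zero_le_one).2 hr'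
  have sub : ∀ t ∈ Set.Icc (0 : ℝ) 1, IntervalIntegrable r' volume 0 t := fun t ht =>
    ir'.mono_set (by rw [Set.uIcc_of_le ht.1, Set.uIcc_of_le zero_le_one]
                     exact Set.Icc_subset_Icc le_rfl ht.2)
  have ig' : IntegrableOn (fun t => φ' t - r' t) (Set.Ioc 0 1) :=
    ((hφ'.intervalIntegrable 0 1).1).sub hr'
  have ftc : ∀ t, ∫ x in (0 : ℝ)..t, φ' x = φ t - φ 0 := fun t =>
    intervalIntegral.integral_eq_sub_of_hasDerivAt (fun x _ => hφ x) (hφ'.intervalIntegrable _ _)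
  have prim : ∀ t ∈ Set.Icc (0 : ℝ) 1,
      ∫ x in (0 : ℝ)..t, (φ' x - r' x) = (φ t - φ 0) - ∫ x in (0 : ℝ)..t, r' x := fun t ht => by
    rw [intervalIntegral.integral_sub (hφ'.intervalIntegrable _ _) (sub t ht), ftc]
  have bnd : ∀ t ∈ Set.Icc (0 : ℝ) 1, |∫ x in (0 : ℝ)..t, (φ' x - r' x)| ≤
      ∫ t in Set.Ioc (0 : ℝ) 1, |φ' t - r' t| := fun t ht => by
    rw [intervalIntegral.integral_of_le ht.1]
    refine (abs_integral_le_integral_abs).trans ?_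
    exact setIntegral_mono_set ig'.abs (ae_of_all _ fun _ => abs_nonneg _)
      (Set.Ioc_subset_Ioc_right ht.2).eventuallyLE
  have cprim : ContinuousOn (fun t => ∫ x in (0 : ℝ)..t, r' x) (Set.uIcc 0 1) :=
    intervalIntegral.continuousOn_primitive_interval' ir' Set.left_mem_uIcc
  -- As `r` is only an integrable function, `r 0` means nothing. The constant of integration is the
  -- mean over t of r(t) - ∫₀ᵗ r', which is why the error in the derivative enters the bound twice:
  -- once through this mean and once through the primitive at `s`.
  have key : φ 0 - (∫ t in (0 : ℝ)..1, (r t - ∫ x in (0 : ℝ)..t, r' x)) =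
      ∫ t in (0 : ℝ)..1, ((φ t - r t) - ∫ x in (0 : ℝ)..t, (φ' x - r' x)) := by
    have h0 : φ 0 = ∫ t in (0 : ℝ)..1, φ 0 := by simp
    rw [h0, ← intervalIntegral.integral_sub (by simp) (ir.sub cprim.intervalIntegrable)]
    refine intervalIntegral.integral_congr fun t ht => ?_
    rw [Set.uIcc_of_le zero_le_one] at ht
    simp only [prim t ht]
    ring
  have e1 : φ s - ((∫ t in (0 : ℝ)..1, (r t - ∫ x in (0 : ℝ)..t, r' x)) + ∫ x in (0 : ℝ)..s, r' x)
      = (∫ t in (0 : ℝ)..1, ((φ t - r t) - ∫ x in (0 : ℝ)..t, (φ' x - r' x))) +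
        ∫ x in (0 : ℝ)..s, (φ' x - r' x) := by
    rw [← key, prim s hs]; ring
  have cp2 : ContinuousOn (fun t => ∫ x in (0 : ℝ)..t, (φ' x - r' x)) (Set.uIcc 0 1) :=
    intervalIntegral.continuousOn_primitive_interval'
      ((hφ'.intervalIntegrable 0 1).sub ir') Set.left_mem_uIcc
  rw [e1, intervalIntegral.integral_sub ((hφc.intervalIntegrable 0 1).sub ir)
    cp2.intervalIntegrable]
  have e2 : |∫ t in (0 : ℝ)..1, (φ t - r t)| ≤ ∫ t in Set.Ioc (0 : ℝ) 1, |φ t - r t| := by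
    rw [intervalIntegral.integral_of_le zero_le_one]
    exact abs_integral_le_integral_abs
  have e3 : |∫ t in (0 : ℝ)..1, ∫ x in (0 : ℝ)..t, (φ' x - r' x)| ≤
      ∫ t in Set.Ioc (0 : ℝ) 1, |φ' t - r' t| := by
    have := intervalIntegral.norm_integral_le_of_norm_le_const (a := (0 : ℝ)) (b := 1)
      (f := fun t => ∫ x in (0 : ℝ)..t, (φ' x - r' x)) (C := ∫ t in Set.Ioc (0 : ℝ) 1, |φ' t - r' t|)
      (fun t ht => by
        rw [Set.uIoc_of_le zero_le_one] at ht
        exact bnd t ⟨ht.1.le, ht.2⟩)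
    simpa using this
  have e4 := bnd s hs
  have := abs_add_le ((∫ t in (0 : ℝ)..1, (φ t - r t)) -
    ∫ t in (0 : ℝ)..1, ∫ x in (0 : ℝ)..t, (φ' x - r' x)) (∫ x in (0 : ℝ)..s, (φ' x - r' x))
  have := abs_sub (∫ t in (0 : ℝ)..1, (φ t - r t))
    (∫ t in (0 : ℝ)..1, ∫ x in (0 : ℝ)..t, (φ' x - r' x))
  linarith

set_option maxHeartbeats 1000000 in
/-- Integration by parts on the unit interval for the product of `χ f`, of the square of an
`L¹`-limit `r` of differentiable functions, and of an everywhere differentiable function `w`. It is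
not assumed that the derivative of `w` is integrable: it suffices that `r² w'` is. -/
lemma integral_unitInterval_byParts {φ φ' : ℕ → ℝ → ℝ} {r r' f f' w w' χ χ' : ℝ → ℝ}
    (hφ : ∀ n s, HasDerivAt (φ n) (φ' n s) s) (hφ' : ∀ n, Continuous (φ' n))
    (hr : IntegrableOn r (Set.Ioc 0 1)) (hr' : IntegrableOn r' (Set.Ioc 0 1))
    (hφr : Tendsto (fun n => ∫ s in Set.Ioc (0 : ℝ) 1, |φ n s - r s|) atTop (𝓝 0))
    (hφr' : Tendsto (fun n => ∫ s in Set.Ioc (0 : ℝ) 1, |φ' n s - r' s|) atTop (𝓝 0))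
    (hf : ∀ s, HasDerivAt f (f' s) s) (hf' : Continuous f')
    (hw : ∀ s, HasDerivAt w (w' s) s)
    (hχ : ∀ s, HasDerivAt χ (χ' s) s) (hχ' : Continuous χ') (hχ0 : χ 0 = 0) (hχ1 : χ 1 = 0)
    (hrw : IntegrableOn (fun s => r s ^ 2 * w' s) (Set.Ioc 0 1)) :
    ∫ s in Set.Ioc (0 : ℝ) 1, (χ s * (f' s * r s ^ 2 * w s + 2 * f s * r s * r' s * w s
      + f s * r s ^ 2 * w' s) + χ' s * (f s * r s ^ 2 * w s)) = 0 := by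
  set τ : Measure ℝ := volume.restrict (Set.Ioc (0 : ℝ) 1) with hτ
  set R : ℝ → ℝ := fun s => (∫ t in (0 : ℝ)..1, (r t - ∫ x in (0 : ℝ)..t, r' x)) +
    ∫ x in (0 : ℝ)..s, r' x with hR
  set δ : ℕ → ℝ := fun n => (∫ t, |φ n t - r t| ∂τ) + 2 * ∫ t, |φ' n t - r' t| ∂τ with hδ
  have δ0 : Tendsto δ atTop (𝓝 0) := by simpa using hφr.add (hφr'.const_mul 2)
  have unif : ∀ n, ∀ s ∈ Set.Icc (0 : ℝ) 1, |φ n s - R s| ≤ δ n := fun n s hs =>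
    abs_sub_primitive_le (hφ n) (hφ' n) hr hr' hs
  have hfc : Continuous f := continuous_iff_continuousAt.2 fun s => (hf s).continuousAt
  have hwc : Continuous w := continuous_iff_continuousAt.2 fun s => (hw s).continuousAt
  have hχc : Continuous χ := continuous_iff_continuousAt.2 fun s => (hχ s).continuousAt
  have hφc : ∀ n, Continuous (φ n) := fun n =>
    continuous_iff_continuousAt.2 fun s => (hφ n s).continuousAt
  have hwm : Measurable w' := by
    have : w' = deriv w := funext fun s => (hw s).deriv.symm
    rw [this]; exact measurable_deriv w
  have hRc : ContinuousOn R (Set.Icc 0 1) := by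
    rw [← Set.uIcc_of_le (zero_le_one (α := ℝ))]
    exact continuousOn_const.add (intervalIntegral.continuousOn_primitive_interval'
      ((intervalIntegrable_iff_integrableOn_Ioc_of_le zero_le_one).2 hr') Set.left_mem_uIcc)
  have memτ : ∀ᵐ s ∂τ, s ∈ Set.Icc (0 : ℝ) 1 :=
    (ae_restrict_mem measurableSet_Ioc).mono fun s hs => ⟨hs.1.le, hs.2⟩
  have : IsFiniteMeasure τ := ⟨by simp [hτ]⟩
  have icont : ∀ g : ℝ → ℝ, ContinuousOn g (Set.Icc 0 1) → Integrable g τ := fun g hg =>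
    (hg.integrableOn_Icc).mono_set Set.Ioc_subset_Icc_self
  -- multiplication of an integrable function by a continuous one
  have imul : ∀ g h : ℝ → ℝ, ContinuousOn g (Set.Icc 0 1) → Integrable h τ →
      Integrable (fun s => g s * h s) τ := fun g h hg hh => by
    obtain ⟨C, hC⟩ := isCompact_Icc.exists_bound_of_continuousOn hg
    exact hh.bdd_mul (icont g hg).aestronglyMeasurable (memτ.mono fun s hs => hC s hs)
  -- `R` is the absolutely continuous version of `r`: the `φ n` tend to `R` uniformly and to `r` in
  -- L¹.
  have RR : ∀ᵐ s ∂τ, R s = r s := by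
    have hint : Integrable (fun s => R s - r s) τ := (icont R hRc).sub hr
    have h0 : ∫ s, |R s - r s| ∂τ = 0 := by
      refine le_antisymm ?_ (integral_nonneg fun _ => abs_nonneg _)
      refine ge_of_tendsto' (x := atTop) (f := fun n => δ n + ∫ s, |φ n s - r s| ∂τ)
        (by simpa using δ0.add hφr) fun n => ?_
      have i2 : Integrable (fun s => |φ n s - r s|) τ :=
        ((icont _ (hφc n).continuousOn).sub hr).abs
      have h1 : ∫ s, |R s - r s| ∂τ ≤ ∫ s, (δ n + |φ n s - r s|) ∂τ := by
        refine integral_mono_ae hint.abs ((integrable_const _).add i2) ?_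
        filter_upwards [memτ] with s hs
        have h2 := unif n s hs
        rw [abs_sub_comm] at h2
        have h3 := abs_sub_le (R s) (φ n s) (r s)
        linarith
      rw [integral_add (integrable_const _) i2] at h1
      simpa [hτ] using h1
    have := (integral_eq_zero_iff_of_nonneg (fun _ => abs_nonneg _) hint.abs).1 h0
    filter_upwards [this] with s hs
    simpa [sub_eq_zero] using hs
  have iRw : Integrable (fun s => R s ^ 2 * w' s) τ := by
    refine hrw.congr ?_
    filter_upwards [RR] with s hs
    rw [hs]
  -- the truncated products
  set P : ℕ → ℝ → ℝ := fun n s => (χ' s * f s + χ s * f' s) * softSq (δ n) (φ n s) * w s +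
    χ s * f s * (softSq' (δ n) (φ n s) * r' s) * w s + χ s * f s * (softSq (δ n) (φ n s) * w' s)
    with hP
  -- In the derivative of χ · f · softSq(φₙ) · w, the factor φₙ' is written as r' + (φₙ' - r'). `P
  -- n` keeps r' and is handled by dominated convergence; `Q n` carries the error and tends to zero
  -- in L¹.
  set Q : ℕ → ℝ → ℝ := fun n s => χ s * f s * (softSq' (δ n) (φ n s) * (φ' n s - r' s)) * w s
    with hQ
  have cs : ∀ n, Continuous fun s => softSq (δ n) (φ n s) := fun n =>
    continuous_softSq.comp (continuous_const.prodMk (hφc n))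
  have cs' : ∀ n, Continuous fun s => softSq' (δ n) (φ n s) := fun n =>
    continuous_softSq'.comp (continuous_const.prodMk (hφc n))
  -- Here the truncation is indispensable: `w'` need not be integrable, nor need φₙ² w' be, but the
  -- truncated square is at most R², and R² w' is integrable by hypothesis.
  have iw : ∀ n, Integrable (fun s => softSq (δ n) (φ n s) * w' s) τ := fun n => by
    refine iRw.mono ((cs n).aestronglyMeasurable.mul hwm.aestronglyMeasurable) ?_
    filter_upwards [memτ] with s hs
    rw [norm_mul, norm_mul]
    gcongr
    rw [Real.norm_eq_abs, Real.norm_eq_abs, abs_of_nonneg (sq_nonneg (R s))]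
    exact abs_softSq_le (unif n s hs)
  have iP : ∀ n, Integrable (P n) τ := fun n => by
    refine ((icont _ ?_).add ?_).add ?_
    · exact Continuous.continuousOn (by have := cs n; fun_prop)
    · have := imul (fun s => χ s * f s * softSq' (δ n) (φ n s) * w s) r'
        (Continuous.continuousOn (by have := cs' n; fun_prop)) hr'
      exact this.congr (ae_of_all _ fun s => by ring)
    · exact imul _ _ (by fun_prop) (iw n)
  have iQ : ∀ n, Integrable (Q n) τ := fun n => by
    have := imul (fun s => χ s * f s * softSq' (δ n) (φ n s) * w s) (fun s => φ' n s - r' s)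
      (Continuous.continuousOn (by have := cs' n; fun_prop))
      ((icont _ (hφ' n).continuousOn).sub hr')
    exact this.congr (ae_of_all _ fun s => by simp only [hQ]; ring)
  have ftc : ∀ n, (∫ s, P n s ∂τ) + ∫ s, Q n s ∂τ = 0 := fun n => by
    rw [← integral_add (iP n) (iQ n), hτ, ← intervalIntegral.integral_of_le zero_le_one]
    have hd : ∀ s, HasDerivAt (fun s => χ s * f s * softSq (δ n) (φ n s) * w s)
        (P n s + Q n s) s := fun s => by
      refine ((((hχ s).mul (hf s)).mul ((hasDerivAt_softSq (δ n) (φ n s)).comp s (hφ n s))).mul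
        (hw s)).congr_deriv ?_
      simp only [hP, hQ, Pi.mul_apply, Function.comp]
      ring
    -- The derivative is not continuous, so this is the fundamental theorem for a function that is
    -- differentiable everywhere with an integrable derivative. The boundary terms vanish with χ.
    rw [intervalIntegral.integral_eq_sub_of_hasDerivAt (fun s _ => hd s)
      ((intervalIntegrable_iff_integrableOn_Ioc_of_le zero_le_one).2 ((iP n).add (iQ n)))]
    simp [hχ0, hχ1]
  have limQ : Tendsto (fun n => ∫ s, Q n s ∂τ) atTop (𝓝 0) := by
    have hb : ContinuousOn (fun s => χ s * f s * (2 * |R s|) * w s) (Set.Icc 0 1) :=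
      ((by fun_prop : ContinuousOn (fun s => χ s * f s) (Set.Icc 0 1)).mul
        (continuousOn_const.mul hRc.abs)).mul hwc.continuousOn
    obtain ⟨C, hC⟩ := isCompact_Icc.exists_bound_of_continuousOn hb
    refine squeeze_zero_norm (a := fun n => C * ∫ s, |φ' n s - r' s| ∂τ) (fun n => ?_)
      (by simpa using hφr'.const_mul C)
    rw [← integral_const_mul]
    refine norm_integral_le_of_norm_le
      ((((icont _ (hφ' n).continuousOn).sub hr').abs).const_mul C) ?_
    filter_upwards [memτ] with s hs
    have h1 := hC s hs
    have h2 := abs_softSq'_le (unif n s hs)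
    simp only [hQ, Real.norm_eq_abs, abs_mul] at h1 ⊢
    calc |χ s| * |f s| * (|softSq' (δ n) (φ n s)| * |φ' n s - r' s|) * |w s|
        ≤ |χ s| * |f s| * ((2 * |R s|) * |φ' n s - r' s|) * |w s| := by gcongr
      _ = (|χ s| * |f s| * (|2| * |(|R s|)|) * |w s|) * |φ' n s - r' s| := by
          rw [abs_abs, abs_two]; ring
      _ ≤ C * |φ' n s - r' s| := by gcongr
  have limP : Tendsto (fun n => ∫ s, P n s ∂τ) atTop (𝓝 (∫ s,
      ((χ' s * f s + χ s * f' s) * R s ^ 2 * w s + χ s * f s * (2 * R s * r' s) * w s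
        + χ s * f s * (R s ^ 2 * w' s)) ∂τ)) := by
    refine tendsto_integral_of_dominated_convergence
      (fun s => |χ' s * f s + χ s * f' s| * R s ^ 2 * |w s| +
        |χ s * f s| * (2 * |R s|) * |w s| * |r' s| + |χ s * f s| * |R s ^ 2 * w' s|)
      (fun n => (iP n).aestronglyMeasurable) ?_ ?_ ?_
    · refine ((icont _ ?_).add (imul _ _ ?_ hr'.abs)).add (imul _ _ ?_ iRw.abs)
      · exact ((by fun_prop : ContinuousOn (fun s => |χ' s * f s + χ s * f' s|) (Set.Icc 0 1)).mul
          (hRc.pow 2)).mul hwc.abs.continuousOn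
      · exact ((by fun_prop : ContinuousOn (fun s => |χ s * f s|) (Set.Icc 0 1)).mul
          (continuousOn_const.mul hRc.abs)).mul hwc.abs.continuousOn
      · fun_prop
    · intro n
      filter_upwards [memτ] with s hs
      have h1 := abs_softSq_le (unif n s hs)
      have h2 := abs_softSq'_le (unif n s hs)
      refine (norm_add₃_le).trans ?_
      simp only [Real.norm_eq_abs, abs_mul]
      gcongr ?_ + ?_ + ?_
      · gcongr
      · calc |χ s| * |f s| * (|softSq' (δ n) (φ n s)| * |r' s|) * |w s|
            ≤ |χ s| * |f s| * ((2 * |R s|) * |r' s|) * |w s| := by gcongr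
          _ = _ := by ring
      · rw [abs_of_nonneg (sq_nonneg (R s))]
        gcongr
    · filter_upwards [memτ] with s hs
      have hlim : Tendsto (fun n => φ n s) atTop (𝓝 (R s)) := by
        rw [tendsto_iff_norm_sub_tendsto_zero]
        exact squeeze_zero (fun _ => norm_nonneg _) (fun n => unif n s hs) δ0
      have h1 : Tendsto (fun n => softSq (δ n) (φ n s)) atTop (𝓝 (R s ^ 2)) := by
        rw [← softSq_zero]
        exact (continuous_softSq.tendsto (0, R s)).comp (δ0.prodMk_nhds hlim)
      have h2 : Tendsto (fun n => softSq' (δ n) (φ n s)) atTop (𝓝 (2 * R s)) := by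
        rw [← softSq'_zero]
        exact (continuous_softSq'.tendsto (0, R s)).comp (δ0.prodMk_nhds hlim)
      have h3 := (h1.const_mul (χ' s * f s + χ s * f' s)).mul_const (w s)
      have h4 := ((h2.mul_const (r' s)).const_mul (χ s * f s)).mul_const (w s)
      have h5 := (h1.mul_const (w' s)).const_mul (χ s * f s)
      exact (h3.add h4).add h5
  have lim := limP.add limQ
  simp only [ftc, add_zero] at lim
  rw [← tendsto_nhds_unique lim tendsto_const_nhds]
  refine integral_congr_ae ?_
  filter_upwards [RR] with s hs
  rw [hs]
  ring

end Analysis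

/-! ### Vector fields in charts and completeness of compactly supported fields. -/

section Charts

variable {n : ℕ} {Y : Type*} [TopologicalSpace Y] [ChartedSpace (EuclideanSpace ℝ (Fin n)) Y]
  [IsManifold (𝓡 n) ∞ Y]

lemma mdifferentiableAt_chart_symm (c : Y) {y : EuclideanSpace ℝ (Fin n)}
    (hy : y ∈ (extChartAt (𝓡 n) c).target) :
    MDifferentiableAt (𝓡 n) (𝓡 n) (extChartAt (𝓡 n) c).symm y :=
  ((contMDiffOn_extChartAt_symm (I := 𝓡 n) (n := ∞) c).contMDiffAt
    ((isOpen_extChartAt_target c).mem_nhds hy)).mdifferentiableAt (by simp)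

lemma mdifferentiableAt_chart (c : Y) {p : Y} (hp : p ∈ (extChartAt (𝓡 n) c).source) :
    MDifferentiableAt (𝓡 n) (𝓡 n) (extChartAt (𝓡 n) c) p :=
  ((contMDiffOn_extChartAt (I := 𝓡 n) (n := ∞) (x := c)).contMDiffAt
    ((by simpa using (chartAt _ c).open_source.mem_nhds (by simpa using hp)))).mdifferentiableAt
      (by simp)

lemma mfderiv_chart_symm_mfderiv_chart (c : Y) {y : EuclideanSpace ℝ (Fin n)}
    (hy : y ∈ (extChartAt (𝓡 n) c).target)
    (w : TangentSpace (𝓡 n) ((extChartAt (𝓡 n) c).symm y)) :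
    mfderiv (𝓡 n) (𝓡 n) (extChartAt (𝓡 n) c).symm y
      (mfderiv (𝓡 n) (𝓡 n) (extChartAt (𝓡 n) c) ((extChartAt (𝓡 n) c).symm y) w) = w := by
  have h := mfderivWithin_extChartAt_symm_comp_mfderiv_extChartAt (I := 𝓡 n) hy
  rw [ModelWithCorners.range_eq_univ, mfderivWithin_univ] at h
  exact DFunLike.congr_fun h w

lemma mfderiv_chart_mfderiv_chart_symm (c : Y) {y : EuclideanSpace ℝ (Fin n)}
    (hy : y ∈ (extChartAt (𝓡 n) c).target) (w : EuclideanSpace ℝ (Fin n)) :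
    mfderiv (𝓡 n) (𝓡 n) (extChartAt (𝓡 n) c) ((extChartAt (𝓡 n) c).symm y)
      (mfderiv (𝓡 n) (𝓡 n) (extChartAt (𝓡 n) c).symm y w) = w := by
  have h := mfderiv_extChartAt_comp_mfderivWithin_extChartAt_symm (I := 𝓡 n) hy
  rw [ModelWithCorners.range_eq_univ, mfderivWithin_univ] at h
  exact DFunLike.congr_fun h w

lemma mfderiv_chart_symm_coords (v : ∀ y : Y, TangentSpace (𝓡 n) y) (c : Y)
    {y : EuclideanSpace ℝ (Fin n)} (hy : y ∈ (extChartAt (𝓡 n) c).target) :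
    mfderiv (𝓡 n) (𝓡 n) (extChartAt (𝓡 n) c).symm y (coords v c y) =
      v ((extChartAt (𝓡 n) c).symm y) :=
  mfderiv_chart_symm_mfderiv_chart c hy _

/-- The components of a vector field of class `C^m` in a chart are of class `C^m`. -/
lemma contDiffOn_coords {m : ℕ∞} {v : ∀ y : Y, TangentSpace (𝓡 n) y}
    (hv : ContMDiff (𝓡 n) (𝓡 n).tangent m (fun x => (⟨x, v x⟩ : TangentBundle (𝓡 n) Y))) (c : Y) :
    ContDiffOn ℝ m (coords v c) (extChartAt (𝓡 n) c).target := by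
  have h1 : ContMDiffOn (𝓡 n).tangent (𝓡 n).tangent m
      (tangentMapWithin (𝓡 n) (𝓡 n) (extChartAt (𝓡 n) c) (chartAt (EuclideanSpace ℝ (Fin n)) c).source)
      (π (EuclideanSpace ℝ (Fin n)) (TangentSpace (𝓡 n)) ⁻¹'
        (chartAt (EuclideanSpace ℝ (Fin n)) c).source) :=
    (contMDiffOn_extChartAt (I := 𝓡 n) (n := ∞) (x := c)).contMDiffOn_tangentMapWithin
      (by exact_mod_cast le_top) (chartAt _ c).open_source.uniqueMDiffOn
  have h2 : ContMDiffOn (𝓡 n) (𝓡 n).tangent m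
      (fun y => (⟨(extChartAt (𝓡 n) c).symm y, v ((extChartAt (𝓡 n) c).symm y)⟩ :
        TangentBundle (𝓡 n) Y)) (extChartAt (𝓡 n) c).target :=
    hv.comp_contMDiffOn (contMDiffOn_extChartAt_symm (I := 𝓡 n) (n := m) c)
  have h3 := (contMDiff_snd_tangentBundle_modelSpace (𝕜 := ℝ) (n := m)
    (EuclideanSpace ℝ (Fin n)) (𝓡 n)).comp_contMDiffOn
    (h1.comp h2 fun y hy => by simpa using (extChartAt (𝓡 n) c).map_target hy)
  rw [← contMDiffOn_iff_contDiffOn]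
  refine h3.congr fun y hy => ?_
  have hs : (extChartAt (𝓡 n) c).symm y ∈ (chartAt (EuclideanSpace ℝ (Fin n)) c).source := by
    simpa using (extChartAt (𝓡 n) c).map_target hy
  simp only [Function.comp, tangentMapWithin, coords]
  rw [mfderivWithin_of_isOpen (chartAt _ c).open_source hs]

/-- A solution of an ordinary differential equation in a chart gives an integral curve. -/
lemma isMIntegralCurveOn_of_coords {v : ∀ y : Y, TangentSpace (𝓡 n) y} (c : Y)
    {α : ℝ → EuclideanSpace ℝ (Fin n)} {J : Set ℝ}
    (hα : ∀ t ∈ J, HasDerivAt α (coords v c (α t)) t)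
    (hJ : ∀ t ∈ J, α t ∈ (extChartAt (𝓡 n) c).target) :
    IsMIntegralCurveOn ((extChartAt (𝓡 n) c).symm ∘ α) v J := by
  intro t ht
  refine HasMFDerivAt.hasMFDerivWithinAt ?_
  have h1 := (mdifferentiableAt_chart_symm c (hJ t ht)).hasMFDerivAt
  have h2 : HasMFDerivAt 𝓘(ℝ, ℝ) (𝓡 n) α t
      ((1 : ℝ →L[ℝ] ℝ).smulRight (coords v c (α t))) :=
    (hα t ht).hasFDerivAt.hasMFDerivAt
  refine (h1.comp t h2).congr_mfderiv ?_
  ext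
  have h3 := mfderiv_chart_symm_coords v c (hJ t ht)
  simp only [Function.comp] at h3 ⊢
  rw [← h3]
  exact map_smul (mfderiv (𝓡 n) (𝓡 n) (extChartAt (𝓡 n) c).symm (α t))
    ((1 : ℝ →L[ℝ] ℝ) 1) (coords v c (α t))

/-- Integral curves exist for a time that is locally uniform in the initial point. -/
lemma exists_nhds_isMIntegralCurveOn {v : ∀ y : Y, TangentSpace (𝓡 n) y}
    (hv : ContMDiff (𝓡 n) (𝓡 n).tangent 1 (fun x => (⟨x, v x⟩ : TangentBundle (𝓡 n) Y))) (x₀ : Y) :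
    ∃ U ∈ 𝓝 x₀, ∃ ε > 0, ∀ x ∈ U, ∃ γ : ℝ → Y, γ 0 = x ∧
      IsMIntegralCurveOn γ v (Set.Ioo (-ε) ε) := by
  have ht := isOpen_extChartAt_target (I := 𝓡 n) x₀
  have hy₀ := mem_extChartAt_target (I := 𝓡 n) x₀
  set φ := extChartAt (𝓡 n) x₀ with hφ
  have hV : ContDiffAt ℝ 1 (coords v x₀) (φ x₀) :=
    (contDiffOn_coords (m := 1) hv x₀).contDiffAt (ht.mem_nhds hy₀)
  obtain ⟨ε, hε, a, r, L, K, hr, hpl⟩ := IsPicardLindelof.of_contDiffAt_one hV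
  obtain ⟨α, hα, hαc⟩ :=
    (hpl 0).exists_forall_mem_closedBall_eq_hasDerivWithinAt_continuousOn
  simp only [zero_sub, zero_add] at hα hαc
  have hr' : (0 : ℝ) < r := hr
  have hnhds : Metric.closedBall (φ x₀) r ×ˢ Set.Icc (-ε) ε ∈ 𝓝 (φ x₀, (0 : ℝ)) :=
    prod_mem_nhds (Metric.closedBall_mem_nhds _ hr') (Icc_mem_nhds (by linarith) hε)
  have hcont := (hαc.continuousAt hnhds)
  have h0 : α (φ x₀, 0) = φ x₀ := (hα _ (Metric.mem_closedBall_self hr'.le)).1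
  -- Joint continuity of the local flow in initial point and time gives one neighbourhood and one
  -- time span for which the solutions stay inside the chart.
  have hpre : α ⁻¹' φ.target ∈ 𝓝 (φ x₀, (0 : ℝ)) :=
    hcont.preimage_mem_nhds (by rw [h0]; exact ht.mem_nhds hy₀)
  rw [nhds_prod_eq, mem_prod_iff] at hpre
  obtain ⟨B, hB, T, hT, hBT⟩ := hpre
  obtain ⟨ε', hε', hT'⟩ := Metric.mem_nhds_iff.1 hT
  have hφc : ContinuousAt φ x₀ := continuousAt_extChartAt x₀
  refine ⟨φ ⁻¹' (B ∩ Metric.closedBall (φ x₀) r) ∩ φ.source,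
    inter_mem (hφc.preimage_mem_nhds (inter_mem hB (Metric.closedBall_mem_nhds _ hr')))
      (extChartAt_source_mem_nhds x₀), min ε ε', lt_min hε hε', fun x hx => ?_⟩
  obtain ⟨⟨hxB, hxr⟩, hxs⟩ := hx
  refine ⟨φ.symm ∘ fun t => α (φ x, t), ?_, isMIntegralCurveOn_of_coords x₀ ?_ ?_⟩
  · simp only [Function.comp]
    rw [(hα _ hxr).1, φ.left_inv hxs]
  · intro t ht
    have h1 : -ε < t := by have := min_le_left ε ε'; linarith [ht.1]
    have h2 : t < ε := ht.2.trans_le (min_le_left _ _)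
    exact ((hα _ hxr).2 t ⟨h1.le, h2.le⟩).hasDerivAt (Icc_mem_nhds h1 h2)
  · intro t ht
    refine hBT ⟨hxB, hT' ?_⟩
    rw [Metric.mem_ball, dist_zero_right, Real.norm_eq_abs, abs_lt]
    have := min_le_right ε ε'
    exact ⟨by linarith [ht.1], by linarith [ht.2]⟩

/-- A vector field with compact support is complete. -/
lemma exists_isMIntegralCurve_of_compactSupport [T2Space Y] {v : ∀ y : Y, TangentSpace (𝓡 n) y}
    (hv : ContMDiff (𝓡 n) (𝓡 n).tangent 1 (fun x => (⟨x, v x⟩ : TangentBundle (𝓡 n) Y)))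
    {K : Set Y} (hK : IsCompact K) (hvK : ∀ x ∉ K, v x = 0) (x : Y) :
    ∃ γ : ℝ → Y, γ 0 = x ∧ IsMIntegralCurve γ v := by
  have : IsManifold (𝓡 n) 1 Y := IsManifold.of_le (n := ∞) (by exact_mod_cast le_top)
  choose U hU ε hε hγ using fun x₀ => exists_nhds_isMIntegralCurveOn hv x₀
  -- A finite cover of `K` gives a uniform existence time; outside `K` the constant curves are
  -- integral curves. A uniform existence time implies completeness.
  obtain ⟨t, -, ht⟩ := hK.elim_nhds_subcover U fun x _ => hU x
  obtain ⟨δ, hδ, hδt⟩ : ∃ δ > 0, ∀ i ∈ t, δ ≤ ε i := by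
    rcases t.eq_empty_or_nonempty with rfl | hne
    · exact ⟨1, one_pos, by simp⟩
    · obtain ⟨i, hi, hmin⟩ := t.exists_min_image ε hne
      exact ⟨ε i, hε i, hmin⟩
  refine exists_isMIntegralCurve_of_isMIntegralCurveOn hv hδ (fun y => ?_) x
  by_cases hy : y ∈ K
  · obtain ⟨i, hi, hyi⟩ := Set.mem_iUnion₂.1 (ht hy)
    obtain ⟨γ, h0, hγ'⟩ := hγ i y hyi
    have := hδt i hi
    exact ⟨γ, h0, hγ'.mono (Set.Ioo_subset_Ioo (by linarith) this)⟩
  · exact ⟨fun _ => y, rfl, (isMIntegralCurve_const (hvK y hy)).isMIntegralCurveOn _⟩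

end Charts

/-! ### Flows of complete vector fields. -/

section Flow

variable {n : ℕ} {Y : Type*} [TopologicalSpace Y] [ChartedSpace (EuclideanSpace ℝ (Fin n)) Y]
  [IsManifold (𝓡 n) ∞ Y] [T2Space Y] {v : ∀ y : Y, TangentSpace (𝓡 n) y}

/-- The defining property of the flow of a complete vector field. -/
lemma flow_spec {x : Y} (h : ∃ γ : ℝ → Y, γ 0 = x ∧ IsMIntegralCurve γ v) :
    flow v 0 x = x ∧ IsMIntegralCurve (fun t => flow v t x) v := by
  have e : (fun t => flow v t x) = h.choose := funext fun t => by simp [flow, h]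
  refine ⟨?_, e ▸ h.choose_spec.2⟩
  exact (congrFun e 0).trans h.choose_spec.1

lemma isMIntegralCurve_eq
    (hv : ContMDiff (𝓡 n) (𝓡 n).tangent 1 (fun x => (⟨x, v x⟩ : TangentBundle (𝓡 n) Y)))
    {γ γ' : ℝ → Y} (hγ : IsMIntegralCurve γ v) (hγ' : IsMIntegralCurve γ' v) {t : ℝ}
    (h : γ t = γ' t) : γ = γ' :=
  have : IsManifold (𝓡 n) 1 Y := IsManifold.of_le (n := ∞) (by exact_mod_cast le_top)
  isMIntegralCurve_Ioo_eq_of_contMDiff_boundaryless hv hγ hγ' h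

lemma flow_injective
    (hv : ContMDiff (𝓡 n) (𝓡 n).tangent 1 (fun x => (⟨x, v x⟩ : TangentBundle (𝓡 n) Y)))
    (hc : ∀ x, ∃ γ : ℝ → Y, γ 0 = x ∧ IsMIntegralCurve γ v) (t : ℝ) :
    Function.Injective (flow v t) := fun x y h => by
  have := congrFun (isMIntegralCurve_eq hv (flow_spec (hc x)).2 (flow_spec (hc y)).2 h) 0
  simpa only [(flow_spec (hc x)).1, (flow_spec (hc y)).1] using this

lemma flow_eq_self
    (hv : ContMDiff (𝓡 n) (𝓡 n).tangent 1 (fun x => (⟨x, v x⟩ : TangentBundle (𝓡 n) Y)))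
    (hc : ∀ x, ∃ γ : ℝ → Y, γ 0 = x ∧ IsMIntegralCurve γ v) {x : Y} (hx : v x = 0) (t : ℝ) :
    flow v t x = x :=
  congrFun (isMIntegralCurve_eq hv (flow_spec (hc x)).2 (isMIntegralCurve_const hx) (t := 0)
    (flow_spec (hc x)).1) t

end Flow

/-! ### Left-invariant fields and one-parameter subgroups. -/

section LieGroup

variable {k : ℕ} {G : Type*} [TopologicalSpace G] [ChartedSpace (EuclideanSpace ℝ (Fin k)) G]
  [Group G] [LieGroup (𝓡 k) ∞ G]

lemma contMDiff_leftInvariant (Y : GroupLieAlgebra (𝓡 k) G) :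
    ContMDiff (𝓡 k) (𝓡 k).tangent 1
      (fun g => (⟨g, mulInvariantVectorField (I := 𝓡 k) Y g⟩ : TangentBundle (𝓡 k) G)) := by
  have : LieGroup (𝓡 k) (minSmoothness ℝ 3) G :=
    LieGroup.of_le (n := ∞) (by
      simp only [minSmoothness_of_isRCLikeNormedField]
      exact WithTop.coe_le_coe.2 (le_top : (3 : ℕ∞) ≤ ⊤))
  refine (contMDiff_mulInvariantVectorField Y).of_le ?_
  simp only [minSmoothness_of_isRCLikeNormedField]
  exact_mod_cast one_le_two

lemma mdifferentiableAt_mul_left (g h : G) :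
    MDifferentiableAt (𝓡 k) (𝓡 k) (fun x : G => g * x) h :=
  (contMDiff_mul_left (I := 𝓡 k) (n := ∞)).mdifferentiableAt (by simp)

lemma mfderiv_mul_left_leftInvariant (Y : GroupLieAlgebra (𝓡 k) G) (g h : G) :
    mfderiv (𝓡 k) (𝓡 k) (fun x : G => g * x) h (mulInvariantVectorField (I := 𝓡 k) Y h) =
      mulInvariantVectorField (I := 𝓡 k) Y (g * h) := by
  have e : (fun x : G => (g * h) * x) = (fun x => g * x) ∘ fun x => h * x := by
    ext x; simp [mul_assoc]
  have h1 := ((mdifferentiableAt_mul_left (k := k) g (h * 1)).hasMFDerivAt.comp (1 : G)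
    (mdifferentiableAt_mul_left (k := k) h (1 : G)).hasMFDerivAt)
  have h2 : HasMFDerivAt (𝓡 k) (𝓡 k) (fun x : G => (g * h) * x) 1 _ :=
    h1.congr_of_eventuallyEq (Eventually.of_forall fun x => congrFun e x)
  -- The chain rule produces the base point `h * 1`, which is equal to `h` only propositionally.
  -- Reading all tangent vectors in the model space allows the base point to be replaced.
  have h3 : ∀ (q : G) (w : EuclideanSpace ℝ (Fin k)), q = h →
      (mfderiv (𝓡 k) (𝓡 k) (fun x : G => g * x) h : EuclideanSpace ℝ (Fin k) → _) w =
        (mfderiv (𝓡 k) (𝓡 k) (fun x : G => g * x) q : EuclideanSpace ℝ (Fin k) → _) w := by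
    rintro _ w rfl; rfl
  exact (h3 (h * 1) (mfderiv (𝓡 k) (𝓡 k) (fun x : G => h * x) 1 Y) (mul_one h)).trans
    (DFunLike.congr_fun h2.mfderiv.symm Y)

lemma mulInvariantVectorField_one (Y : GroupLieAlgebra (𝓡 k) G) :
    mulInvariantVectorField (I := 𝓡 k) Y (1 : G) = Y := by
  have h : HasMFDerivAt (𝓡 k) (𝓡 k) (fun x : G => 1 * x) 1 _ :=
    (hasMFDerivAt_id (1 : G)).congr_of_eventuallyEq (Eventually.of_forall fun x => by simp)
  exact DFunLike.congr_fun h.mfderiv Y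

lemma isMIntegralCurveOn_mul_left {Y : GroupLieAlgebra (𝓡 k) G} {γ : ℝ → G} {J : Set ℝ}
    (hγ : IsMIntegralCurveOn (I := 𝓡 k) γ (mulInvariantVectorField (I := 𝓡 k) Y) J) (g : G) :
    IsMIntegralCurveOn (I := 𝓡 k) (fun t => g * γ t) (mulInvariantVectorField (I := 𝓡 k) Y) J := by
  intro t ht
  refine ((mdifferentiableAt_mul_left g (γ t)).hasMFDerivAt.comp_hasMFDerivWithinAt t
    (hγ t ht)).congr_mfderiv ?_
  ext
  rw [← mfderiv_mul_left_leftInvariant]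
  exact map_smul (mfderiv (𝓡 k) (𝓡 k) (fun x : G => g * x) (γ t)) ((1 : ℝ →L[ℝ] ℝ) 1)
    (mulInvariantVectorField (I := 𝓡 k) Y (γ t))

variable [T2Space G]

/-- Left-invariant vector fields are complete. -/
lemma exists_isMIntegralCurve_leftInvariant (Y : GroupLieAlgebra (𝓡 k) G) (g : G) :
    ∃ γ : ℝ → G, γ 0 = g ∧ IsMIntegralCurve (I := 𝓡 k) γ (mulInvariantVectorField (I := 𝓡 k) Y) := by
  have : IsManifold (𝓡 k) 1 G := IsManifold.of_le (n := ∞) (by exact_mod_cast le_top)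
  obtain ⟨U, hU, ε, hε, h⟩ := exists_nhds_isMIntegralCurveOn (contMDiff_leftInvariant Y) 1
  obtain ⟨γ, h0, hγ⟩ := h 1 (mem_of_mem_nhds hU)
  exact exists_isMIntegralCurve_of_isMIntegralCurveOn (contMDiff_leftInvariant Y) hε
    (fun g => ⟨fun t => g * γ t, by simp [h0], isMIntegralCurveOn_mul_left hγ g⟩) g

/-- The one-parameter subgroup generated by an element of the Lie algebra. -/
def oneParam (Y : GroupLieAlgebra (𝓡 k) G) (t : ℝ) : G :=
  flow (mulInvariantVectorField (I := 𝓡 k) Y) t 1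

lemma oneParam_zero (Y : GroupLieAlgebra (𝓡 k) G) : oneParam Y 0 = 1 :=
  (flow_spec (exists_isMIntegralCurve_leftInvariant Y 1)).1

lemma isMIntegralCurve_oneParam (Y : GroupLieAlgebra (𝓡 k) G) :
    IsMIntegralCurve (I := 𝓡 k) (oneParam Y) (mulInvariantVectorField (I := 𝓡 k) Y) :=
  (flow_spec (exists_isMIntegralCurve_leftInvariant Y 1)).2

lemma continuous_oneParam (Y : GroupLieAlgebra (𝓡 k) G) : Continuous (oneParam Y) :=
  (isMIntegralCurve_oneParam Y).continuous

lemma oneParam_add (Y : GroupLieAlgebra (𝓡 k) G) (s t : ℝ) :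
    oneParam Y (s + t) = oneParam Y s * oneParam Y t := by
  have h1 := (isMIntegralCurve_oneParam Y).comp_add s
  have h2 : IsMIntegralCurve (I := 𝓡 k) (fun t => oneParam Y s * oneParam Y t)
      (mulInvariantVectorField (I := 𝓡 k) Y) := by
    rw [isMIntegralCurve_iff_isMIntegralCurveOn]
    exact isMIntegralCurveOn_mul_left ((isMIntegralCurve_oneParam Y).isMIntegralCurveOn _) _
  have := congrFun (isMIntegralCurve_eq (contMDiff_leftInvariant Y) h1 h2 (t := 0)
    (by simp [oneParam_zero])) t
  simpa [add_comm] using this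

lemma hasMFDerivAt_oneParam_zero (Y : GroupLieAlgebra (𝓡 k) G) :
    HasMFDerivAt 𝓘(ℝ, ℝ) (𝓡 k) (oneParam (G := G) Y) 0
      ((1 : ℝ →L[ℝ] ℝ).smulRight (Y : EuclideanSpace ℝ (Fin k))) := by
  refine (isMIntegralCurve_oneParam Y 0).congr_mfderiv ?_
  have e : ∀ q : G, q = 1 →
      (mulInvariantVectorField (I := 𝓡 k) Y q : EuclideanSpace ℝ (Fin k)) = Y := by
    rintro _ rfl; exact mulInvariantVectorField_one Y
  exact congrArg (fun q : EuclideanSpace ℝ (Fin k) => (1 : ℝ →L[ℝ] ℝ).smulRight q)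
    (e _ (oneParam_zero Y))

end LieGroup

/-- The chain rule for a real function along a curve. -/
lemma hasDerivAt_comp_curve {E H N : Type*} [NormedAddCommGroup E] [NormedSpace ℝ E]
    [TopologicalSpace H] {I : ModelWithCorners ℝ E H} [TopologicalSpace N] [ChartedSpace H N]
    {Φ : N → ℝ} {c : ℝ → N} {t : ℝ} {p : N} {w : E} (hp : c t = p)
    (hΦ : MDifferentiableAt I 𝓘(ℝ, ℝ) Φ p)
    (hc : HasMFDerivAt 𝓘(ℝ, ℝ) I c t ((1 : ℝ →L[ℝ] ℝ).smulRight w)) :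
    HasDerivAt (fun s => Φ (c s)) ((mfderiv I 𝓘(ℝ, ℝ) Φ p : E → ℝ) w) t := by
  subst hp
  obtain ⟨A, hA⟩ : ∃ A : E →L[ℝ] ℝ, A = mfderiv I 𝓘(ℝ, ℝ) Φ (c t) := ⟨_, rfl⟩
  have h : HasFDerivAt (fun s => Φ (c s)) (A.comp ((1 : ℝ →L[ℝ] ℝ).smulRight w)) t := by
    rw [hA]
    exact (hΦ.hasMFDerivAt.comp t hc).hasFDerivAt
  rw [← hA]
  exact h.hasDerivAt.congr_deriv (by simp; rfl)

/-! ### First-order behaviour of the exponential map at the unit. -/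

section LieExp

variable {k : ℕ} {G : Type*} [TopologicalSpace G] [ChartedSpace (EuclideanSpace ℝ (Fin k)) G]
  [Group G] [LieGroup (𝓡 k) ∞ G]

/-- The derivative of left translation, read in the preferred chart at the unit. -/
def leftJac (g : G) : EuclideanSpace ℝ (Fin k) →L[ℝ] EuclideanSpace ℝ (Fin k) :=
  (mfderiv (𝓡 k) (𝓡 k) (extChartAt (𝓡 k) (1 : G)) g : EuclideanSpace ℝ (Fin k) →L[ℝ]
    EuclideanSpace ℝ (Fin k)).comp
    (mfderiv (𝓡 k) (𝓡 k) (fun x : G => g * x) (1 : G) : EuclideanSpace ℝ (Fin k) →L[ℝ]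
    EuclideanSpace ℝ (Fin k))

/-- In finite dimension continuity can be tested on fixed vectors, and applied to a fixed `Y` the
map is the coordinate expression of the left-invariant field of `Y`. -/
lemma continuousOn_leftJac :
    ContinuousOn (leftJac (k := k) (G := G)) (extChartAt (𝓡 k) (1 : G)).source := by
  rw [continuousOn_clm_apply]
  intro Y
  have h1 : ContinuousOn (coords (mulInvariantVectorField (I := 𝓡 k) (G := G) Y) (1 : G))
      (extChartAt (𝓡 k) (1 : G)).target :=
    (contDiffOn_coords (m := 1) (contMDiff_leftInvariant Y) (1 : G)).continuousOn
  refine (h1.comp (continuousOn_extChartAt (I := 𝓡 k) (1 : G))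
    (extChartAt (𝓡 k) (1 : G)).mapsTo).congr fun g hg => ?_
  simp only [Function.comp, coords]
  rw [(extChartAt (𝓡 k) (1 : G)).left_inv hg]
  rfl

variable [T2Space G]

lemma hasDerivAt_chart_oneParam (Y : GroupLieAlgebra (𝓡 k) G) {t : ℝ}
    (ht : oneParam Y t ∈ (extChartAt (𝓡 k) (1 : G)).source) :
    HasDerivAt (fun s => extChartAt (𝓡 k) (1 : G) (oneParam Y s))
      (leftJac (oneParam Y t) Y) t := by
  obtain ⟨A, hA⟩ : ∃ A : EuclideanSpace ℝ (Fin k) →L[ℝ] EuclideanSpace ℝ (Fin k),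
      A = mfderiv (𝓡 k) (𝓡 k) (extChartAt (𝓡 k) (1 : G)) (oneParam Y t) := ⟨_, rfl⟩
  obtain ⟨w, hw⟩ : ∃ w : EuclideanSpace ℝ (Fin k),
      w = mulInvariantVectorField (I := 𝓡 k) Y (oneParam Y t) := ⟨_, rfl⟩
  have h : HasFDerivAt (fun s => extChartAt (𝓡 k) (1 : G) (oneParam Y s))
      (A.comp ((1 : ℝ →L[ℝ] ℝ).smulRight w)) t := by
    rw [hA, hw]
    exact ((mdifferentiableAt_chart (1 : G) ht).hasMFDerivAt.comp t
      (isMIntegralCurve_oneParam Y t)).hasFDerivAt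
  refine h.hasDerivAt.congr_deriv ?_
  have e : leftJac (oneParam Y t) Y = A w := by rw [hA, hw]; rfl
  simp [e]

/-- First order expansion of the exponential map in the preferred chart at the unit. -/
lemma norm_chart_lieExp_sub_le {ε : ℝ} (hε : 0 < ε) :
    ∃ δ > 0, ∀ Y : EuclideanSpace ℝ (Fin k), ‖Y‖ < δ →
      lieExp (G := G) Y ∈ (extChartAt (𝓡 k) (1 : G)).source ∧
      ‖extChartAt (𝓡 k) (1 : G) (lieExp (G := G) Y) - extChartAt (𝓡 k) (1 : G) 1 -
        leftJac (1 : G) Y‖ ≤ ε * ‖Y‖ := by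
  have hopen := isOpen_extChartAt_source (I := 𝓡 k) (1 : G)
  have h1s := mem_extChartAt_source (I := 𝓡 k) (1 : G)
  have htn := (isOpen_extChartAt_target (I := 𝓡 k) (1 : G)).mem_nhds
    (mem_extChartAt_target (I := 𝓡 k) (1 : G))
  have hφc := continuousOn_extChartAt (I := 𝓡 k) (1 : G)
  have hφs := continuousOn_extChartAt_symm (I := 𝓡 k) (1 : G)
  have hJ : ∀ᶠ y in 𝓝 (extChartAt (𝓡 k) (1 : G) 1),
      ‖leftJac (k := k) ((extChartAt (𝓡 k) (1 : G)).symm y) - leftJac (k := k) (1 : G)‖ < ε := by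
    have hc : ContinuousAt (fun y => leftJac (k := k) ((extChartAt (𝓡 k) (1 : G)).symm y))
        (extChartAt (𝓡 k) (1 : G) 1) :=
      ((continuousOn_leftJac.comp hφs (extChartAt (𝓡 k) (1 : G)).mapsTo_symm).continuousAt htn)
    have := hc.tendsto.eventually (Metric.ball_mem_nhds _ hε)
    filter_upwards [this] with y hy
    simpa [dist_eq_norm, (extChartAt (𝓡 k) (1 : G)).left_inv h1s] using hy
  set φ := extChartAt (𝓡 k) (1 : G) with hφ
  obtain ⟨r, hr, hball⟩ := Metric.nhds_basis_closedBall.mem_iff.1 (inter_mem hJ htn)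
  set C := ‖leftJac (k := k) (1 : G)‖ + ε with hC
  have hC0 : 0 < C := by positivity
  have hbound : ∀ g ∈ φ.source, φ g ∈ Metric.closedBall (φ 1) r →
      ‖leftJac (k := k) g - leftJac (1 : G)‖ ≤ ε ∧ ‖leftJac (k := k) g‖ ≤ C := fun g hg hgr => by
    have h : ‖leftJac (k := k) (φ.symm (φ g)) - leftJac (1 : G)‖ ≤ ε := (hball hgr).1.le
    rw [φ.left_inv hg] at h
    refine ⟨h, ?_⟩
    have := norm_add_le (leftJac (k := k) (1 : G)) (leftJac (k := k) g - leftJac (1 : G))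
    rw [add_sub_cancel] at this
    linarith
  have hcpt : IsCompact (φ.symm '' Metric.closedBall (φ 1) r) :=
    (isCompact_closedBall _ _).image_of_continuousOn (hφs.mono fun y hy => (hball hy).2)
  have hU : IsOpen (φ.source ∩ φ ⁻¹' Metric.ball (φ 1) r) :=
    hφc.isOpen_inter_preimage hopen Metric.isOpen_ball
  have hUsub : φ.source ∩ φ ⁻¹' Metric.ball (φ 1) r ⊆ φ.symm '' Metric.closedBall (φ 1) r :=
    fun g hg => ⟨φ g, Metric.ball_subset_closedBall hg.2, φ.left_inv hg.1⟩
  -- The chart neighbourhood lies in the compact, hence closed, image of a closed ball, so its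
  -- closure does not leave the chart domain. This controls the curve at its first exit time.
  have hclos : ∀ g ∈ closure (φ.source ∩ φ ⁻¹' Metric.ball (φ 1) r),
      g ∈ φ.source ∧ φ g ∈ Metric.closedBall (φ 1) r := fun g hg => by
    obtain ⟨y, hy, rfl⟩ := closure_minimal hUsub hcpt.isClosed hg
    exact ⟨φ.map_target (hball hy).2, by rwa [φ.right_inv (hball hy).2]⟩
  -- Within the ball the coordinate speed of s ↦ exp(sY) is at most C‖Y‖, so this choice of radius
  -- prevents an exit before time one.
  refine ⟨r / C, by positivity, fun Y hY => ?_⟩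
  have hone : oneParam (k := k) (G := G) Y 0 = 1 := oneParam_zero Y
  have hCY : C * ‖Y‖ < r := by rw [lt_div_iff₀ hC0] at hY; linarith
  -- the curve stays in the ball up to time one
  have stay : ∀ t ∈ Set.Icc (0 : ℝ) 1, oneParam (G := G) Y t ∈
      φ.source ∩ φ ⁻¹' Metric.ball (φ 1) r := by
    by_contra! hne
    obtain ⟨t', ht', hnt'⟩ := hne
    set S := Set.Icc (0 : ℝ) 1 ∩ (oneParam (G := G) Y) ⁻¹'
      (φ.source ∩ φ ⁻¹' Metric.ball (φ 1) r)ᶜ with hS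
    have hScl : IsClosed S := isClosed_Icc.inter (hU.isClosed_compl.preimage (continuous_oneParam _))
    have hSc : IsCompact S := isCompact_Icc.of_isClosed_subset hScl Set.inter_subset_left
    -- First exit time: up to `t₁` the speed bound applies, so the displacement at `t₁` is at most
    -- C‖Y‖ < r, and the curve has not left after all.
    obtain ⟨t₁, ht₁, hmin⟩ := hSc.exists_isLeast ⟨t', ht', hnt'⟩
    have hbefore : ∀ t, 0 ≤ t → t < t₁ → oneParam (G := G) Y t ∈
        φ.source ∩ φ ⁻¹' Metric.ball (φ 1) r := fun t h0 h1 => by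
      by_contra hn
      exact absurd (hmin ⟨⟨h0, h1.le.trans ht₁.1.2⟩, hn⟩) (not_le.2 h1)
    have h0mem : oneParam (G := G) Y 0 ∈ φ.source ∩ φ ⁻¹' Metric.ball (φ 1) r := by
      rw [hone]
      exact ⟨h1s, Metric.mem_ball_self hr⟩
    have hpos : 0 < t₁ := lt_of_le_of_ne ht₁.1.1 fun h => ht₁.2 (h ▸ h0mem)
    have hclt : oneParam (G := G) Y t₁ ∈ closure (φ.source ∩ φ ⁻¹' Metric.ball (φ 1) r) := by
      refine mem_closure_of_tendsto (b := 𝓝[<] t₁)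
        ((continuous_oneParam (G := G) Y).continuousAt.continuousWithinAt) ?_
      filter_upwards [Ioo_mem_nhdsLT hpos] with t ht
      exact hbefore t ht.1.le ht.2
    have hall : ∀ t ∈ Set.Icc 0 t₁, oneParam (G := G) Y t ∈ φ.source ∧
        φ (oneParam (G := G) Y t) ∈ Metric.closedBall (φ 1) r := fun t ht => by
      rcases ht.2.eq_or_lt with rfl | hlt
      · exact hclos _ hclt
      · exact ⟨(hbefore t ht.1 hlt).1, Metric.ball_subset_closedBall (hbefore t ht.1 hlt).2⟩
    have hmv := norm_image_sub_le_of_norm_deriv_le_segment' (C := C * ‖Y‖)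
      (fun t ht => (hasDerivAt_chart_oneParam Y (hall t ht).1).hasDerivWithinAt)
      (fun t ht => ((leftJac (oneParam Y t)).le_opNorm Y).trans
        (by
          have := (hbound _ (hall t ⟨ht.1, ht.2.le⟩).1 (hall t ⟨ht.1, ht.2.le⟩).2).2
          gcongr)) t₁ ⟨hpos.le, le_rfl⟩
    refine ht₁.2 ⟨(hall t₁ ⟨hpos.le, le_rfl⟩).1, ?_⟩
    rw [Set.mem_preimage, Metric.mem_ball, dist_eq_norm]
    rw [hone, sub_zero] at hmv
    refine hmv.trans_lt (lt_of_le_of_lt ?_ hCY)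
    exact mul_le_of_le_one_right (by positivity) ht₁.1.2
  refine ⟨(stay 1 (by simp)).1, ?_⟩
  -- Mean value inequality for the difference of the curve and its linearization, whose speed is at
  -- most ε‖Y‖ by the continuity of `leftJac`. The estimate is uniform in Y, so Y may vary with t
  -- later, and smoothness of exp is not needed.
  have hmv := norm_image_sub_le_of_norm_deriv_le_segment' (a := (0 : ℝ)) (b := 1)
    (f := fun t => φ (oneParam (G := G) Y t) - t • leftJac (1 : G) Y)
    (f' := fun t => leftJac (oneParam (G := G) Y t) Y - leftJac (1 : G) Y) (C := ε * ‖Y‖)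
    (fun t ht => by
      have := (hasDerivAt_chart_oneParam Y (stay t ht).1).sub
        ((hasDerivAt_id t).smul_const (leftJac (1 : G) Y))
      exact (this.congr_deriv (by simp)).hasDerivWithinAt)
    (fun t ht => by
      have h := (hbound _ (stay t ⟨ht.1, ht.2.le⟩).1
        (Metric.ball_subset_closedBall (stay t ⟨ht.1, ht.2.le⟩).2)).1
      rw [← sub_apply]
      exact (ContinuousLinearMap.le_opNorm _ Y).trans (mul_le_mul_of_nonneg_right h (norm_nonneg _)))
    1 (by simp)
  simp only [one_smul, zero_smul, sub_zero, mul_one, hone] at hmv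
  rw [sub_right_comm] at hmv
  exact hmv

lemma lieExp_zero : lieExp (0 : GroupLieAlgebra (𝓡 k) G) = 1 := by
  have h : mulInvariantVectorField (I := 𝓡 k) (0 : GroupLieAlgebra (𝓡 k) G) (1 : G) = 0 :=
    mulInvariantVectorField_one 0
  exact flow_eq_self (contMDiff_leftInvariant 0) (exists_isMIntegralCurve_leftInvariant 0) h 1

/-- The derivative at zero of `t ↦ exp (t u(t))`. -/
lemma hasMFDerivAt_lieExp {u : ℝ → EuclideanSpace ℝ (Fin k)} (hu : ContinuousAt u 0) :
    HasMFDerivAt 𝓘(ℝ, ℝ) (𝓡 k) (fun t => lieExp (k := k) (G := G) (t • u t)) 0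
      ((1 : ℝ →L[ℝ] ℝ).smulRight (u 0)) := by
  set φ := extChartAt (𝓡 k) (1 : G) with hφ
  have h1s := mem_extChartAt_source (I := 𝓡 k) (1 : G)
  have h0 : lieExp (k := k) (G := G) ((0 : ℝ) • u 0) = 1 := by rw [zero_smul]; exact lieExp_zero
  have htu : Tendsto (fun t : ℝ => t • u t) (𝓝 0) (𝓝 0) := by
    have := (tendsto_id (x := 𝓝 (0 : ℝ))).smul hu.tendsto
    rwa [zero_smul] at this
  have hder : HasDerivAt (fun t => φ (lieExp (k := k) (G := G) (t • u t))) (leftJac (1 : G) (u 0)) 0 := by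
    rw [hasDerivAt_iff_isLittleO_nhds_zero]
    simp only [zero_add, h0]
    -- The first summand is o(‖h u(h)‖) by the uniform expansion, the second is h times a quantity
    -- tending to zero. Continuity of u at 0 is enough for both.
    have e : (fun h : ℝ => φ (lieExp (k := k) (G := G) (h • u h)) - φ 1 - h • leftJac (1 : G) (u 0)) =
        fun h => (φ (lieExp (k := k) (G := G) (h • u h)) - φ 1 - leftJac (1 : G) (h • u h)) +
          h • leftJac (1 : G) (u h - u 0) := by
      funext h
      rw [map_smul, map_sub, smul_sub]
      abel
    rw [e]
    refine Asymptotics.IsLittleO.add ?_ ?_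
    · have h1 : (fun h : ℝ => φ (lieExp (k := k) (G := G) (h • u h)) - φ 1 - leftJac (1 : G) (h • u h))
          =o[𝓝 0] fun h : ℝ => h • u h := by
        rw [Asymptotics.isLittleO_iff]
        intro ε hε
        obtain ⟨δ, hδ, H⟩ := norm_chart_lieExp_sub_le (k := k) (G := G) hε
        filter_upwards [htu.eventually (Metric.ball_mem_nhds _ hδ)] with t ht
        exact (H _ (by simpa using ht)).2
      refine h1.trans_isBigO ?_
      have := (Asymptotics.isBigO_refl (fun h : ℝ => h) (𝓝 0)).smul (hu.isBigO_one (F := ℝ))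
      simpa using this
    · have h2 : (fun h => leftJac (1 : G) (u h - u 0)) =o[𝓝 0] fun _ => (1 : ℝ) := by
        rw [Asymptotics.isLittleO_one_iff]
        have : Tendsto (fun h => u h - u 0) (𝓝 0) (𝓝 0) := by
          simpa using hu.tendsto.sub_const (u 0)
        have h3 := ((leftJac (k := k) (1 : G)).continuous.tendsto 0).comp this
        rwa [map_zero] at h3
      simpa using (Asymptotics.isBigO_refl (fun h : ℝ => h) (𝓝 0)).smul_isLittleO h2
  have hsymm := (mdifferentiableAt_chart_symm (1 : G) (φ.map_source h1s)).hasMFDerivAt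
  have hev : (fun t => lieExp (k := k) (G := G) (t • u t)) =ᶠ[𝓝 0]
      φ.symm ∘ fun t => φ (lieExp (k := k) (G := G) (t • u t)) := by
    obtain ⟨δ, hδ, H⟩ := norm_chart_lieExp_sub_le (k := k) (G := G) one_pos
    filter_upwards [htu.eventually (Metric.ball_mem_nhds _ hδ)] with t ht
    exact (φ.left_inv (H _ (by simpa using ht)).1).symm
  have hφ0 : φ (lieExp (k := k) (G := G) ((0 : ℝ) • u 0)) = φ 1 := by rw [h0]
  have hsymm' : HasMFDerivAt (𝓡 k) (𝓡 k) φ.symm (φ (lieExp (k := k) (G := G) ((0 : ℝ) • u 0)))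
      (mfderiv (𝓡 k) (𝓡 k) φ.symm (φ (lieExp (k := k) (G := G) ((0 : ℝ) • u 0)))) := by
    refine (mdifferentiableAt_chart_symm (1 : G) ?_).hasMFDerivAt
    rw [hφ0]
    exact φ.map_source h1s
  refine ((hsymm'.comp (0 : ℝ) hder.hasFDerivAt.hasMFDerivAt).congr_of_eventuallyEq hev).congr_mfderiv
    ?_
  have key : (mfderiv (𝓡 k) (𝓡 k) φ.symm (φ (lieExp (k := k) (G := G) ((0 : ℝ) • u 0))) :
      EuclideanSpace ℝ (Fin k) → EuclideanSpace ℝ (Fin k)) (leftJac (1 : G) (u 0)) = u 0 := by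
    have h3 := mfderiv_chart_symm_coords
      (mulInvariantVectorField (I := 𝓡 k) (G := G) (u 0)) (1 : G) (φ.map_source h1s)
    have h4 : (mulInvariantVectorField (I := 𝓡 k) (G := G) (u 0) (φ.symm (φ 1)) :
        EuclideanSpace ℝ (Fin k)) = u 0 := by
      rw [φ.left_inv h1s]
      exact mulInvariantVectorField_one (u 0)
    have h5 : coords (mulInvariantVectorField (I := 𝓡 k) (G := G) (u 0)) (1 : G) (φ 1) =
        leftJac (1 : G) (u 0) := by
      simp only [coords]
      rw [φ.left_inv h1s]
      rfl
    rw [← h5, hφ0]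
    exact h3.trans h4
  obtain ⟨A, hA⟩ : ∃ A : EuclideanSpace ℝ (Fin k) →L[ℝ] EuclideanSpace ℝ (Fin k),
      A = mfderiv (𝓡 k) (𝓡 k) φ.symm (φ (lieExp (k := k) (G := G) ((0 : ℝ) • u 0))) := ⟨_, rfl⟩
  have key' : A.comp ((1 : ℝ →L[ℝ] ℝ).smulRight (leftJac (1 : G) (u 0))) =
      (1 : ℝ →L[ℝ] ℝ).smulRight (u 0) := by
    rw [← hA] at key
    ext i
    simp only [ContinuousLinearMap.coe_comp, Function.comp_apply,
      ContinuousLinearMap.smulRight_apply, one_apply_eq_self, one_smul]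
    exact congrArg (fun q : EuclideanSpace ℝ (Fin k) => q i) key
  rw [hA] at key'
  exact key'

end LieExp

/-- The derivative of a smooth function along a smooth family of tangent vectors is smooth. -/
lemma contMDiff_mfderiv_section {E H N E' H' Z : Type*} [NormedAddCommGroup E] [NormedSpace ℝ E]
    [TopologicalSpace H] {I : ModelWithCorners ℝ E H} [TopologicalSpace N] [ChartedSpace H N]
    [IsManifold I ∞ N]
    [NormedAddCommGroup E'] [NormedSpace ℝ E']
    [TopologicalSpace H'] {I' : ModelWithCorners ℝ E' H'} [TopologicalSpace Z] [ChartedSpace H' Z]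
    {Φ : N → ℝ} (hΦ : ContMDiff I 𝓘(ℝ, ℝ) ∞ Φ) {s : Z → TangentBundle I N}
    (hs : ContMDiff I' I.tangent ∞ s) :
    ContMDiff I' 𝓘(ℝ, ℝ) ∞ (fun z => (mfderiv I 𝓘(ℝ, ℝ) Φ (s z).1 (s z).2 : ℝ)) :=
  (contMDiff_snd_tangentBundle_modelSpace (𝕜 := ℝ) (n := ∞) ℝ 𝓘(ℝ, ℝ)).comp
    ((hΦ.contMDiff_tangentMap (m := ∞) (by simp)).comp hs)

/-- The derivative of a function of two variables, applied to a pair of tangent vectors. -/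
lemma mfderiv_prod_apply {E H N E' H' N' : Type*} [NormedAddCommGroup E] [NormedSpace ℝ E]
    [TopologicalSpace H] {I : ModelWithCorners ℝ E H} [TopologicalSpace N] [ChartedSpace H N]
    [NormedAddCommGroup E'] [NormedSpace ℝ E']
    [TopologicalSpace H'] {I' : ModelWithCorners ℝ E' H'} [TopologicalSpace N'] [ChartedSpace H' N']
    {Φ : N × N' → ℝ} {p : N × N'} (h : MDifferentiableAt (I.prod I') 𝓘(ℝ, ℝ) Φ p) (v : E) (w : E') :
    (mfderiv (I.prod I') 𝓘(ℝ, ℝ) Φ p : E × E' → ℝ) (v, w) =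
      (mfderiv I 𝓘(ℝ, ℝ) (fun z => Φ (z, p.2)) p.1 : E → ℝ) v +
        (mfderiv I' 𝓘(ℝ, ℝ) (fun z => Φ (p.1, z)) p.2 : E' → ℝ) w :=
  mfderiv_prod_eq_add_apply h

/-! ### Directional derivatives on X × M. -/

section Calculus

variable {d e k : ℕ} {X M G : Type*}
  [TopologicalSpace X] [ChartedSpace (EuclideanSpace ℝ (Fin d)) X] [IsManifold (𝓡 d) ∞ X]
  [TopologicalSpace M] [ChartedSpace (EuclideanSpace ℝ (Fin e)) M] [IsManifold (𝓡 e) ∞ M]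
  [TopologicalSpace G] [ChartedSpace (EuclideanSpace ℝ (Fin k)) G] [Group G] [LieGroup (𝓡 k) ∞ G]
  [MulAction G M]

namespace CurrentAlgebra

/-- The component of an element of the Lie algebra that acts on positions. -/
def vPart (a : CurrentAlgebra d k X G) : CurrentAlgebra d k X G where
  v := a.v
  u := fun _ => 0
  smooth_v := a.smooth_v
  smooth_u := contMDiff_const
  compact_support := by
    obtain ⟨K, hK, h⟩ := a.compact_support
    exact ⟨K, hK, fun x hx => ⟨(h x hx).1, rfl⟩⟩

/-- The component of an element of the Lie algebra that acts on marks. -/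
def uPart (a : CurrentAlgebra d k X G) : CurrentAlgebra d k X G where
  v := fun _ => 0
  u := a.u
  smooth_v := contMDiff_zeroSection ℝ (TangentSpace (𝓡 d) : X → Type _)
  smooth_u := a.smooth_u
  compact_support := by
    obtain ⟨K, hK, h⟩ := a.compact_support
    exact ⟨K, hK, fun x hx => ⟨rfl, (h x hx).2⟩⟩

end CurrentAlgebra

lemma gradXM_vPart (a : CurrentAlgebra d k X G) (φ : X × M → ℝ) (z : X × M) :
    gradXM a.vPart φ z = dX φ z (a.v z.1) := by
  have : dG k G φ z (0 : GroupLieAlgebra (𝓡 k) G) = 0 := map_zero _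
  change dX φ z (a.v z.1) + dG k G φ z (0 : GroupLieAlgebra (𝓡 k) G) = _
  rw [this, add_zero]

lemma gradXM_uPart (a : CurrentAlgebra d k X G) (φ : X × M → ℝ) (z : X × M) :
    gradXM a.uPart φ z = dG k G φ z (a.u z.1) := by
  have : dX φ z (0 : TangentSpace (𝓡 d) z.1) = 0 := map_zero _
  change dX φ z (0 : TangentSpace (𝓡 d) z.1) + dG k G φ z (a.u z.1) = _
  rw [this, zero_add]

lemma gradXM_eq_add (a : CurrentAlgebra d k X G) (φ : X × M → ℝ) (z : X × M) :
    gradXM a φ z = gradXM a.vPart φ z + gradXM a.uPart φ z := by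
  rw [gradXM_vPart, gradXM_uPart]
  rfl

lemma contMDiff_action (hsmooth : ContMDiff ((𝓡 k).prod (𝓡 e)) (𝓡 e) ∞ (fun y : G × M => y.1 • y.2)) :
    ContMDiff (((𝓡 d).prod (𝓡 e)).prod (𝓡 k)) ((𝓡 d).prod (𝓡 e)) ∞
      (fun y : (X × M) × G => ((y.1.1, y.2 • y.1.2) : X × M)) :=
  (contMDiff_fst.comp contMDiff_fst).prodMk
    (hsmooth.comp (contMDiff_snd.prodMk (contMDiff_snd.comp contMDiff_fst)))

/-- The partial derivative is the full differential applied to the smooth section (v, 0) of the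
tangent bundle of the product. -/
lemma contMDiff_dX (a : CurrentAlgebra d k X G) {φ : X × M → ℝ}
    (hφ : ContMDiff ((𝓡 d).prod (𝓡 e)) 𝓘(ℝ, ℝ) ∞ φ) :
    ContMDiff ((𝓡 d).prod (𝓡 e)) 𝓘(ℝ, ℝ) ∞ (fun z : X × M => (dX φ z (a.v z.1) : ℝ)) := by
  have hs : ContMDiff ((𝓡 d).prod (𝓡 e)) ((𝓡 d).prod (𝓡 e)).tangent ∞
      (fun z : X × M => (equivTangentBundleProd (𝓡 d) X (𝓡 e) M).symm
        ((⟨z.1, a.v z.1⟩ : TangentBundle (𝓡 d) X), (⟨z.2, 0⟩ : TangentBundle (𝓡 e) M))) :=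
    contMDiff_equivTangentBundleProd_symm.comp ((a.smooth_v.comp contMDiff_fst).prodMk
      ((contMDiff_zeroSection ℝ (TangentSpace (𝓡 e) : M → Type _)).comp contMDiff_snd))
  refine (contMDiff_mfderiv_section hφ hs).congr fun z => ?_
  have h := mfderiv_prod_apply (hφ.mdifferentiableAt (x := z) (by simp))
    (a.v z.1 : EuclideanSpace ℝ (Fin d)) (0 : EuclideanSpace ℝ (Fin e))
  refine Eq.trans ?_ h.symm
  have h0 : (mfderiv (𝓡 e) 𝓘(ℝ, ℝ) (fun m => φ (z.1, m)) z.2 : EuclideanSpace ℝ (Fin e) → ℝ) 0 = 0 :=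
    map_zero (mfderiv (𝓡 e) 𝓘(ℝ, ℝ) (fun m => φ (z.1, m)) z.2)
  exact ((congrArg (fun q : ℝ => (dX φ z (a.v z.1) : ℝ) + q) h0).trans (add_zero _)).symm

/-- The derivative in the mark is the differential of ((x, m), g) ↦ φ(x, gm) applied to the section
(0, Y) over the points (z, e). -/
lemma contMDiff_dG (hsmooth : ContMDiff ((𝓡 k).prod (𝓡 e)) (𝓡 e) ∞ (fun y : G × M => y.1 • y.2))
    (Y : GroupLieAlgebra (𝓡 k) G) {φ : X × M → ℝ}
    (hφ : ContMDiff ((𝓡 d).prod (𝓡 e)) 𝓘(ℝ, ℝ) ∞ φ) :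
    ContMDiff ((𝓡 d).prod (𝓡 e)) 𝓘(ℝ, ℝ) ∞ (fun z : X × M => (dG k G φ z Y : ℝ)) := by
  have hs : ContMDiff ((𝓡 d).prod (𝓡 e)) (((𝓡 d).prod (𝓡 e)).prod (𝓡 k)).tangent ∞
      (fun z : X × M => (equivTangentBundleProd ((𝓡 d).prod (𝓡 e)) (X × M) (𝓡 k) G).symm
        ((⟨z, 0⟩ : TangentBundle ((𝓡 d).prod (𝓡 e)) (X × M)),
          (⟨1, Y⟩ : TangentBundle (𝓡 k) G))) :=
    contMDiff_equivTangentBundleProd_symm.comp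
      ((contMDiff_zeroSection ℝ (TangentSpace ((𝓡 d).prod (𝓡 e)) : X × M → Type _)).prodMk
      contMDiff_const)
  have hc := hφ.comp (contMDiff_action (d := d) (X := X) hsmooth)
  refine (contMDiff_mfderiv_section hc hs).congr fun z => ?_
  have h := mfderiv_prod_apply (hc.mdifferentiableAt (x := (z, (1 : G))) (by simp))
    (0 : EuclideanSpace ℝ (Fin d) × EuclideanSpace ℝ (Fin e)) (Y : EuclideanSpace ℝ (Fin k))
  refine Eq.trans ?_ h.symm
  rw [add_comm]
  refine (add_eq_left.2 ?_).symm
  exact map_zero (mfderiv ((𝓡 d).prod (𝓡 e)) 𝓘(ℝ, ℝ)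
    (fun z : X × M => (φ ∘ fun y : (X × M) × G => ((y.1.1, y.2 • y.1.2) : X × M)) (z, 1)) z)

lemma contMDiff_gradXM (hsmooth : ContMDiff ((𝓡 k).prod (𝓡 e)) (𝓡 e) ∞ (fun y : G × M => y.1 • y.2))
    (a : CurrentAlgebra d k X G) {φ : X × M → ℝ}
    (hφ : ContMDiff ((𝓡 d).prod (𝓡 e)) 𝓘(ℝ, ℝ) ∞ φ) :
    ContMDiff ((𝓡 d).prod (𝓡 e)) 𝓘(ℝ, ℝ) ∞ (gradXM a φ) := by
  obtain ⟨uE, huE⟩ : ∃ uE : X → EuclideanSpace ℝ (Fin k), uE = a.u := ⟨_, rfl⟩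
  have huE' : ContMDiff (𝓡 d) (𝓡 k) ∞ uE := huE ▸ a.smooth_u
  -- The Lie algebra direction u(x) varies with x; expanding it in coordinates leaves derivatives
  -- along fixed elements with smooth coefficients.
  have hsum : ContMDiff ((𝓡 d).prod (𝓡 e)) 𝓘(ℝ, ℝ) ∞ (fun z : X × M =>
      ∑ i, uE z.1 i *
        (dG k G φ z (EuclideanSpace.single i (1 : ℝ) : EuclideanSpace ℝ (Fin k)) : ℝ)) := by
    refine contMDiff_finsetSum fun i _ => ContMDiff.mul ?_ (contMDiff_dG hsmooth _ hφ)
    exact ((EuclideanSpace.proj (𝕜 := ℝ) i).contMDiff.comp huE').comp contMDiff_fst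
  refine ((contMDiff_dX a hφ).add hsum).congr fun z => ?_
  refine congrArg (fun q : ℝ => (dX φ z (a.v z.1) : ℝ) + q) ?_
  obtain ⟨A, hA⟩ : ∃ A : EuclideanSpace ℝ (Fin k) →L[ℝ] ℝ, A = dG k G φ z := ⟨_, rfl⟩
  have : A (uE z.1) = ∑ i, uE z.1 i * A (EuclideanSpace.single i (1 : ℝ)) := by
    conv_lhs => rw [← (EuclideanSpace.basisFun (Fin k) ℝ).sum_repr (uE z.1)]
    simp
  subst hA huE
  exact this

/-- The derivative of a function along a curve in the group, applied to the marks. -/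
lemma hasDerivAt_smul_curve (hsmooth : ContMDiff ((𝓡 k).prod (𝓡 e)) (𝓡 e) ∞ (fun y : G × M => y.1 • y.2))
    {φ : X × M → ℝ} (hφ : ContMDiff ((𝓡 d).prod (𝓡 e)) 𝓘(ℝ, ℝ) 1 φ) (z : X × M)
    {γ : ℝ → X} {η : ℝ → G} {v : EuclideanSpace ℝ (Fin d)} {u : EuclideanSpace ℝ (Fin k)} {t : ℝ}
    (hγ : HasMFDerivAt 𝓘(ℝ, ℝ) (𝓡 d) γ t ((1 : ℝ →L[ℝ] ℝ).smulRight v)) (hγ0 : γ t = z.1)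
    (hη : HasMFDerivAt 𝓘(ℝ, ℝ) (𝓡 k) η t ((1 : ℝ →L[ℝ] ℝ).smulRight u)) (hη0 : η t = 1) :
    HasDerivAt (fun s => φ (γ s, η s • z.2))
      ((dX φ z : EuclideanSpace ℝ (Fin d) → ℝ) v + (dG k G φ z : EuclideanSpace ℝ (Fin k) → ℝ) u) t := by
  have hΦ : ContMDiff ((𝓡 d).prod (𝓡 k)) 𝓘(ℝ, ℝ) 1 (fun y : X × G => φ (y.1, y.2 • z.2)) :=
    hφ.comp (contMDiff_fst.prodMk ((hsmooth.of_le (by exact_mod_cast le_top)).comp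
      (contMDiff_snd.prodMk contMDiff_const)))
  have hc : HasMFDerivAt 𝓘(ℝ, ℝ) ((𝓡 d).prod (𝓡 k)) (fun s => (γ s, η s)) t
      ((1 : ℝ →L[ℝ] ℝ).smulRight ((v, u) : EuclideanSpace ℝ (Fin d) × EuclideanSpace ℝ (Fin k))) :=
    hγ.prodMk hη
  have h := hasDerivAt_comp_curve (p := (z.1, (1 : G))) (by rw [hγ0, hη0])
    (hΦ.mdifferentiableAt (by simp)) hc
  refine h.congr_deriv ?_
  rw [mfderiv_prod_apply (hΦ.mdifferentiableAt (by simp))]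
  congr 1
  have : (fun x : X => φ (x, (1 : G) • z.2)) = fun x => φ (x, z.2) := by simp
  exact congrArg (fun f : X → ℝ => (mfderiv (𝓡 d) 𝓘(ℝ, ℝ) f z.1 : EuclideanSpace ℝ (Fin d) → ℝ) v) this

variable [T2Space X] [T2Space G]

lemma CurrentAlgebra.complete (a : CurrentAlgebra d k X G) (x : X) :
    ∃ γ : ℝ → X, γ 0 = x ∧ IsMIntegralCurve (I := 𝓡 d) γ a.v := by
  obtain ⟨K, hK, h⟩ := a.compact_support
  exact exists_isMIntegralCurve_of_compactSupport (a.smooth_v.of_le (by exact_mod_cast le_top)) hK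
    (fun x hx => (h x hx).1) x

lemma CurrentAlgebra.flow_zero (a : CurrentAlgebra d k X G) (x : X) : flow a.v 0 x = x :=
  (flow_spec (a.complete x)).1

lemma CurrentAlgebra.flow_injective (a : CurrentAlgebra d k X G) (t : ℝ) :
    Function.Injective (flow a.v t) :=
  MarkedConfig.flow_injective (a.smooth_v.of_le (by exact_mod_cast le_top)) a.complete t

lemma CurrentAlgebra.flow_eq_self (a : CurrentAlgebra d k X G) {x : X} (hx : a.v x = 0) (t : ℝ) :
    flow a.v t x = x :=
  MarkedConfig.flow_eq_self (a.smooth_v.of_le (by exact_mod_cast le_top)) a.complete hx t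

lemma CurrentAlgebra.hasMFDerivAt_flow (a : CurrentAlgebra d k X G) (x : X) :
    HasMFDerivAt 𝓘(ℝ, ℝ) (𝓡 d) (fun t => flow a.v t x) 0
      ((1 : ℝ →L[ℝ] ℝ).smulRight (a.v x : EuclideanSpace ℝ (Fin d))) := by
  have h := (flow_spec (a.complete x)).2 0
  have e : ∀ q, q = x → (a.v q : EuclideanSpace ℝ (Fin d)) = a.v x := by rintro _ rfl; rfl
  refine h.congr_mfderiv ?_
  exact congrArg (fun q : EuclideanSpace ℝ (Fin d) => (1 : ℝ →L[ℝ] ℝ).smulRight q)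
    (e _ (a.flow_zero x))

lemma act_zero (a : CurrentAlgebra d k X G) (z : X × M) : act a 0 z = z := by
  have h : lieExp ((0 : ℝ) • a.u (flow a.v 0 z.1)) = (1 : G) := by
    rw [zero_smul]; exact lieExp_zero
  simp only [act]
  rw [h, a.flow_zero, one_smul]

lemma CurrentAlgebra.hasMFDerivAt_lieExp (a : CurrentAlgebra d k X G) (x : X) :
    HasMFDerivAt 𝓘(ℝ, ℝ) (𝓡 k) (fun t : ℝ => lieExp (t • a.u (flow a.v t x))) 0
      ((1 : ℝ →L[ℝ] ℝ).smulRight (a.u x : EuclideanSpace ℝ (Fin k))) := by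
  have hu : ContinuousAt (fun t => (a.u (flow a.v t x) : EuclideanSpace ℝ (Fin k))) 0 :=
    a.smooth_u.continuous.continuousAt.comp (a.hasMFDerivAt_flow x).continuousAt
  refine (MarkedConfig.hasMFDerivAt_lieExp (G := G) hu).congr_mfderiv ?_
  simp only [a.flow_zero]
  rfl

/-- The directional derivative along an element of the Lie algebra is the derivative along the
curves that it generates. -/
lemma hasDerivAt_act (hsmooth : ContMDiff ((𝓡 k).prod (𝓡 e)) (𝓡 e) ∞ (fun y : G × M => y.1 • y.2))
    (a : CurrentAlgebra d k X G) {φ : X × M → ℝ}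
    (hφ : ContMDiff ((𝓡 d).prod (𝓡 e)) 𝓘(ℝ, ℝ) 1 φ) (z : X × M) :
    HasDerivAt (fun t => φ (act a t z)) (gradXM a φ z) 0 := by
  refine hasDerivAt_smul_curve hsmooth hφ z (a.hasMFDerivAt_flow z.1) (a.flow_zero _)
    (a.hasMFDerivAt_lieExp z.1) ?_
  rw [zero_smul]; exact lieExp_zero

lemma continuousAt_act (hsmooth : ContMDiff ((𝓡 k).prod (𝓡 e)) (𝓡 e) ∞ (fun y : G × M => y.1 • y.2))
    (a : CurrentAlgebra d k X G) (z : X × M) : ContinuousAt (fun t => act a t z) 0 := by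
  have h1 := (a.hasMFDerivAt_flow z.1).continuousAt
  have h2 := (a.hasMFDerivAt_lieExp z.1).continuousAt
  exact h1.prodMk (hsmooth.continuous.continuousAt.comp (h2.prodMk continuousAt_const))

lemma gradXM_eq_zero_of_eventuallyEq
    (hsmooth : ContMDiff ((𝓡 k).prod (𝓡 e)) (𝓡 e) ∞ (fun y : G × M => y.1 • y.2))
    (a : CurrentAlgebra d k X G) {φ : X × M → ℝ}
    (hφ : ContMDiff ((𝓡 d).prod (𝓡 e)) 𝓘(ℝ, ℝ) 1 φ) {z : X × M} (h : φ =ᶠ[𝓝 z] 0) :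
    gradXM a φ z = 0 := by
  have hc := continuousAt_act hsmooth a z
  have h1 : (fun t => φ (act a t z)) =ᶠ[𝓝 0] fun _ => 0 := by
    refine hc.tendsto.eventually (p := fun y => φ y = 0) ?_
    rwa [act_zero]
  exact (hasDerivAt_act hsmooth a hφ z).unique ((hasDerivAt_const 0 (0 : ℝ)).congr_of_eventuallyEq h1)

/-- Smooth functions with compact support belong to the class of test functions. -/
lemma isTest_of_compactSupport [T2Space M]
    (hsmooth : ContMDiff ((𝓡 k).prod (𝓡 e)) (𝓡 e) ∞ (fun y : G × M => y.1 • y.2)) {φ : X × M → ℝ}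
    (hφ : ContMDiff ((𝓡 d).prod (𝓡 e)) 𝓘(ℝ, ℝ) ∞ φ) {K : Set (X × M)} (hK : IsCompact K)
    (hφK : ∀ z ∉ K, φ z = 0) : IsTest d e k G φ where
  smooth := hφ
  support := ⟨Prod.fst '' K, hK.image continuous_fst, fun z hz =>
    hφK z fun h => hz (Set.mem_image_of_mem _ h)⟩
  bounded := by
    -- By induction the iterated derivatives remain smooth and remain supported in the same compact
    -- set, so each of them is bounded.
    have key : ∀ l : List (CurrentAlgebra d k X G),
        ContMDiff ((𝓡 d).prod (𝓡 e)) 𝓘(ℝ, ℝ) ∞ (l.foldr (fun a f => gradXM a f) φ) ∧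
          ∀ z ∉ K, l.foldr (fun a f => gradXM a f) φ z = 0 := by
      intro l
      induction l with
      | nil => exact ⟨hφ, hφK⟩
      | cons a l ih =>
        refine ⟨contMDiff_gradXM hsmooth a ih.1, fun z hz => ?_⟩
        refine gradXM_eq_zero_of_eventuallyEq hsmooth a (ih.1.of_le (by exact_mod_cast le_top)) ?_
        filter_upwards [hK.isClosed.isOpen_compl.mem_nhds hz] with y hy
        exact ih.2 y hy
    intro l
    obtain ⟨h1, h2⟩ := key l
    obtain ⟨C, hC⟩ := hK.exists_bound_of_continuousOn h1.continuous.continuousOn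
    refine ⟨max C 0, fun z => ?_⟩
    by_cases hz : z ∈ K
    · exact (hC z hz).trans (le_max_left _ _)
    · rw [h2 z hz, abs_zero]
      exact le_max_right _ _

/-- The chain rule for the directional derivative. -/
lemma gradXM_comp (hsmooth : ContMDiff ((𝓡 k).prod (𝓡 e)) (𝓡 e) ∞ (fun y : G × M => y.1 • y.2))
    (a : CurrentAlgebra d k X G) {ι : Type*} [Fintype ι] {g : (ι → ℝ) → ℝ} (hg : ContDiff ℝ 1 g)
    {φ : ι → X × M → ℝ} (hφ : ∀ i, ContMDiff ((𝓡 d).prod (𝓡 e)) 𝓘(ℝ, ℝ) 1 (φ i)) (z : X × M) :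
    gradXM a (fun z => g fun i => φ i z) z = fderiv ℝ g (fun i => φ i z) fun i => gradXM a (φ i) z := by
  have h1 : HasDerivAt (fun t i => φ i (act a t z)) (fun i => gradXM a (φ i) z) 0 :=
    hasDerivAt_pi.2 fun i => hasDerivAt_act hsmooth a (hφ i) z
  have h2 : HasFDerivAt g (fderiv ℝ g fun i => φ i (act a 0 z)) fun i => φ i (act a 0 z) :=
    (hg.differentiable (by simp) _).hasFDerivAt
  have h3 := h2.comp_hasDerivAt (0 : ℝ) h1
  rw [act_zero] at h3
  have h4 : ContMDiff ((𝓡 d).prod (𝓡 e)) 𝓘(ℝ, ℝ) 1 (fun z => g fun i => φ i z) :=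
    hg.contMDiff.comp (contMDiff_pi_space.2 hφ)
  exact (hasDerivAt_act hsmooth a h4 z).unique h3

/-- The product rule for the directional derivative. -/
lemma gradXM_mul (hsmooth : ContMDiff ((𝓡 k).prod (𝓡 e)) (𝓡 e) ∞ (fun y : G × M => y.1 • y.2))
    (a : CurrentAlgebra d k X G) {f g : X × M → ℝ}
    (hf : ContMDiff ((𝓡 d).prod (𝓡 e)) 𝓘(ℝ, ℝ) 1 f)
    (hg : ContMDiff ((𝓡 d).prod (𝓡 e)) 𝓘(ℝ, ℝ) 1 g) (z : X × M) :
    gradXM a (fun z => f z * g z) z = gradXM a f z * g z + f z * gradXM a g z := by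
  have h := (hasDerivAt_act hsmooth a hf z).mul (hasDerivAt_act hsmooth a hg z)
  rw [act_zero] at h
  exact (hasDerivAt_act hsmooth a (hf.mul hg) z).unique h

/-- The derivative along an orbit of a one-parameter subgroup. -/
lemma hasDerivAt_oneParam_smul
    (hsmooth : ContMDiff ((𝓡 k).prod (𝓡 e)) (𝓡 e) ∞ (fun y : G × M => y.1 • y.2))
    (Y : GroupLieAlgebra (𝓡 k) G) {φ : X × M → ℝ}
    (hφ : ContMDiff ((𝓡 d).prod (𝓡 e)) 𝓘(ℝ, ℝ) 1 φ) (x : X) (m : M) (s : ℝ) :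
    HasDerivAt (fun s => φ (x, oneParam Y s • m)) (dG k G φ (x, oneParam Y s • m) Y) s := by
  have h1 : HasMFDerivAt 𝓘(ℝ, ℝ) (𝓡 d) (fun _ : ℝ => x) 0
      ((1 : ℝ →L[ℝ] ℝ).smulRight (0 : EuclideanSpace ℝ (Fin d))) := by
    have e : (1 : ℝ →L[ℝ] ℝ).smulRight (0 : EuclideanSpace ℝ (Fin d)) = 0 := by ext; simp
    exact (hasMFDerivAt_const x (0 : ℝ)).congr_mfderiv e.symm
  -- The derivative at time zero is taken at the point already reached and is shifted to time `s` by
  -- the group law.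
  have h := hasDerivAt_smul_curve hsmooth hφ (x, oneParam Y s • m) h1 rfl
    (hasMFDerivAt_oneParam_zero Y) (oneParam_zero Y)
  have h0 : (dX φ (x, oneParam (G := G) Y s • m) : EuclideanSpace ℝ (Fin d) → ℝ) 0 = 0 :=
    map_zero (dX φ (x, oneParam (G := G) Y s • m))
  have h3 := h.congr_deriv ((congrArg (fun q : ℝ => q + (dG k G φ (x, oneParam (G := G) Y s • m) Y : ℝ))
    h0).trans (zero_add _))
  rw [← sub_self s] at h3
  refine (h3.comp_sub_const s s).congr_of_eventuallyEq (Eventually.of_forall fun r => ?_)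
  simp only [smul_smul, ← oneParam_add, sub_add_cancel]

end Calculus

/-! ### The density of the translates as a cocycle along orbits. -/

section Cocycle

variable {e k : ℕ} {M G : Type*}
  [TopologicalSpace M] [SecondCountableTopology M] [T2Space M]
  [ChartedSpace (EuclideanSpace ℝ (Fin e)) M] [IsManifold (𝓡 e) ∞ M]
  [MeasurableSpace M] [BorelSpace M]
  [TopologicalSpace G] [T2Space G] [ChartedSpace (EuclideanSpace ℝ (Fin k)) G] [Group G]
  [LieGroup (𝓡 k) ∞ G] [MulAction G M]

lemma measurable_smul_mark
    (hsmooth : ContMDiff ((𝓡 k).prod (𝓡 e)) (𝓡 e) ∞ (fun y : G × M => y.1 • y.2)) (g : G) :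
    Measurable (fun m : M => g • m) :=
  (hsmooth.continuous.comp (continuous_const.prodMk continuous_id)).measurable

variable {lam : Measure M} {P : G → M → ℝ}

lemma IsDifferentiableDensity.continuous (hP : IsDifferentiableDensity (e := e) (k := k) lam P) :
    Continuous (fun y : G × M => P y.1 y.2) :=
  hP.differentiable.continuous

lemma IsDifferentiableDensity.measurable (hP : IsDifferentiableDensity (e := e) (k := k) lam P)
    (g : G) : Measurable (P g) :=
  (hP.continuous.comp (continuous_const.prodMk continuous_id)).measurable

/-- The change of variables `m ↦ g • m`. -/
lemma IsDifferentiableDensity.lintegral_smul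
    (hP : IsDifferentiableDensity (e := e) (k := k) lam P)
    (hsmooth : ContMDiff ((𝓡 k).prod (𝓡 e)) (𝓡 e) ∞ (fun y : G × M => y.1 • y.2)) (g : G)
    {f : M → ENNReal} (hf : Measurable f) :
    ∫⁻ m, f (g • m) ∂lam = ∫⁻ m, ENNReal.ofReal (P g m) * f m ∂lam := by
  rw [← lintegral_map hf (measurable_smul_mark hsmooth g), hP.density,
    lintegral_withDensity_eq_lintegral_mul _ (hP.measurable g).ennreal_ofReal hf]
  rfl

/-- The density of the translates is a multiplicative cocycle. -/
lemma IsDifferentiableDensity.cocycle [SigmaFinite lam]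
    (hP : IsDifferentiableDensity (e := e) (k := k) lam P)
    (hsmooth : ContMDiff ((𝓡 k).prod (𝓡 e)) (𝓡 e) ∞ (fun y : G × M => y.1 • y.2)) (g h : G) :
    ∀ᵐ m ∂lam, ENNReal.ofReal (P (g * h) m) =
      ENNReal.ofReal (P g m) * ENNReal.ofReal (P h (g⁻¹ • m)) := by
  have hm1 : Measurable fun m => ENNReal.ofReal (P (g * h) m) := (hP.measurable _).ennreal_ofReal
  have hm2 : Measurable fun m => ENNReal.ofReal (P h (g⁻¹ • m)) :=
    ((hP.measurable h).comp (measurable_smul_mark hsmooth _)).ennreal_ofReal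
  have hm3 : Measurable fun m => ENNReal.ofReal (P g m) * ENNReal.ofReal (P h (g⁻¹ • m)) :=
    (hP.measurable g).ennreal_ofReal.mul hm2
  have key : lam.withDensity (fun m => ENNReal.ofReal (P (g * h) m)) =
      lam.withDensity fun m => ENNReal.ofReal (P g m) * ENNReal.ofReal (P h (g⁻¹ • m)) := by
    refine Measure.ext_of_lintegral _ fun f hf => ?_
    rw [lintegral_withDensity_eq_lintegral_mul _ hm1 hf,
      lintegral_withDensity_eq_lintegral_mul _ hm3 hf]
    have h1 := hP.lintegral_smul hsmooth (g * h) hf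
    have h2 := hP.lintegral_smul hsmooth h (f := fun m => f (g • m))
      (hf.comp (measurable_smul_mark hsmooth g))
    have h3 := hP.lintegral_smul hsmooth g (f := fun m => ENNReal.ofReal (P h (g⁻¹ • m)) * f m)
      (hm2.mul hf)
    simp only [inv_smul_smul] at h3
    simp only [mul_smul] at h1
    rw [h2, h3] at h1
    simpa only [Pi.mul_apply, mul_assoc] using h1.symm
  exact (withDensity_eq_iff_of_sigmaFinite hm1.aemeasurable hm3.aemeasurable).1 key

lemma IsDifferentiableDensity.one [SigmaFinite lam]
    (hP : IsDifferentiableDensity (e := e) (k := k) lam P) :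
    ∀ᵐ m ∂lam, ENNReal.ofReal (P 1 m) = 1 := by
  refine (withDensity_eq_iff_of_sigmaFinite (hP.measurable _).ennreal_ofReal.aemeasurable
    aemeasurable_const).1 ?_
  rw [← hP.density]
  simp only [one_smul]
  exact Measure.map_id'.trans withDensity_one.symm

/-- The derivative of the density along a one-parameter subgroup. -/
lemma IsDifferentiableDensity.hasDerivAt (hP : IsDifferentiableDensity (e := e) (k := k) lam P)
    (Y : GroupLieAlgebra (𝓡 k) G) (m : M) :
    HasDerivAt (fun t => P (oneParam Y t) m) (dDensity P m Y) 0 := by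
  have h : MDifferentiable (𝓡 k) 𝓘(ℝ, ℝ) (fun g : G => P g m) :=
    hP.differentiable.comp (mdifferentiable_id.prodMk mdifferentiable_const)
  exact hasDerivAt_comp_curve (oneParam_zero Y) (h 1) (hasMFDerivAt_oneParam_zero Y)

/-- `P` is only differentiable, so its derivative need not be continuous in m; it is measurable as a
pointwise limit of difference quotients along the one-parameter subgroup. -/
lemma IsDifferentiableDensity.measurable_dDensity
    (hP : IsDifferentiableDensity (e := e) (k := k) lam P) (Y : GroupLieAlgebra (𝓡 k) G) :
    Measurable (fun m => (dDensity P m Y : ℝ)) := by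
  refine measurable_of_tendsto_metrizable (f := fun (n : ℕ) m =>
    ((1 : ℝ) / (n + 1))⁻¹ * (P (oneParam Y (0 + 1 / ((n : ℝ) + 1))) m - P (oneParam Y 0) m))
    (fun n => ((hP.measurable _).sub (hP.measurable _)).const_mul _)
    (tendsto_pi_nhds.2 fun m => ?_)
  have h := (hasDerivAt_iff_tendsto_slope_zero.1 (hP.hasDerivAt Y m))
  have h1 : Tendsto (fun n : ℕ => (1 : ℝ) / ((n : ℝ) + 1)) atTop (𝓝[≠] 0) :=
    tendsto_nhdsWithin_iff.2 ⟨tendsto_one_div_add_atTop_nhds_zero_nat,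
      Eventually.of_forall fun n => by
        have : (0 : ℝ) < 1 / ((n : ℝ) + 1) := Nat.one_div_pos_of_nat
        exact this.ne'⟩
  exact h.comp h1

/-- Along almost every orbit of a one-parameter subgroup, the density of the translates is a
positive differentiable function, whose logarithmic derivative is that of the measure. -/
lemma IsDifferentiableDensity.orbit [SigmaFinite lam]
    (hP : IsDifferentiableDensity (e := e) (k := k) lam P)
    (hsmooth : ContMDiff ((𝓡 k).prod (𝓡 e)) (𝓡 e) ∞ (fun y : G × M => y.1 • y.2))
    (Y : GroupLieAlgebra (𝓡 k) G) :
    ∀ᵐ m ∂lam, ∀ s : ℝ, 0 < P (oneParam Y (-s)) m ∧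
      HasDerivAt (fun s => P (oneParam Y (-s)) m)
        (-(dDensity P (oneParam Y s • m) Y : ℝ) * P (oneParam Y (-s)) m) s := by
  have hinv : ∀ s : ℝ, (oneParam (G := G) Y (-s))⁻¹ = oneParam Y s := fun s => by
    rw [inv_eq_iff_mul_eq_one, ← oneParam_add, neg_add_cancel, oneParam_zero]
  -- For each pair of group elements the cocycle identity has its own null set. Rational times leave
  -- countably many, and continuity of `P` restores all real times below.
  have h1 : ∀ᵐ m ∂lam, ∀ q : ℚ × ℚ, ENNReal.ofReal (P (oneParam Y (-(q.1 : ℝ) + -(q.2 : ℝ))) m) =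
      ENNReal.ofReal (P (oneParam Y (-(q.1 : ℝ))) m) *
        ENNReal.ofReal (P (oneParam Y (-(q.2 : ℝ))) (oneParam Y (q.1 : ℝ) • m)) := by
    rw [ae_all_iff]
    intro q
    have := hP.cocycle hsmooth (oneParam Y (-(q.1 : ℝ))) (oneParam Y (-(q.2 : ℝ)))
    rw [← oneParam_add, hinv] at this
    exact this
  filter_upwards [h1, hP.one] with m hm hm1
  have hPc := hP.continuous
  have hγ := continuous_oneParam (k := k) (G := G) Y
  have hγm : Continuous fun s : ℝ => oneParam Y s • m :=
    hsmooth.continuous.comp (hγ.prodMk continuous_const)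
  -- the cocycle identity for the positive part
  have hall : ∀ s t : ℝ, max (P (oneParam Y (-s + -t)) m) 0 =
      max (P (oneParam Y (-s)) m) 0 * max (P (oneParam Y (-t)) (oneParam Y s • m)) 0 := by
    have hd : DenseRange (fun q : ℚ × ℚ => ((q.1 : ℝ), (q.2 : ℝ))) :=
      Rat.denseRange_cast.prodMap Rat.denseRange_cast
    have e1 : Continuous fun q : ℝ × ℝ => P (oneParam Y (-q.1 + -q.2)) m :=
      hPc.comp ((hγ.comp (by fun_prop)).prodMk continuous_const)
    have e2 : Continuous fun q : ℝ × ℝ => P (oneParam Y (-q.1)) m :=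
      hPc.comp ((hγ.comp (by fun_prop)).prodMk continuous_const)
    have e3 : Continuous fun q : ℝ × ℝ => P (oneParam Y (-q.2)) (oneParam Y q.1 • m) :=
      hPc.comp ((hγ.comp (by fun_prop)).prodMk (hγm.comp continuous_fst))
    have := hd.equalizer (e1.max continuous_const) ((e2.max continuous_const).mul
      (e3.max continuous_const)) (by
        funext q
        have := congrArg ENNReal.toReal (hm q)
        rwa [ENNReal.toReal_mul, ENNReal.toReal_ofReal', ENNReal.toReal_ofReal',
          ENNReal.toReal_ofReal'] at this)
    intro s t
    exact congrFun this (s, t)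
  have hone : max (P (oneParam Y 0) m) 0 = 1 := by
    rw [oneParam_zero, ← ENNReal.toReal_ofReal', hm1, ENNReal.toReal_one]
  -- The density hypothesis sees only the positive part of `P`, so the sign is not given. It follows
  -- from the cocycle identity for the times s and -s: the product of positive parts equals 1, so
  -- neither factor vanishes.
  have hpos : ∀ s, 0 < P (oneParam Y (-s)) m := fun s => by
    have := hall s (-s)
    rw [neg_neg, neg_add_cancel, hone] at this
    by_contra hn
    rw [max_eq_right (not_lt.1 hn), zero_mul] at this
    exact one_ne_zero this
  have hpos2 : ∀ s t, 0 < P (oneParam Y (-t)) (oneParam Y s • m) := fun s t => by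
    have h2 := hall s t
    have h3 := hpos (s + t)
    rw [neg_add] at h3
    by_contra hn
    rw [max_eq_left h3.le, max_eq_right (not_lt.1 hn), mul_zero] at h2
    exact h3.ne' h2
  have hmul : ∀ s t : ℝ, P (oneParam Y (-s + -t)) m =
      P (oneParam Y (-s)) m * P (oneParam Y (-t)) (oneParam Y s • m) := fun s t => by
    have h2 := hall s t
    have h3 := hpos (s + t)
    rw [neg_add] at h3
    rwa [max_eq_left h3.le, max_eq_left (hpos s).le, max_eq_left (hpos2 s t).le] at h2
  refine fun s => ⟨hpos s, ?_⟩
  -- The cocycle identity turns the derivative at time `s` into the derivative at the unit, taken at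
  -- the point exp(sY)m.
  have h4 : HasDerivAt (fun t => P (oneParam Y (0 - t)) (oneParam Y s • m))
      (-(dDensity P (oneParam Y s • m) Y : ℝ)) 0 := by
    refine HasDerivAt.comp_const_sub (f := fun t => P (oneParam Y t) (oneParam Y s • m)) 0 0 ?_
    rw [sub_zero]
    exact hP.hasDerivAt Y _
  have h5 := h4.const_mul (P (oneParam Y (-s)) m)
  rw [← sub_self s] at h5
  refine ((h5.comp_sub_const s s).congr_deriv (mul_comm _ _)).congr_of_eventuallyEq
    (Eventually.of_forall fun r => ?_)
  simp only []
  rw [show -r = -s + -(r - s) by ring, hmul, sub_self, zero_sub]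

end Cocycle

/-! ### Weighted L² control on the unit interval. -/

section UnitInterval

/-- Integrability with respect to a weight that is bounded below. -/
lemma integrableOn_of_sq_mul {g w : ℝ → ℝ} (hg : Measurable g) (hw : Continuous w)
    (hpos : ∀ s, 0 < w s) (h : IntegrableOn (fun s => w s * g s ^ 2) (Set.Ioc 0 1)) :
    IntegrableOn g (Set.Ioc 0 1) := by
  obtain ⟨s₀, -, hs₀⟩ := isCompact_Icc.exists_isMinOn (Set.nonempty_Icc.2 (zero_le_one (α := ℝ)))
    hw.continuousOn
  have hc := hpos s₀
  -- From |g| ≤ 1 + g² and the fact that the weight is at least its positive minimum `w s₀`.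
  refine Integrable.mono' (g := fun s => 1 + (w s₀)⁻¹ * (w s * g s ^ 2))
    ((integrable_const 1).add (h.const_mul _)) hg.aestronglyMeasurable ?_
  filter_upwards [ae_restrict_mem measurableSet_Ioc] with s hs
  have h1 : w s₀ ≤ w s := hs₀ ⟨hs.1.le, hs.2⟩
  have h2 : g s ^ 2 ≤ (w s₀)⁻¹ * (w s * g s ^ 2) := by
    rw [← mul_assoc]
    refine le_mul_of_one_le_left (sq_nonneg _) ?_
    rw [inv_mul_eq_div]
    exact (one_le_div hc).2 h1
  rw [Real.norm_eq_abs]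
  nlinarith [sq_nonneg (|g s| - 1), sq_abs (g s)]

/-- Convergence in a weighted `L²`-space of the unit interval implies convergence in `L¹`, if the
weight is bounded below. -/
lemma tendsto_integral_abs_of_sq {g : ℕ → ℝ → ℝ} {w : ℝ → ℝ} (hg : ∀ n, Measurable (g n))
    (hw : Continuous w) (hpos : ∀ s, 0 < w s)
    (h : Tendsto (fun n => ∫⁻ s in Set.Ioc (0 : ℝ) 1, ENNReal.ofReal (w s) *
      ENNReal.ofReal (g n s ^ 2)) atTop (𝓝 0)) :
    Tendsto (fun n => ∫ s in Set.Ioc (0 : ℝ) 1, |g n s|) atTop (𝓝 0) := by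
  obtain ⟨s₀, -, hs₀⟩ := isCompact_Icc.exists_isMinOn (Set.nonempty_Icc.2 (zero_le_one (α := ℝ)))
    hw.continuousOn
  have hc := hpos s₀
  set τ : Measure ℝ := volume.restrict (Set.Ioc (0 : ℝ) 1) with hτ
  have : IsProbabilityMeasure τ := ⟨by simp [hτ]⟩
  have h1 : Tendsto (fun n => ∫⁻ s, ENNReal.ofReal (g n s ^ 2) ∂τ) atTop (𝓝 0) := by
    have h2 := ENNReal.Tendsto.const_mul (a := ENNReal.ofReal (w s₀)⁻¹) h (Or.inr (by simp))
    rw [mul_zero] at h2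
    refine tendsto_of_tendsto_of_tendsto_of_le_of_le tendsto_const_nhds h2 (fun _ => zero_le)
      fun n => ?_
    rw [← lintegral_const_mul _ (by fun_prop)]
    refine lintegral_mono_ae ?_
    filter_upwards [ae_restrict_mem measurableSet_Ioc] with s hs
    have h1 : w s₀ ≤ w s := hs₀ ⟨hs.1.le, hs.2⟩
    rw [← mul_assoc, ← ENNReal.ofReal_mul (inv_nonneg.2 hc.le)]
    refine le_mul_of_one_le_left zero_le ?_
    rw [inv_mul_eq_div]
    exact ENNReal.one_le_ofReal.2 ((one_le_div hc).2 h1)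
  have h3 : Tendsto (fun n => eLpNorm (g n) 2 τ) atTop (𝓝 0) := by
    have h4 := (ENNReal.continuous_rpow_const (y := (1 / 2 : ℝ))).tendsto 0 |>.comp h1
    rw [ENNReal.zero_rpow_of_pos (by norm_num)] at h4
    refine h4.congr fun n => ?_
    rw [eLpNorm_eq_lintegral_rpow_enorm_toReal (by simp) (by simp)]
    simp only [Function.comp, ENNReal.toReal_ofNat]
    congr 1
    refine lintegral_congr fun s => ?_
    rw [← ofReal_norm, ENNReal.ofReal_rpow_of_nonneg (norm_nonneg _) (by norm_num)]
    congr 1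
    simp
  have h5 : Tendsto (fun n => eLpNorm (g n) 1 τ) atTop (𝓝 0) :=
    tendsto_of_tendsto_of_tendsto_of_le_of_le tendsto_const_nhds h3 (fun _ => zero_le)
      fun n => eLpNorm_le_eLpNorm_of_exponent_le (by norm_num) (hg n).aestronglyMeasurable
  have h6 := (ENNReal.tendsto_toReal ENNReal.zero_ne_top).comp h5
  rw [ENNReal.toReal_zero] at h6
  refine h6.congr fun n => ?_
  simp only [Function.comp, eLpNorm_one_eq_lintegral_enorm]
  rw [← integral_norm_eq_lintegral_enorm (hg n).aestronglyMeasurable]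
  rfl

end UnitInterval

/-! ### Integration by parts along one-parameter orbits in M. -/

section OrbitIntegration

variable {e k : ℕ} {M G : Type*}
  [TopologicalSpace M] [SecondCountableTopology M] [T2Space M]
  [ChartedSpace (EuclideanSpace ℝ (Fin e)) M] [IsManifold (𝓡 e) ∞ M]
  [MeasurableSpace M] [BorelSpace M]
  [TopologicalSpace G] [T2Space G] [ChartedSpace (EuclideanSpace ℝ (Fin k)) G] [Group G]
  [LieGroup (𝓡 k) ∞ G] [MulAction G M]

variable {lam : Measure M} {P : G → M → ℝ}

lemma continuous_orbit_smul
    (hsmooth : ContMDiff ((𝓡 k).prod (𝓡 e)) (𝓡 e) ∞ (fun y : G × M => y.1 • y.2))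
    (Y : GroupLieAlgebra (𝓡 k) G) :
    Continuous fun z : M × ℝ => oneParam Y z.2 • z.1 :=
  hsmooth.continuous.comp (((continuous_oneParam (k := k) (G := G) Y).comp continuous_snd).prodMk
    continuous_fst)

lemma IsDifferentiableDensity.continuous_orbit
    (hP : IsDifferentiableDensity (e := e) (k := k) lam P) (Y : GroupLieAlgebra (𝓡 k) G) :
    Continuous fun z : M × ℝ => P (oneParam Y (-z.2)) z.1 :=
  hP.continuous.comp (((continuous_oneParam (k := k) (G := G) Y).comp
    continuous_snd.neg).prodMk continuous_fst)

/-- Integration along the orbits of a one-parameter subgroup. -/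
lemma IsDifferentiableDensity.measurePreserving_orbit [SigmaFinite lam]
    (hP : IsDifferentiableDensity (e := e) (k := k) lam P)
    (hsmooth : ContMDiff ((𝓡 k).prod (𝓡 e)) (𝓡 e) ∞ (fun y : G × M => y.1 • y.2))
    (Y : GroupLieAlgebra (𝓡 k) G) (τ : Measure ℝ) [SFinite τ] :
    MeasurePreserving (fun z : M × ℝ => (oneParam Y z.2 • z.1, z.2))
      ((lam.prod τ).withDensity fun z => ENNReal.ofReal (P (oneParam Y (-z.2)) z.1))
      (lam.prod τ) := by
  have hΘ : Measurable fun z : M × ℝ => (oneParam Y z.2 • z.1, z.2) :=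
    (continuous_orbit_smul hsmooth Y).measurable.prodMk measurable_snd
  have hw : Measurable fun z : M × ℝ => ENNReal.ofReal (P (oneParam Y (-z.2)) z.1) :=
    (hP.continuous_orbit Y).measurable.ennreal_ofReal
  refine ⟨hΘ, Measure.ext_of_lintegral _ fun f hf => ?_⟩
  rw [lintegral_map hf hΘ]
  refine (lintegral_withDensity_eq_lintegral_mul _ hw (hf.comp hΘ)).trans ?_
  rw [lintegral_prod_symm _ (hw.mul (hf.comp hΘ)).aemeasurable,
    lintegral_prod_symm _ hf.aemeasurable]
  refine lintegral_congr fun s => ?_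
  -- For a fixed time the change of variables by exp(-sY) is applied to a function already moved by
  -- exp(sY); the two translations cancel and leave the density as weight.
  have h := hP.lintegral_smul hsmooth (oneParam Y (-s))
    (f := fun m => f (oneParam Y s • m, s))
    (hf.comp ((measurable_smul_mark hsmooth _).prodMk measurable_const))
  simp only [smul_smul, ← oneParam_add, add_neg_cancel, oneParam_zero, one_smul] at h
  exact h.symm

/-- Fubini for the shear (m, s) ↦ (exp(sY)m, s): an integrable function on M is integrable along
almost every orbit, with the density as weight. This supplies the hypotheses of the one-dimensional
formula. -/
lemma IsDifferentiableDensity.integrable_orbit [SigmaFinite lam]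
    (hP : IsDifferentiableDensity (e := e) (k := k) lam P)
    (hsmooth : ContMDiff ((𝓡 k).prod (𝓡 e)) (𝓡 e) ∞ (fun y : G × M => y.1 • y.2))
    (Y : GroupLieAlgebra (𝓡 k) G) {h : M → ℝ} (hh : Integrable h lam) :
    ∀ᵐ m ∂lam, IntegrableOn (fun s => P (oneParam Y (-s)) m * h (oneParam Y s • m))
      (Set.Ioc 0 1) := by
  set τ : Measure ℝ := volume.restrict (Set.Ioc (0 : ℝ) 1) with hτ
  have h1 : Integrable (fun z : M × ℝ => h z.1) (lam.prod τ) := hh.comp_fst τ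
  have h2 := (hP.measurePreserving_orbit hsmooth Y τ).integrable_comp_of_integrable h1
  have hw : Measurable fun z : M × ℝ => ENNReal.ofReal (P (oneParam Y (-z.2)) z.1) :=
    (hP.continuous_orbit Y).measurable.ennreal_ofReal
  rw [integrable_withDensity_iff_integrable_smul' hw (by simp)] at h2
  filter_upwards [h2.prod_right_ae, hP.orbit hsmooth Y] with m hm hm2
  refine hm.congr (Eventually.of_forall fun s => ?_)
  simp only [Function.comp, smul_eq_mul]
  rw [ENNReal.toReal_ofReal (hm2 s).1.le]

/-- Integration by parts along a one-parameter subgroup, for the square of a function in the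
Sobolev space. -/
lemma IsDifferentiableDensity.integral_byParts [SigmaFinite lam]
    (hP : IsDifferentiableDensity (e := e) (k := k) lam P)
    (hsmooth : ContMDiff ((𝓡 k).prod (𝓡 e)) (𝓡 e) ∞ (fun y : G × M => y.1 • y.2))
    (Y : GroupLieAlgebra (𝓡 k) G) {φ φ' : ℕ → M → ℝ} {f f' r r' : M → ℝ} {C : ℝ}
    (hφ : ∀ n m s, HasDerivAt (fun s => φ n (oneParam Y s • m)) (φ' n (oneParam Y s • m)) s)
    (hφc : ∀ n, Continuous (φ n)) (hφ'c : ∀ n, Continuous (φ' n))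
    (hf : ∀ m s, HasDerivAt (fun s => f (oneParam Y s • m)) (f' (oneParam Y s • m)) s)
    (hfc : Continuous f) (hf'c : Continuous f')
    (hfC : ∀ m, |f m| ≤ C) (hf'C : ∀ m, |f' m| ≤ C)
    (hr : Measurable r) (hr' : Measurable r')
    (hr2 : Integrable (fun m => r m ^ 2) lam) (hr2' : Integrable (fun m => r' m ^ 2) lam)
    (hlim : Tendsto (fun n => ∫⁻ m, (ENNReal.ofReal ((φ n m - r m) ^ 2) +
      ENNReal.ofReal ((φ' n m - r' m) ^ 2)) ∂lam) atTop (𝓝 0))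
    (hrP : Integrable (fun m => r m ^ 2 * (dDensity P m Y : ℝ)) lam) :
    Integrable (fun m => f' m * r m ^ 2 + 2 * f m * r m * r' m -
      f m * r m ^ 2 * (dDensity P m Y : ℝ)) lam ∧
    ∫ m, (f' m * r m ^ 2 + 2 * f m * r m * r' m -
      f m * r m ^ 2 * (dDensity P m Y : ℝ)) ∂lam = 0 := by
  obtain ⟨F, hF⟩ : ∃ F : M → ℝ, F = fun m => f' m * r m ^ 2 + 2 * f m * r m * r' m -
      f m * r m ^ 2 * (dDensity P m Y : ℝ) := ⟨_, rfl⟩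
  have hfr : Integrable (fun m => f m * r m ^ 2) lam :=
    hr2.bdd_mul (c := C) hfc.measurable.aestronglyMeasurable (Eventually.of_forall hfC)
  have hrr' : Integrable (fun m => r m * r' m) lam := by
    refine Integrable.mono' (hr2.add hr2') (hr.mul hr').aestronglyMeasurable
      (Eventually.of_forall fun m => ?_)
    simp only [Pi.add_apply, Real.norm_eq_abs, abs_mul]
    nlinarith [sq_abs (r m), sq_abs (r' m), sq_nonneg (|r m| - |r' m|), sq_nonneg (|r m|),
      sq_nonneg (|r' m|)]
  have hFi : Integrable F lam := by
    have e1 : Integrable (fun m => f' m * r m ^ 2) lam :=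
      hr2.bdd_mul (c := C) hf'c.measurable.aestronglyMeasurable (Eventually.of_forall hf'C)
    have e2 : Integrable (fun m => f m * (r m * r' m)) lam :=
      hrr'.bdd_mul (c := C) hfc.measurable.aestronglyMeasurable (Eventually.of_forall hfC)
    have e3 : Integrable (fun m => f m * (r m ^ 2 * (dDensity P m Y : ℝ))) lam :=
      hrP.bdd_mul (c := C) hfc.measurable.aestronglyMeasurable (Eventually.of_forall hfC)
    rw [hF]
    refine ((e1.add (e2.const_mul 2)).sub e3).congr (Eventually.of_forall fun m => ?_)
    simp only [Pi.add_apply, Pi.sub_apply]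
    ring
  have hdP := hP.measurable_dDensity Y
  have hFm : Measurable F := by
    rw [hF]
    exact ((hf'c.measurable.mul (hr.pow_const 2)).add
      (((hfc.measurable.const_mul 2).mul hr).mul hr')).sub
      ((hfc.measurable.mul (hr.pow_const 2)).mul hdP)
  suffices h : ∫ m, F m ∂lam = 0 by rw [hF] at hFi h; exact ⟨hFi, h⟩
  set τ : Measure ℝ := volume.restrict (Set.Ioc (0 : ℝ) 1) with hτ
  have hmp := hP.measurePreserving_orbit hsmooth Y τ
  have hwc := hP.continuous_orbit Y
  have hw : Measurable fun z : M × ℝ => ENNReal.ofReal (P (oneParam Y (-z.2)) z.1) :=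
    hwc.measurable.ennreal_ofReal
  have hoc := continuous_orbit_smul (e := e) (k := k) hsmooth Y
  have hprob : IsProbabilityMeasure τ := ⟨by simp [hτ]⟩
  -- convergence along almost every orbit
  obtain ⟨ns, hns, hsub⟩ := exists_subseq_ae_tendsto_zero (μ := lam)
    (f := fun n m => ∫⁻ s, ENNReal.ofReal (P (oneParam Y (-s)) m) *
      (ENNReal.ofReal ((φ n (oneParam Y s • m) - r (oneParam Y s • m)) ^ 2) +
        ENNReal.ofReal ((φ' n (oneParam Y s • m) - r' (oneParam Y s • m)) ^ 2)) ∂τ) (by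
      intro n
      refine (Measurable.lintegral_prod_right' (f := fun z : M × ℝ =>
        ENNReal.ofReal (P (oneParam Y (-z.2)) z.1) *
        (ENNReal.ofReal ((φ n (oneParam Y z.2 • z.1) - r (oneParam Y z.2 • z.1)) ^ 2) +
        ENNReal.ofReal ((φ' n (oneParam Y z.2 • z.1) - r' (oneParam Y z.2 • z.1)) ^ 2)))
        (hw.mul ?_)).aemeasurable
      exact (((((hφc n).measurable.sub hr).pow_const 2).ennreal_ofReal.add
        (((hφ'c n).measurable.sub hr').pow_const 2).ennreal_ofReal)).comp hoc.measurable) (by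
      refine hlim.congr fun n => ?_
      have hg : Measurable fun m => ENNReal.ofReal ((φ n m - r m) ^ 2) +
          ENNReal.ofReal ((φ' n m - r' m) ^ 2) :=
        ((((hφc n).measurable.sub hr).pow_const 2).ennreal_ofReal.add
        (((hφ'c n).measurable.sub hr').pow_const 2).ennreal_ofReal)
      have e1 := hmp.lintegral_comp (f := fun z : M × ℝ => ENNReal.ofReal ((φ n z.1 - r z.1) ^ 2) +
          ENNReal.ofReal ((φ' n z.1 - r' z.1) ^ 2)) (hg.comp measurable_fst)
      replace e1 :=
        (lintegral_withDensity_eq_lintegral_mul _ hw (hg.comp hoc.measurable)).symm.trans e1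
      rw [lintegral_prod _ (hw.mul (hg.comp hoc.measurable)).aemeasurable] at e1
      refine Eq.trans ?_ e1.symm
      refine Eq.trans ?_ (lintegral_prod _ (hg.comp measurable_fst).aemeasurable).symm
      simp only [Function.comp, lintegral_const, measure_univ, mul_one])
  -- With χ(s) = s(1 - s) this is Fχ + fr²χ', the integrand of the one-dimensional formula before it
  -- is transported by the shear. Its integral is computed in two ways: as a product integral it
  -- equals ∫F · ∫χ because ∫χ' = 0, and along the orbits it vanishes.
  obtain ⟨H, hH⟩ : ∃ H : M × ℝ → ℝ, H = fun z =>
      F z.1 * (z.2 * (1 - z.2)) + (f z.1 * r z.1 ^ 2) * (1 - 2 * z.2) := ⟨_, rfl⟩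
  have hχ : Integrable (fun s : ℝ => s * (1 - s)) τ :=
    ((by fun_prop : Continuous fun s : ℝ => s * (1 - s)).integrableOn_Ioc (a := 0) (b := 1))
  have hχ' : Integrable (fun s : ℝ => 1 - 2 * s) τ :=
    ((by fun_prop : Continuous fun s : ℝ => 1 - 2 * s).integrableOn_Ioc (a := 0) (b := 1))
  have hHi : Integrable H (lam.prod τ) := by
    rw [hH]
    exact (hFi.mul_prod hχ).add (hfr.mul_prod hχ')
  have hHint : ∫ z, H z ∂(lam.prod τ) = (∫ m, F m ∂lam) * (1 / 6) := by
    have i1 : ∫ s, s * (1 - s) ∂τ = 1 / 6 := by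
      rw [hτ, ← intervalIntegral.integral_of_le zero_le_one]
      simp only [mul_sub, mul_one, ← pow_two]
      rw [intervalIntegral.integral_sub (by simp) (by simp), integral_id, integral_pow]
      norm_num
    have i2 : ∫ s, (1 - 2 * s) ∂τ = 0 := by
      rw [hτ, ← intervalIntegral.integral_of_le zero_le_one,
        intervalIntegral.integral_sub intervalIntegrable_const
          ((by fun_prop : Continuous fun s : ℝ => 2 * s).intervalIntegrable _ _),
        intervalIntegral.integral_const_mul, integral_id, intervalIntegral.integral_const]
      norm_num
    rw [hH, integral_add (hFi.mul_prod hχ) (hfr.mul_prod hχ'), integral_prod_mul F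
      (fun s : ℝ => s * (1 - s)),
      integral_prod_mul (fun m => f m * r m ^ 2) (fun s : ℝ => 1 - 2 * s), i1, i2, mul_zero,
      add_zero]
  have hHm : Measurable H := by
    rw [hH]
    have := hfc.measurable
    fun_prop
  have hH0 : ∫ z, H z ∂(lam.prod τ) = 0 := by
    have hcomp : Integrable (fun z : M × ℝ =>
        (ENNReal.ofReal (P (oneParam Y (-z.2)) z.1)).toReal •
          H (oneParam Y z.2 • z.1, z.2)) (lam.prod τ) := by
      have h2 := hmp.integrable_comp_of_integrable hHi
      rwa [integrable_withDensity_iff_integrable_smul' hw (by simp)] at h2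
    rw [← hmp.map_eq, integral_map hmp.measurable.aemeasurable hHm.aestronglyMeasurable,
      integral_withDensity_eq_integral_toReal_smul hw (by simp), integral_prod _ hcomp]
    refine integral_eq_zero_of_ae ?_
    filter_upwards [hsub, hP.orbit hsmooth Y, hP.integrable_orbit hsmooth Y hr2,
      hP.integrable_orbit hsmooth Y hr2', hP.integrable_orbit hsmooth Y hrP] with m hm hpos i1 i2 i3
    have hγ : Continuous fun s : ℝ => oneParam Y s • m :=
      hoc.comp (continuous_const.prodMk continuous_id)
    have hwm : Continuous fun s : ℝ => P (oneParam Y (-s)) m :=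
      hwc.comp (continuous_const.prodMk continuous_id)
    have hrm : Measurable fun s : ℝ => r (oneParam Y s • m) := hr.comp hγ.measurable
    have hrm' : Measurable fun s : ℝ => r' (oneParam Y s • m) := hr'.comp hγ.measurable
    have l1 : Tendsto (fun n => ∫ s in Set.Ioc (0 : ℝ) 1,
        |φ (ns n) (oneParam Y s • m) - r (oneParam Y s • m)|) atTop (𝓝 0) := by
      refine tendsto_integral_abs_of_sq (w := fun s => P (oneParam Y (-s)) m)
        (fun n => ((hφc _).comp hγ).measurable.sub hrm) hwm (fun s => (hpos s).1)
        (tendsto_of_tendsto_of_tendsto_of_le_of_le tendsto_const_nhds hm (fun _ => zero_le)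
          fun n => lintegral_mono fun s => ?_)
      exact mul_le_mul_right (le_self_add) _
    have l2 : Tendsto (fun n => ∫ s in Set.Ioc (0 : ℝ) 1,
        |φ' (ns n) (oneParam Y s • m) - r' (oneParam Y s • m)|) atTop (𝓝 0) := by
      refine tendsto_integral_abs_of_sq (w := fun s => P (oneParam Y (-s)) m)
        (fun n => ((hφ'c _).comp hγ).measurable.sub hrm') hwm (fun s => (hpos s).1)
        (tendsto_of_tendsto_of_tendsto_of_le_of_le tendsto_const_nhds hm (fun _ => zero_le)
          fun n => lintegral_mono fun s => ?_)
      exact mul_le_mul_right (le_add_self) _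
    -- `i1` and `i2` say that r² and r'² are integrable against the positive continuous weight, so r
    -- and r' are integrable on the orbit. For the derivative of the weight nothing beyond `i3`, the
    -- integrability of r²w', is available or needed.
    have key := integral_unitInterval_byParts
      (φ := fun n s => φ (ns n) (oneParam Y s • m)) (φ' := fun n s => φ' (ns n) (oneParam Y s • m))
      (r := fun s => r (oneParam Y s • m)) (r' := fun s => r' (oneParam Y s • m))
      (f := fun s => f (oneParam Y s • m)) (f' := fun s => f' (oneParam Y s • m))
      (w := fun s => P (oneParam Y (-s)) m)
      (w' := fun s => -(dDensity P (oneParam Y s • m) Y : ℝ) * P (oneParam Y (-s)) m)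
      (χ := fun s => s * (1 - s)) (χ' := fun s => 1 - 2 * s)
      (fun n s => hφ (ns n) m s) (fun n => (hφ'c _).comp hγ)
      (integrableOn_of_sq_mul hrm hwm (fun s => (hpos s).1) i1)
      (integrableOn_of_sq_mul hrm' hwm (fun s => (hpos s).1) i2)
      l1 l2 (fun s => hf m s) (hf'c.comp hγ) (fun s => (hpos s).2)
      (fun s => (((hasDerivAt_id s).mul ((hasDerivAt_id s).const_sub 1))).congr_deriv (by
        simp only [id]; ring)) (by fun_prop) (by simp) (by simp)
      (i3.neg.congr (Eventually.of_forall fun s => by simp only [Pi.neg_apply]; ring))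
    refine (integral_congr_ae (Eventually.of_forall fun s => ?_)).trans key
    simp only [smul_eq_mul]
    rw [ENNReal.toReal_ofReal (hpos s).1.le, hH, hF]
    ring
  rw [hHint] at hH0
  linarith

end OrbitIntegration

/-! ### The Gram matrix of the metric under changes of chart. -/

section Gram

variable {d : ℕ} {X : Type*} [TopologicalSpace X] [ChartedSpace (EuclideanSpace ℝ (Fin d)) X]
  [IsManifold (𝓡 d) ∞ X] [RiemannianBundle (fun x : X => TangentSpace (𝓡 d) x)]

/-- Expressing the matrix through an abstract frame at the point `x`, rather than at the image of
coordinates, puts the frames of two charts into one tangent space, where they can be compared. -/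
lemma gram_eq_inner {c x : X} (hx : x ∈ (extChartAt (𝓡 d) c).source)
    {w : Fin d → TangentSpace (𝓡 d) x}
    (hw : ∀ i, (mfderiv (𝓡 d) (𝓡 d) (extChartAt (𝓡 d) c) x (w i) : EuclideanSpace ℝ (Fin d)) =
      EuclideanSpace.single i (1 : ℝ)) (i j : Fin d) :
    gram c (extChartAt (𝓡 d) c x) i j = inner ℝ (w i) (w j) := by
  obtain ⟨y, hy, rfl⟩ : ∃ y ∈ (extChartAt (𝓡 d) c).target, (extChartAt (𝓡 d) c).symm y = x :=
    ⟨_, (extChartAt (𝓡 d) c).map_source hx, (extChartAt (𝓡 d) c).left_inv hx⟩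
  rw [(extChartAt (𝓡 d) c).right_inv hy]
  have h : ∀ i, (mfderiv (𝓡 d) (𝓡 d) (extChartAt (𝓡 d) c).symm y
      (EuclideanSpace.single i (1 : ℝ)) : TangentSpace (𝓡 d) ((extChartAt (𝓡 d) c).symm y)) =
      w i := fun i => by
    have := mfderiv_chart_symm_mfderiv_chart c hy (w i)
    exact (congrArg _ (hw i)).symm.trans this
  exact congrArg₂ (fun u v : TangentSpace (𝓡 d) ((extChartAt (𝓡 d) c).symm y) => inner ℝ u v)
    (h i) (h j)

omit [RiemannianBundle (fun x : X => TangentSpace (𝓡 d) x)] in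
lemma exists_frame {c x : X} (hx : x ∈ (extChartAt (𝓡 d) c).source) :
    ∃ w : Fin d → TangentSpace (𝓡 d) x,
      (∀ i, (mfderiv (𝓡 d) (𝓡 d) (extChartAt (𝓡 d) c) x (w i) : EuclideanSpace ℝ (Fin d)) =
        EuclideanSpace.single i (1 : ℝ)) ∧
      (∀ B : TangentSpace (𝓡 d) x →L[ℝ] EuclideanSpace ℝ (Fin d),
        B = mfderiv (𝓡 d) (𝓡 d) (extChartAt (𝓡 d) c) x → ∀ u, u = ∑ i, B u i • w i) ∧
      LinearIndependent ℝ w := by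
  obtain ⟨y, hy, rfl⟩ : ∃ y ∈ (extChartAt (𝓡 d) c).target, (extChartAt (𝓡 d) c).symm y = x :=
    ⟨_, (extChartAt (𝓡 d) c).map_source hx, (extChartAt (𝓡 d) c).left_inv hx⟩
  obtain ⟨A, hA⟩ : ∃ A : EuclideanSpace ℝ (Fin d) →L[ℝ]
    TangentSpace (𝓡 d) ((extChartAt (𝓡 d) c).symm y),
    A = mfderiv (𝓡 d) (𝓡 d) (extChartAt (𝓡 d) c).symm y := ⟨_, rfl⟩
  obtain ⟨B, hB⟩ : ∃ B : TangentSpace (𝓡 d) ((extChartAt (𝓡 d) c).symm y) →L[ℝ]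
    EuclideanSpace ℝ (Fin d),
    B = mfderiv (𝓡 d) (𝓡 d) (extChartAt (𝓡 d) c) ((extChartAt (𝓡 d) c).symm y) := ⟨_, rfl⟩
  have hAB : ∀ u, A (B u) = u := fun u => by
    rw [hA, hB]; exact mfderiv_chart_symm_mfderiv_chart c hy u
  have hBA : ∀ u, B (A u) = u := fun u => by
    rw [hA, hB]; exact mfderiv_chart_mfderiv_chart_symm c hy u
  have hsum : ∀ u : EuclideanSpace ℝ (Fin d), u = ∑ i, u i • EuclideanSpace.single i (1 : ℝ) :=
    fun u => by
      have := (EuclideanSpace.basisFun (Fin d) ℝ).sum_repr u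
      simpa using this.symm
  refine ⟨fun i => A (EuclideanSpace.single i 1), fun i => ?_, fun B' hB' u => ?_, ?_⟩
  · have := hBA (EuclideanSpace.single i 1)
    rw [hB] at this
    exact this
  · have h1 := congrArg A (hsum (B u))
    rw [hAB, map_sum] at h1
    simp only [map_smul] at h1
    rw [hB', ← hB]
    exact h1
  · have h1 : LinearIndependent ℝ fun i : Fin d => (EuclideanSpace.single i 1 : EuclideanSpace ℝ (Fin d)) := by
      have := (EuclideanSpace.basisFun (Fin d) ℝ).toBasis.linearIndependent
      have h : (fun i : Fin d => (EuclideanSpace.single i 1 : EuclideanSpace ℝ (Fin d))) =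
          (EuclideanSpace.basisFun (Fin d) ℝ).toBasis := by ext i; simp
      rw [h]
      exact this
    refine h1.map' A.toLinearMap (LinearMap.ker_eq_bot.2 fun u v huv => ?_)
    have : A u = A v := huv
    rw [← hBA u, this, hBA]

lemma volDensity_pos {c : X} {y : EuclideanSpace ℝ (Fin d)}
    (hy : y ∈ (extChartAt (𝓡 d) c).target) : 0 < volDensity c y := by
  obtain ⟨x, hx, rfl⟩ : ∃ x ∈ (extChartAt (𝓡 d) c).source, extChartAt (𝓡 d) c x = y :=
    ⟨_, (extChartAt (𝓡 d) c).map_target hy, (extChartAt (𝓡 d) c).right_inv hy⟩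
  obtain ⟨w, hw, -, hli⟩ := exists_frame hx
  have : gram c (extChartAt (𝓡 d) c x) = Matrix.gram ℝ w := by
    ext i j
    exact gram_eq_inner hx hw i j
  rw [volDensity, this]
  exact Real.sqrt_pos.2 (Matrix.posDef_gram_of_linearIndependent hli).det_pos

/-- The transformation rule of `√(det g)` under a change of charts. -/
lemma hasFDerivAt_transition {c c' x : X} (hx : x ∈ (extChartAt (𝓡 d) c).source)
    (hx' : x ∈ (extChartAt (𝓡 d) c').source) :
    ∃ A : EuclideanSpace ℝ (Fin d) →L[ℝ] EuclideanSpace ℝ (Fin d),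
      HasFDerivAt (extChartAt (𝓡 d) c' ∘ (extChartAt (𝓡 d) c).symm) A (extChartAt (𝓡 d) c x) ∧
      volDensity c (extChartAt (𝓡 d) c x) = |A.det| * volDensity c' (extChartAt (𝓡 d) c' x) := by
  obtain ⟨w, hw, -, -⟩ := exists_frame hx
  obtain ⟨w', hw', hsum, -⟩ := exists_frame hx'
  obtain ⟨A, hA, hAw⟩ : ∃ A : EuclideanSpace ℝ (Fin d) →L[ℝ] EuclideanSpace ℝ (Fin d),
      HasFDerivAt (extChartAt (𝓡 d) c' ∘ (extChartAt (𝓡 d) c).symm) A (extChartAt (𝓡 d) c x) ∧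
      ∀ i, A (EuclideanSpace.single i 1) =
        mfderiv (𝓡 d) (𝓡 d) (extChartAt (𝓡 d) c') x (w i) := by
    obtain ⟨y, hy, rfl⟩ : ∃ y ∈ (extChartAt (𝓡 d) c).target, (extChartAt (𝓡 d) c).symm y = x :=
      ⟨_, (extChartAt (𝓡 d) c).map_source hx, (extChartAt (𝓡 d) c).left_inv hx⟩
    rw [(extChartAt (𝓡 d) c).right_inv hy]
    have h1 := ((mdifferentiableAt_chart c' hx').hasMFDerivAt.comp y
      (mdifferentiableAt_chart_symm c hy).hasMFDerivAt)
    refine ⟨_, h1.hasFDerivAt, fun i => ?_⟩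
    have h2 := mfderiv_chart_symm_mfderiv_chart c hy (w i)
    have h3 := (congrArg _ (hw i)).symm.trans h2
    exact congrArg _ h3
  refine ⟨A, hA, ?_⟩
  set J : Matrix (Fin d) (Fin d) ℝ := fun k i => A (EuclideanSpace.single i 1) k with hJ
  have hdet : A.det = J.det := by
    have h1 := LinearMap.det_toMatrix (EuclideanSpace.basisFun (Fin d) ℝ).toBasis A.toLinearMap
    have h2 : LinearMap.toMatrix (EuclideanSpace.basisFun (Fin d) ℝ).toBasis
        (EuclideanSpace.basisFun (Fin d) ℝ).toBasis A.toLinearMap = J := by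
      ext k i
      simp [LinearMap.toMatrix_apply, hJ]
    rw [h2] at h1
    exact h1.symm
  -- The columns of `J` are the coordinates of the first frame in the second. Taking determinants
  -- and square roots gives the factor |det J|.
  have hg : gram c (extChartAt (𝓡 d) c x) = J.transpose * gram c' (extChartAt (𝓡 d) c' x) * J := by
    ext i j
    have hwi : ∀ i, w i = ∑ k, J k i • w' k := fun i => by
      simp only [hJ, hAw]
      exact hsum _ rfl (w i)
    rw [gram_eq_inner hx hw i j, hwi i, hwi j, sum_inner]
    simp only [inner_sum, Matrix.mul_apply, Matrix.transpose_apply, Finset.sum_mul]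
    rw [Finset.sum_comm]
    refine Finset.sum_congr rfl fun l _ => Finset.sum_congr rfl fun m _ => ?_
    rw [gram_eq_inner hx' hw' m l, real_inner_smul_left, real_inner_smul_right]
    ring
  rw [volDensity, volDensity, hg, Matrix.det_mul, Matrix.det_mul, Matrix.det_transpose, hdet,
    show J.det * (gram c' (extChartAt (𝓡 d) c' x)).det * J.det =
      J.det ^ 2 * (gram c' (extChartAt (𝓡 d) c' x)).det by ring,
    Real.sqrt_mul (sq_nonneg _), Real.sqrt_sq_eq_abs]

/-- The coordinate fields are the tangent map of the inverse chart along constant sections, so their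
inner products are C¹; the determinant is positive, so its square root is C¹ as well. -/
lemma contDiffOn_volDensity [IsContMDiffRiemannianBundle (𝓡 d) ∞ (EuclideanSpace ℝ (Fin d))
      (fun x : X => TangentSpace (𝓡 d) x)] (c : X) :
    ContDiffOn ℝ 1 (volDensity (d := d) c) (extChartAt (𝓡 d) c).target := by
  have hU := isOpen_extChartAt_target (I := 𝓡 d) c
  have hsec : ∀ w : EuclideanSpace ℝ (Fin d), ContMDiffOn (𝓡 d) (𝓡 d).tangent 1
      (fun y => (⟨(extChartAt (𝓡 d) c).symm y,
        mfderiv (𝓡 d) (𝓡 d) (extChartAt (𝓡 d) c).symm y w⟩ : TangentBundle (𝓡 d) X))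
      (extChartAt (𝓡 d) c).target := fun w => by
    have h1 : ContMDiffOn (𝓡 d).tangent (𝓡 d).tangent 1
        (tangentMapWithin (𝓡 d) (𝓡 d) (extChartAt (𝓡 d) c).symm (extChartAt (𝓡 d) c).target)
        (π (EuclideanSpace ℝ (Fin d)) (TangentSpace (𝓡 d)) ⁻¹' (extChartAt (𝓡 d) c).target) :=
      (contMDiffOn_extChartAt_symm (I := 𝓡 d) (n := ∞) c).contMDiffOn_tangentMapWithin
        (by norm_num; exact WithTop.coe_le_coe.2 (le_top : (2 : ℕ∞) ≤ ⊤)) hU.uniqueMDiffOn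
    have h2 := (contMDiff_vectorSpace_iff_contDiff (𝕜 := ℝ) (E := EuclideanSpace ℝ (Fin d))
      (n := 1) (V := fun _ => w)).2 contDiff_const
    refine (h1.comp h2.contMDiffOn (fun y hy => hy)).congr fun y hy => ?_
    simp only [Function.comp, tangentMapWithin]
    rw [mfderivWithin_of_isOpen hU hy]
  have hg : ∀ i j, ContDiffOn ℝ 1 (fun y => gram (d := d) c y i j) (extChartAt (𝓡 d) c).target := by
    intro i j
    rw [← contMDiffOn_iff_contDiffOn]
    have : IsContMDiffRiemannianBundle (𝓡 d) 1 (EuclideanSpace ℝ (Fin d))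
      (fun x : X => TangentSpace (𝓡 d) x) :=
      IsContMDiffRiemannianBundle.of_le (n := ∞) (by exact_mod_cast le_top)
    have := (hsec (EuclideanSpace.single i 1)).inner_bundle (hsec (EuclideanSpace.single j 1))
    exact this
  have hdet : ContDiffOn ℝ 1 (fun y => (gram (d := d) c y).det) (extChartAt (𝓡 d) c).target := by
    simp only [Matrix.det_apply]
    exact ContDiffOn.sum fun σ _ => (contDiffOn_prod fun i _ => hg _ _).const_smul _
  refine hdet.sqrt fun y hy => ?_
  have := volDensity_pos hy
  exact (Real.sqrt_pos.1 this).ne'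

end Gram

/-- Every member is at most κ plus the restriction of the supremum to the complement of U, hence so
is the supremum, and the second summand disappears on U. This controls the least upper bound that
defines the volume inside a single chart. -/
lemma restrict_iSup_le {α ι : Type*} [MeasurableSpace α] {μ : ι → Measure α} {κ : Measure α}
    {U : Set α} (hU : MeasurableSet U) (h : ∀ i, (μ i).restrict U ≤ κ) :
    (⨆ i, μ i).restrict U ≤ κ := by
  have h1 : (⨆ i, μ i) ≤ κ + (⨆ i, μ i).restrict Uᶜ := iSup_le fun i => by
    rw [← Measure.restrict_add_restrict_compl (μ := μ i) hU]
    exact add_le_add (h i) (Measure.restrict_mono le_rfl (le_iSup μ i))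
  calc (⨆ i, μ i).restrict U ≤ (κ + (⨆ i, μ i).restrict Uᶜ).restrict U :=
        Measure.restrict_mono le_rfl h1
    _ = κ.restrict U := by
        rw [Measure.restrict_add, Measure.restrict_restrict hU, Set.inter_compl_self,
          Measure.restrict_empty, add_zero]
    _ ≤ κ := Measure.restrict_le_self

/-! ### The Riemannian volume in charts. -/

section Volume

variable {d : ℕ} {X : Type*} [TopologicalSpace X] [ChartedSpace (EuclideanSpace ℝ (Fin d)) X]
  [IsManifold (𝓡 d) ∞ X] [RiemannianBundle (fun x : X => TangentSpace (𝓡 d) x)]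
  [IsContMDiffRiemannianBundle (𝓡 d) ∞ (EuclideanSpace ℝ (Fin d))
      (fun x : X => TangentSpace (𝓡 d) x)]
  [MeasurableSpace X] [BorelSpace X]

omit [IsManifold (𝓡 d) ∞ X] [RiemannianBundle (fun x : X => TangentSpace (𝓡 d) x)]
  [IsContMDiffRiemannianBundle (𝓡 d) ∞ (EuclideanSpace ℝ (Fin d))
      (fun x : X => TangentSpace (𝓡 d) x)] in
lemma aemeasurable_chart_symm (c : X) : AEMeasurable (extChartAt (𝓡 d) c).symm
    ((volume : Measure (EuclideanSpace ℝ (Fin d))).restrict (extChartAt (𝓡 d) c).target) :=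
  (continuousOn_extChartAt_symm c).aemeasurable (isOpen_extChartAt_target c).measurableSet

omit [IsManifold (𝓡 d) ∞ X] [RiemannianBundle (fun x : X => TangentSpace (𝓡 d) x)]
  [IsContMDiffRiemannianBundle (𝓡 d) ∞ (EuclideanSpace ℝ (Fin d))
      (fun x : X => TangentSpace (𝓡 d) x)] in
lemma measurableSet_target_inter (c : X) {A : Set X} (hA : MeasurableSet A) :
    MeasurableSet ((extChartAt (𝓡 d) c).target ∩ (extChartAt (𝓡 d) c).symm ⁻¹' A) := by
  classical
  have hU := (isOpen_extChartAt_target (I := 𝓡 d) c).measurableSet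
  have hc : Measurable ((extChartAt (𝓡 d) c).target.piecewise (extChartAt (𝓡 d) c).symm
      fun _ => c) :=
    (continuousOn_extChartAt_symm c).measurable_piecewise continuousOn_const hU
  convert hU.inter (hc hA) using 1
  ext y
  simp only [Set.mem_inter_iff, Set.mem_preimage]
  refine and_congr_right fun hy => ?_
  rw [Set.piecewise_eq_of_mem _ _ _ hy]

omit [MeasurableSpace X] [BorelSpace X] in
lemma aemeasurable_volDensity (c : X) :
    AEMeasurable (fun y => ENNReal.ofReal (volDensity (d := d) c y))
    ((volume : Measure (EuclideanSpace ℝ (Fin d))).restrict (extChartAt (𝓡 d) c).target) :=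
  ((contDiffOn_volDensity c).continuousOn.aemeasurable
    (isOpen_extChartAt_target c).measurableSet).ennreal_ofReal

lemma lintegral_localVolume (c : X) {F : X → ENNReal} (hF : Measurable F) :
    ∫⁻ x, F x ∂(localVolume (d := d) c) = ∫⁻ y in (extChartAt (𝓡 d) c).target,
      ENNReal.ofReal (volDensity c y) * F ((extChartAt (𝓡 d) c).symm y) := by
  have h1 := aemeasurable_chart_symm (d := d) c
  have h2 := aemeasurable_volDensity (d := d) c
  rw [localVolume, lintegral_map' hF.aemeasurable
    (h1.mono_ac (withDensity_absolutelyContinuous _ _))]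
  exact lintegral_withDensity_eq_lintegral_mul₀ h2 (hF.comp_aemeasurable h1)

lemma localVolume_apply (c : X) {A : Set X} (hA : MeasurableSet A) :
    localVolume (d := d) c A =
      ∫⁻ y in (extChartAt (𝓡 d) c).target ∩ (extChartAt (𝓡 d) c).symm ⁻¹' A,
        ENNReal.ofReal (volDensity c y) := by
  have hm := measurableSet_target_inter (d := d) c hA
  rw [← lintegral_indicator_one hA, lintegral_localVolume c (measurable_one.indicator hA),
    ← lintegral_indicator (isOpen_extChartAt_target c).measurableSet, ← lintegral_indicator hm]
  refine lintegral_congr fun y => ?_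
  by_cases h1 : y ∈ (extChartAt (𝓡 d) c).target
  · by_cases h2 : (extChartAt (𝓡 d) c).symm y ∈ A
    · simp only [Set.indicator, Set.mem_inter_iff, Set.mem_preimage, h1, h2, and_self, if_true,
        Pi.one_apply, mul_one]
    · simp only [Set.indicator, Set.mem_inter_iff, Set.mem_preimage, h1, h2, and_false, if_true,
        if_false, mul_zero]
  · simp only [Set.indicator, Set.mem_inter_iff, h1, false_and, if_false]

lemma localVolume_source_compl (c : X) :
    localVolume (d := d) c (extChartAt (𝓡 d) c).sourceᶜ = 0 := by
  rw [localVolume_apply c (isOpen_extChartAt_source c).measurableSet.compl]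
  have : (extChartAt (𝓡 d) c).target ∩ (extChartAt (𝓡 d) c).symm ⁻¹'
      (extChartAt (𝓡 d) c).sourceᶜ = ∅ := by
    ext y
    simp only [Set.mem_inter_iff, Set.mem_preimage, Set.mem_compl_iff, Set.mem_empty_iff_false,
      iff_false, not_and, not_not]
    exact fun hy => (extChartAt (𝓡 d) c).map_target hy
  rw [this, Measure.restrict_empty, lintegral_zero_measure]

/-- The Riemannian volumes on the domains of two charts agree on the overlap. -/
lemma localVolume_congr (c c' : X) {A : Set X} (hA : MeasurableSet A)
    (h : A ⊆ (extChartAt (𝓡 d) c).source) (h' : A ⊆ (extChartAt (𝓡 d) c').source) :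
    localVolume (d := d) c A = localVolume (d := d) c' A := by
  set s := extChartAt (𝓡 d) c '' A with hs
  have key : ∀ (b : X), A ⊆ (extChartAt (𝓡 d) b).source →
      (extChartAt (𝓡 d) b).target ∩ (extChartAt (𝓡 d) b).symm ⁻¹' A = extChartAt (𝓡 d) b '' A := by
    intro b hb
    ext y
    constructor
    · rintro ⟨hy, hyA⟩
      exact ⟨_, hyA, (extChartAt (𝓡 d) b).right_inv hy⟩
    · rintro ⟨x, hx, rfl⟩
      refine ⟨(extChartAt (𝓡 d) b).map_source (hb hx), ?_⟩
      rw [Set.mem_preimage, (extChartAt (𝓡 d) b).left_inv (hb hx)]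
      exact hx
  have hsm : MeasurableSet s := by
    rw [hs, ← key c h]
    exact measurableSet_target_inter c hA
  rw [localVolume_apply c hA, localVolume_apply c' hA, key c h, key c' h', ← hs]
  have htr : ∀ x : A, ∃ A : EuclideanSpace ℝ (Fin d) →L[ℝ] EuclideanSpace ℝ (Fin d),
      HasFDerivAt (extChartAt (𝓡 d) c' ∘ (extChartAt (𝓡 d) c).symm) A (extChartAt (𝓡 d) c x) ∧
      volDensity c (extChartAt (𝓡 d) c x) = |A.det| * volDensity c' (extChartAt (𝓡 d) c' x) :=
    fun x => hasFDerivAt_transition (h x.2) (h' x.2)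
  choose T hT hTv using htr
  have hex : ∀ y, ∃ B : EuclideanSpace ℝ (Fin d) →L[ℝ] EuclideanSpace ℝ (Fin d), y ∈ s →
      HasFDerivAt (extChartAt (𝓡 d) c' ∘ (extChartAt (𝓡 d) c).symm) B y ∧
      volDensity c y = |B.det| * volDensity c' ((extChartAt (𝓡 d) c' ∘
        (extChartAt (𝓡 d) c).symm) y) := by
    intro y
    by_cases hy : y ∈ s
    · obtain ⟨x, hx, rfl⟩ := hy
      refine ⟨T ⟨x, hx⟩, fun _ => ⟨hT _, ?_⟩⟩
      rw [Function.comp_apply, (extChartAt (𝓡 d) c).left_inv (h hx)]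
      exact hTv ⟨x, hx⟩
    · exact ⟨0, fun h => absurd h hy⟩
  choose B hB using hex
  have himg : (extChartAt (𝓡 d) c' ∘ (extChartAt (𝓡 d) c).symm) '' s = extChartAt (𝓡 d) c' '' A := by
    rw [hs, Set.image_image]
    refine Set.image_congr fun x hx => ?_
    rw [Function.comp_apply, (extChartAt (𝓡 d) c).left_inv (h hx)]
  have hinj : Set.InjOn (extChartAt (𝓡 d) c' ∘ (extChartAt (𝓡 d) c).symm) s := by
    rintro _ ⟨x, hx, rfl⟩ _ ⟨y, hy, rfl⟩ hxy
    simp only [Function.comp, (extChartAt (𝓡 d) c).left_inv (h hx),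
      (extChartAt (𝓡 d) c).left_inv (h hy)] at hxy
    rw [(extChartAt (𝓡 d) c').injOn (h' hx) (h' hy) hxy]
  -- Change of variables under the transition map; its Jacobian is exactly the ratio of the two
  -- densities √(det g).
  rw [← himg, lintegral_image_eq_lintegral_abs_det_fderiv_mul volume hsm
    (fun y hy => (hB y hy).1.hasFDerivWithinAt) hinj]
  refine setLIntegral_congr_fun hsm fun y hy => ?_
  rw [(hB y hy).2, ENNReal.ofReal_mul (abs_nonneg _)]

/-- In a chart, the Riemannian volume has the density `√(det g)`. -/
lemma riemannianVolume_restrict (c : X) :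
    (riemannianVolume d X).restrict (extChartAt (𝓡 d) c).source = localVolume (d := d) c := by
  have hU := (isOpen_extChartAt_source (I := 𝓡 d) c).measurableSet
  refine le_antisymm (restrict_iSup_le hU fun c' => Measure.le_iff.2 fun A hA => ?_) ?_
  · have hU' := (isOpen_extChartAt_source (I := 𝓡 d) c').measurableSet
    rw [Measure.restrict_apply hA, ← measure_inter_add_sdiff (A ∩ _) hU',
      measure_mono_null (Set.sdiff_subset_compl _ _) (localVolume_source_compl c'), add_zero,
      localVolume_congr c' c ((hA.inter hU).inter hU') Set.inter_subset_right
        (Set.inter_subset_left.trans Set.inter_subset_right)]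
    exact measure_mono (Set.inter_subset_left.trans Set.inter_subset_left)
  · have h1 : localVolume (d := d) c = (localVolume (d := d) c).restrict
        (extChartAt (𝓡 d) c).source := by
      refine (Measure.restrict_eq_self_of_ae_mem ?_).symm
      rw [ae_iff]
      exact localVolume_source_compl c
    rw [h1]
    exact Measure.restrict_mono le_rfl (le_iSup (fun c : X => localVolume (d := d) c) c)

instance isLocallyFiniteMeasure_riemannianVolume :
    IsLocallyFiniteMeasure (riemannianVolume d X) := by
  refine ⟨fun c => ?_⟩
  have hU := isOpen_extChartAt_target (I := 𝓡 d) c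
  have hS := isOpen_extChartAt_source (I := 𝓡 d) c
  obtain ⟨r, hr, hrs⟩ := Metric.nhds_basis_closedBall.mem_iff.1
    (hU.mem_nhds (mem_extChartAt_target (I := 𝓡 d) c))
  set K := Metric.closedBall (extChartAt (𝓡 d) c c) r with hK
  have hKc : IsCompact K := isCompact_closedBall _ _
  obtain ⟨C, hC⟩ := hKc.exists_bound_of_continuousOn
    ((contDiffOn_volDensity (d := d) c).continuousOn.mono hrs)
  set V := (extChartAt (𝓡 d) c).source ∩
    extChartAt (𝓡 d) c ⁻¹' Metric.ball (extChartAt (𝓡 d) c c) r with hV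
  have hVo : IsOpen V := (continuousOn_extChartAt c).isOpen_inter_preimage hS Metric.isOpen_ball
  refine ⟨V, hVo.mem_nhds ⟨mem_extChartAt_source c, Metric.mem_ball_self hr⟩, ?_⟩
  have h1 : riemannianVolume d X V = localVolume (d := d) c V := by
    rw [← riemannianVolume_restrict, Measure.restrict_apply hVo.measurableSet,
      Set.inter_eq_left.2 Set.inter_subset_left]
  rw [h1, localVolume_apply c hVo.measurableSet]
  calc _ ≤ ∫⁻ y in K, ENNReal.ofReal (volDensity (d := d) c y) := by
        refine lintegral_mono_set ?_
        rintro y ⟨hy, -, hy2⟩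
        rw [Set.mem_preimage, (extChartAt (𝓡 d) c).right_inv hy] at hy2
        exact Metric.ball_subset_closedBall hy2
    _ ≤ ∫⁻ y in K, ENNReal.ofReal C := by
        refine setLIntegral_mono' hKc.measurableSet fun y hy => ENNReal.ofReal_le_ofReal ?_
        exact (le_abs_self _).trans (hC y hy)
    _ < ⊤ := by
        rw [setLIntegral_const]
        exact ENNReal.mul_lt_top ENNReal.ofReal_lt_top hKc.measure_lt_top

instance isOpenPosMeasure_riemannianVolume : (riemannianVolume d X).IsOpenPosMeasure := by
  refine ⟨fun U hU ⟨c, hc⟩ h0 => ?_⟩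
  have hT := isOpen_extChartAt_target (I := 𝓡 d) c
  have h1 : localVolume (d := d) c U = 0 := by
    rw [← riemannianVolume_restrict, Measure.restrict_apply hU.measurableSet]
    exact measure_mono_null Set.inter_subset_left h0
  rw [localVolume_apply c hU.measurableSet] at h1
  have hO : IsOpen ((extChartAt (𝓡 d) c).target ∩ (extChartAt (𝓡 d) c).symm ⁻¹' U) :=
    (continuousOn_extChartAt_symm c).isOpen_inter_preimage hT hU
  rw [setLIntegral_eq_zero_iff' hO.measurableSet
    ((aemeasurable_volDensity c).mono_measure (Measure.restrict_mono Set.inter_subset_left le_rfl)),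
    ae_iff] at h1
  refine (hO.measure_pos volume ⟨extChartAt (𝓡 d) c c, mem_extChartAt_target c, ?_⟩).ne'
    (measure_mono_null (fun y hy => ?_) h1)
  · rw [Set.mem_preimage, extChartAt_to_inv]
    exact hc
  · simp only [Set.mem_ofPred_eq, Classical.not_imp]
    exact ⟨hy, (ENNReal.ofReal_pos.2 (volDensity_pos hy.1)).ne'⟩

/-- In dimension zero a connected Hausdorff manifold is a single point and so compact.
Non-compactness therefore forces positive dimension, where points are Lebesgue null. This is the
source of the fact that Poisson points almost surely have distinct positions. -/
lemma riemannianVolume_singleton [ConnectedSpace X] [NoncompactSpace X] [T2Space X] (x : X) :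
    riemannianVolume d X {x} = 0 := by
  have hd : Nontrivial (EuclideanSpace ℝ (Fin d)) := by
    by_contra hn
    rw [not_nontrivial_iff_subsingleton] at hn
    have hdisc : ∀ c : X, IsOpen ({c} : Set X) := fun c => by
      have : ({c} : Set X) = (extChartAt (𝓡 d) c).source := by
        refine Set.Subset.antisymm (by simp) fun y hy => ?_
        exact (extChartAt (𝓡 d) c).injOn hy (mem_extChartAt_source c) (Subsingleton.elim _ _)
      rw [this]
      exact isOpen_extChartAt_source c
    have huniv : ({x} : Set X) = Set.univ :=
      IsClopen.eq_univ ⟨isClosed_singleton, hdisc x⟩ (Set.singleton_nonempty x)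
    exact noncompact_univ X (huniv ▸ isCompact_singleton)
  have h1 : riemannianVolume d X {x} = localVolume (d := d) x {x} := by
    rw [← riemannianVolume_restrict, Measure.restrict_apply (measurableSet_singleton x),
      Set.inter_eq_left.2 (by simp)]
  rw [h1, localVolume_apply x (measurableSet_singleton x)]
  refine setLIntegral_measure_zero _ _ (measure_mono_null (t := {extChartAt (𝓡 d) x x}) ?_
    (measure_singleton _))
  rintro y ⟨hy, hy2⟩
  rw [Set.mem_preimage, Set.mem_singleton_iff] at hy2
  exact ((extChartAt (𝓡 d) x).right_inv hy).symm.trans (congrArg _ hy2)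

end Volume

/-- Integration by parts against the constant function one. -/
lemma integral_fderiv_eq_zero {E : Type*} [NormedAddCommGroup E] [NormedSpace ℝ E]
    [FiniteDimensional ℝ E] [MeasurableSpace E] [BorelSpace E] {μ : Measure E} [μ.IsAddHaarMeasure]
    {Q : E → ℝ} (hQ : ContDiff ℝ 1 Q) (hc : HasCompactSupport Q) (v : E) :
    ∫ y, fderiv ℝ Q y v ∂μ = 0 := by
  have h1 : Integrable (fun y => fderiv ℝ Q y v) μ :=
    ((hQ.continuous_fderiv (by simp)).clm_apply continuous_const).integrable_of_hasCompactSupport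
      (hc.fderiv_apply ℝ v)
  have h := integral_mul_fderiv_eq_neg_fderiv_mul_of_integrable (μ := μ) (f := fun _ : E => (1 : ℝ))
    (g := Q) (v := v) (by simp) (by simpa using h1)
    (by simpa using hQ.continuous.integrable_of_hasCompactSupport hc)
    (fun _ _ => differentiableAt_const _) (fun y _ => hQ.differentiable (by simp) y)
  simpa using h

/-! ### The divergence theorem for compactly supported fields. -/

section Divergence

variable {d : ℕ} {X : Type*} [TopologicalSpace X] [ChartedSpace (EuclideanSpace ℝ (Fin d)) X]
  [RiemannianBundle (fun x : X => TangentSpace (𝓡 d) x)]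

/-- The divergence, computed in the chart at `c`. -/
def divChart (v : ∀ x : X, TangentSpace (𝓡 d) x) (c x : X) : ℝ :=
  (volDensity c (extChartAt (𝓡 d) c x))⁻¹ *
    ∑ i : Fin d, fderiv ℝ (fun y => volDensity c y * coords v c y i)
      (extChartAt (𝓡 d) c x) (EuclideanSpace.single i 1)

variable [IsManifold (𝓡 d) ∞ X]
  [IsContMDiffRiemannianBundle (𝓡 d) ∞ (EuclideanSpace ℝ (Fin d))
      (fun x : X => TangentSpace (𝓡 d) x)]
  {v : ∀ x : X, TangentSpace (𝓡 d) x}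

lemma contDiffOn_volDensity_mul_coords
    (hv : ContMDiff (𝓡 d) (𝓡 d).tangent ∞ (fun x => (⟨x, v x⟩ : TangentBundle (𝓡 d) X)))
    (c : X) (i : Fin d) :
    ContDiffOn ℝ 1 (fun y => volDensity c y * coords v c y i) (extChartAt (𝓡 d) c).target :=
  (contDiffOn_volDensity c).mul ((contDiffOn_piLp 2).1
    (contDiffOn_coords (m := 1) (hv.of_le (by simp)) c) i)

lemma continuousOn_divChart
    (hv : ContMDiff (𝓡 d) (𝓡 d).tangent ∞ (fun x => (⟨x, v x⟩ : TangentBundle (𝓡 d) X)))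
    (c : X) : ContinuousOn (divChart v c) (extChartAt (𝓡 d) c).source := by
  have hm : Set.MapsTo (extChartAt (𝓡 d) c) (extChartAt (𝓡 d) c).source
    (extChartAt (𝓡 d) c).target := (extChartAt (𝓡 d) c).mapsTo
  have hφ := continuousOn_extChartAt (I := 𝓡 d) c
  refine (((contDiffOn_volDensity c).continuousOn.comp hφ hm).inv₀ fun x hx =>
    (volDensity_pos (hm hx)).ne').mul (continuousOn_finsetSum _ fun i _ => ?_)
  have h1 := (contDiffOn_volDensity_mul_coords hv c i).continuousOn_fderiv_of_isOpen
    (isOpen_extChartAt_target c) le_rfl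
  exact (h1.comp hφ hm).clm_apply continuousOn_const

omit [RiemannianBundle (fun x : X => TangentSpace (𝓡 d) x)] [IsManifold (𝓡 d) ∞ X]
  [IsContMDiffRiemannianBundle (𝓡 d) ∞ (EuclideanSpace ℝ (Fin d))
      (fun x : X => TangentSpace (𝓡 d) x)] in
variable (v) in
/-- The derivative of a function along a vector field. -/
def lieD (h : X → ℝ) (x : X) : ℝ := mfderiv (𝓡 d) 𝓘(ℝ, ℝ) h x (v x)

lemma continuous_lieD {h : X → ℝ} (hh : ContMDiff (𝓡 d) 𝓘(ℝ, ℝ) ∞ h)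
    (hv : ContMDiff (𝓡 d) (𝓡 d).tangent ∞ (fun x => (⟨x, v x⟩ : TangentBundle (𝓡 d) X))) :
    Continuous (lieD v h) :=
  (contMDiff_mfderiv_section hh hv).continuous

lemma lieD_congr {g h : X → ℝ} {x : X} (hgh : g =ᶠ[𝓝 x] h) : lieD v g x = lieD v h x :=
  congrArg (fun A : EuclideanSpace ℝ (Fin d) →L[ℝ] ℝ => A (v x)) hgh.mfderiv_eq

lemma lieD_const (r : ℝ) (x : X) : lieD v (fun _ => r) x = 0 :=
  congrArg (fun A : EuclideanSpace ℝ (Fin d) →L[ℝ] ℝ => A (v x)) mfderiv_const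

lemma lieD_eq_zero {h : X → ℝ} {x : X} (hx : v x = 0) : lieD v h x = 0 := by
  simp only [lieD]
  rw [hx]
  exact map_zero _

lemma lieD_add {g h : X → ℝ} (hg : ContMDiff (𝓡 d) 𝓘(ℝ, ℝ) ∞ g)
    (hh : ContMDiff (𝓡 d) 𝓘(ℝ, ℝ) ∞ h) (x : X) :
    lieD v (fun x => g x + h x) x = lieD v g x + lieD v h x :=
  congrArg (fun A : EuclideanSpace ℝ (Fin d) →L[ℝ] ℝ => A (v x))
    ((hg.mdifferentiableAt (x := x) (by simp)).hasMFDerivAt.add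
      (hh.mdifferentiableAt (x := x) (by simp)).hasMFDerivAt).mfderiv

lemma lieD_sum {ι : Type*} {s : Finset ι} {g : ι → X → ℝ}
    (hg : ∀ i, ContMDiff (𝓡 d) 𝓘(ℝ, ℝ) ∞ (g i)) (x : X) :
    lieD v (fun x => ∑ i ∈ s, g i x) x = ∑ i ∈ s, lieD v (g i) x := by
  classical
  induction s using Finset.induction_on with
  | empty => simp [lieD_const]
  | insert i s hi ih =>
    simp only [Finset.sum_insert hi]
    rw [lieD_add (hg i) (contMDiff_finsetSum fun i _ => hg i), ih]

/-- The set where v does not vanish is open. As it lies inside the compact set, a partition of unity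
that sums to one only on that set still sums to one near every point that matters. -/
lemma eventually_ne_zero
    (hv : ContMDiff (𝓡 d) (𝓡 d).tangent ∞ (fun x => (⟨x, v x⟩ : TangentBundle (𝓡 d) X)))
    {x : X} (hx : v x ≠ 0) : ∀ᶠ y in 𝓝 x, v y ≠ 0 := by
  have hT := (isOpen_extChartAt_target (I := 𝓡 d) x).mem_nhds (mem_extChartAt_target x)
  have h0 : coords v x (extChartAt (𝓡 d) x x) ≠ 0 := by
    intro h
    have h1 := mfderiv_chart_symm_coords v x (mem_extChartAt_target (I := 𝓡 d) x)
    rw [h] at h1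
    have h2 : v ((extChartAt (𝓡 d) x).symm (extChartAt (𝓡 d) x x)) = 0 :=
      h1.symm.trans (map_zero _)
    rw [extChartAt_to_inv] at h2
    exact hx h2
  have h1 := ((contDiffOn_coords (m := (⊤ : ℕ∞)) hv x).continuousOn.continuousAt hT).eventually_ne h0
  filter_upwards [(continuousAt_extChartAt (I := 𝓡 d) x).eventually h1,
    extChartAt_source_mem_nhds (I := 𝓡 d) x] with y hy hys h
  refine hy ?_
  simp only [coords]
  rw [(extChartAt (𝓡 d) x).left_inv hys, h]
  exact map_zero _

variable [MeasurableSpace X] [BorelSpace X]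

/-- Integration by parts in a chart. -/
lemma setIntegral_mfderiv_add_divChart [T2Space X] {h : X → ℝ}
    (hh : ContMDiff (𝓡 d) 𝓘(ℝ, ℝ) ∞ h)
    (hv : ContMDiff (𝓡 d) (𝓡 d).tangent ∞ (fun x => (⟨x, v x⟩ : TangentBundle (𝓡 d) X)))
    (c : X) {K : Set X} (hK : IsCompact K) (hKc : K ⊆ (extChartAt (𝓡 d) c).source)
    (hKv : ∀ x ∉ K, h x = 0 ∨ v x = 0) :
    IntegrableOn (fun x => lieD v h x + h x * divChart v c x)
      (extChartAt (𝓡 d) c).source (riemannianVolume d X) ∧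
    ∫ x in (extChartAt (𝓡 d) c).source, (lieD v h x +
      h x * divChart v c x) ∂(riemannianVolume d X) = 0 := by
  have hT := isOpen_extChartAt_target (I := 𝓡 d) c
  have hS := isOpen_extChartAt_source (I := 𝓡 d) c
  set φ := extChartAt (𝓡 d) c with hφ
  set F : X → ℝ := fun x => lieD v h x + h x * divChart v c x with hF
  set W : Fin d → EuclideanSpace ℝ (Fin d) → ℝ := fun i y => volDensity c y * coords v c y i with hW
  have hWc : ∀ i, ContDiffOn ℝ 1 (W i) φ.target := contDiffOn_volDensity_mul_coords hv c
  have hhc : ContDiffOn ℝ 1 (fun y => h (φ.symm y)) φ.target := by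
    rw [← contMDiffOn_iff_contDiffOn]
    exact (hh.of_le (by simp)).comp_contMDiffOn
      (contMDiffOn_extChartAt_symm (I := 𝓡 d) (n := 1) c)
  -- The components of √(det g) · h · v, extended by zero, are C¹ with compact support as soon as h
  -- or v vanishes off `K`. The alternative serves two uses: test functions supported in an overlap
  -- of charts, and a cut-off h with v supported in a compact set.
  set Q : Fin d → EuclideanSpace ℝ (Fin d) → ℝ :=
    fun i => φ.target.indicator fun y => h (φ.symm y) * W i y with hQ
  have hK' : IsCompact (φ '' K) := hK.image_of_continuousOn
    ((continuousOn_extChartAt (I := 𝓡 d) c).mono hKc)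
  have hQ0 : ∀ i, ∀ y ∉ φ '' K, Q i y = 0 := by
    intro i y hy
    by_cases hyT : y ∈ φ.target
    · have : φ.symm y ∉ K := fun hk => hy ⟨_, hk, φ.right_inv hyT⟩
      simp only [hQ, Set.indicator_of_mem hyT]
      rcases hKv _ this with h0 | h0
      · rw [h0, zero_mul]
      · have : coords v c y = 0 := by
          simp only [coords]
          rw [← hφ, h0]
          exact map_zero _
        simp [hW, this]
    · exact Set.indicator_of_notMem hyT _
  have hQeq : ∀ i, ∀ y ∈ φ.target, Q i =ᶠ[𝓝 y] fun y => h (φ.symm y) * W i y := fun i y hy =>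
    Filter.mem_of_superset (hT.mem_nhds hy) fun z hz => Set.indicator_of_mem hz _
  have hQz : ∀ i, ∀ y ∉ φ '' K, Q i =ᶠ[𝓝 y] fun _ => 0 := fun i y hy =>
    Filter.mem_of_superset (hK'.isClosed.isOpen_compl.mem_nhds hy) fun z hz => hQ0 i z hz
  have hQc : ∀ i, ContDiff ℝ 1 (Q i) := by
    refine fun i => contDiff_iff_contDiffAt.2 fun y => ?_
    by_cases hy : y ∈ φ.target
    · exact ((hhc.mul (hWc i)).contDiffAt (hT.mem_nhds hy)).congr_of_eventuallyEq (hQeq i y hy)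
    · refine contDiffAt_const.congr_of_eventuallyEq (hQz i y fun hyK => hy ?_)
      obtain ⟨x, hx, rfl⟩ := hyK
      exact φ.map_source (hKc hx)
  have hQs : ∀ i, HasCompactSupport (Q i) := fun i => HasCompactSupport.intro hK' (hQ0 i)
  have key : ∀ y ∈ φ.target, ∑ i, fderiv ℝ (Q i) y (EuclideanSpace.single i 1) =
      volDensity c y * F (φ.symm y) := by
    intro y hy
    have e1 : ∀ i, fderiv ℝ (Q i) y (EuclideanSpace.single i 1) =
        fderiv ℝ (fun y => h (φ.symm y)) y (EuclideanSpace.single i 1) * W i y +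
          h (φ.symm y) * fderiv ℝ (W i) y (EuclideanSpace.single i 1) := fun i => by
      rw [(hQeq i y hy).fderiv_eq, fderiv_fun_mul
        ((hhc.contDiffAt (hT.mem_nhds hy)).differentiableAt (by simp))
        (((hWc i).contDiffAt (hT.mem_nhds hy)).differentiableAt (by simp))]
      simp only [add_apply, smul_apply, smul_eq_mul]
      ring
    have hsum : coords v c y = ∑ i, coords v c y i • EuclideanSpace.single i (1 : ℝ) := by
      have := (EuclideanSpace.basisFun (Fin d) ℝ).sum_repr (coords v c y)
      simpa using this.symm
    have e2 : ∑ i, fderiv ℝ (fun y => h (φ.symm y)) y (EuclideanSpace.single i 1) * W i y =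
        volDensity c y * fderiv ℝ (fun y => h (φ.symm y)) y (coords v c y) := by
      conv_rhs => rw [hsum]
      rw [map_sum, Finset.mul_sum]
      refine Finset.sum_congr rfl fun i _ => ?_
      rw [map_smul, smul_eq_mul]
      simp only [hW]
      ring
    have e3 : fderiv ℝ (fun y => h (φ.symm y)) y (coords v c y) =
        lieD v h (φ.symm y) := by
      have h1 := ((hh.mdifferentiableAt (x := φ.symm y) (by simp)).hasMFDerivAt.comp y
        (mdifferentiableAt_chart_symm c hy).hasMFDerivAt)
      refine (congrArg (fun A : EuclideanSpace ℝ (Fin d) →L[ℝ] ℝ => A (coords v c y))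
        (mfderiv_eq_fderiv.symm.trans h1.mfderiv)).trans ?_
      exact congrArg (mfderiv (𝓡 d) 𝓘(ℝ, ℝ) h (φ.symm y)) (mfderiv_chart_symm_coords v c hy)
    have e4 : volDensity c y * divChart v c (φ.symm y) =
        ∑ i, fderiv ℝ (W i) y (EuclideanSpace.single i 1) := by
      simp only [divChart]
      rw [← hφ, φ.right_inv hy, ← mul_assoc, mul_inv_cancel₀ (volDensity_pos hy).ne', one_mul]
    simp only [e1]
    rw [Finset.sum_add_distrib, e2, e3, ← Finset.mul_sum, ← e4]
    simp only [hF]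
    ring
  have hFc : ContinuousOn F φ.source :=
    (continuous_lieD hh hv).continuousOn.add
      (hh.continuous.continuousOn.mul (continuousOn_divChart hv c))
  have hF0 : ∀ x ∈ φ.source, x ∉ K → F x = 0 := by
    intro x hx hxK
    have h1 := key (φ x) (φ.map_source hx)
    rw [φ.left_inv hx, Finset.sum_eq_zero fun i _ => ?_] at h1
    · exact (mul_eq_zero.1 h1.symm).resolve_left (volDensity_pos (φ.map_source hx)).ne'
    · rw [(hQz i (φ x) ?_).fderiv_eq]
      · simp
      · rintro ⟨x', hx', hxx⟩
        rw [φ.injOn (hKc hx') hx hxx] at hx'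
        exact hxK hx'
  have hint : IntegrableOn F φ.source (riemannianVolume d X) := by
    have h1 : IntegrableOn F K (riemannianVolume d X) :=
      (hFc.mono hKc).integrableOn_compact hK
    exact h1.of_forall_sdiff_eq_zero hS.measurableSet fun x hx => hF0 x hx.1 hx.2
  refine ⟨hint, ?_⟩
  have hm := aemeasurable_chart_symm (d := d) c
  have hm2 := aemeasurable_volDensity (d := d) c
  have hsm : AEStronglyMeasurable F (localVolume (d := d) c) := by
    rw [← riemannianVolume_restrict]
    exact hint.aestronglyMeasurable
  rw [riemannianVolume_restrict, localVolume, integral_map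
    (hm.mono_ac (withDensity_absolutelyContinuous _ _)) hsm]
  rw [integral_withDensity_eq_integral_toReal_smul₀ hm2 (by simp)]
  calc ∫ y in φ.target, (ENNReal.ofReal (volDensity c y)).toReal • F (φ.symm y)
      = ∫ y in φ.target, ∑ i, fderiv ℝ (Q i) y (EuclideanSpace.single i 1) := by
        refine setIntegral_congr_fun hT.measurableSet fun y hy => ?_
        simp only [key y hy]
        rw [ENNReal.toReal_ofReal (volDensity_pos hy).le, smul_eq_mul]
    _ = ∫ y, ∑ i, fderiv ℝ (Q i) y (EuclideanSpace.single i 1) := by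
        refine setIntegral_eq_integral_of_forall_compl_eq_zero fun y hy => ?_
        refine Finset.sum_eq_zero fun i _ => ?_
        rw [(hQz i y ?_).fderiv_eq]
        · simp
        · rintro ⟨x, hx, rfl⟩
          exact hy (φ.map_source (hKc hx))
    _ = ∑ i, ∫ y, fderiv ℝ (Q i) y (EuclideanSpace.single i 1) := by
        refine integral_finsetSum _ fun i _ => ?_
        exact (((hQc i).continuous_fderiv (by simp)).clm_apply
          continuous_const).integrable_of_hasCompactSupport ((hQs i).fderiv_apply ℝ _)
    _ = 0 := Finset.sum_eq_zero fun i _ => integral_fderiv_eq_zero (hQc i) (hQs i) _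

variable [T2Space X] [SecondCountableTopology X]

/-- The divergence does not depend on the chart. -/
lemma divChart_eq
    (hv : ContMDiff (𝓡 d) (𝓡 d).tangent ∞ (fun x => (⟨x, v x⟩ : TangentBundle (𝓡 d) X)))
    {c c' x : X} (hx : x ∈ (extChartAt (𝓡 d) c).source) (hx' : x ∈ (extChartAt (𝓡 d) c').source) :
    divChart v c x = divChart v c' x := by
  have hS := isOpen_extChartAt_source (I := 𝓡 d) c
  have hS' := isOpen_extChartAt_source (I := 𝓡 d) c'
  have : LocallyCompactSpace X :=
    ChartedSpace.locallyCompactSpace (EuclideanSpace ℝ (Fin d)) X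
  set U := (extChartAt (𝓡 d) c).source ∩ (extChartAt (𝓡 d) c').source with hU
  have hUo : IsOpen U := hS.inter hS'
  have hc := (continuousOn_divChart hv c).mono (Set.inter_subset_left (t := (extChartAt (𝓡 d) c').source))
  have hc' := (continuousOn_divChart hv c').mono (Set.inter_subset_right (s := (extChartAt (𝓡 d) c).source))
  -- No computation in coordinates: both expressions satisfy the same weak identity against test
  -- functions supported in the overlap, so they agree almost everywhere there, and by continuity
  -- everywhere.
  have h0 := hUo.ae_eq_zero_of_integral_contMDiff_smul_eq_zero (𝓡 d)
    (μ := riemannianVolume d X) (f := fun x => divChart v c x - divChart v c' x)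
    ((hc.sub hc').locallyIntegrableOn hUo.measurableSet) (by
      intro g hg hgc hgU
      have h1 := setIntegral_mfderiv_add_divChart hg hv c hgc (hgU.trans Set.inter_subset_left)
        (fun x hx => Or.inl (image_eq_zero_of_notMem_tsupport hx))
      have h2 := setIntegral_mfderiv_add_divChart hg hv c' hgc (hgU.trans Set.inter_subset_right)
        (fun x hx => Or.inl (image_eq_zero_of_notMem_tsupport hx))
      have hz : ∀ (b : X), ∀ x ∉ U, lieD v g x +
          g x * divChart v b x = 0 := fun b x hx => by
        have hx2 : x ∉ tsupport g := fun h => hx (hgU h)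
        have e1 : g =ᶠ[𝓝 x] fun _ => 0 := notMem_tsupport_iff_eventuallyEq.1 hx2
        rw [image_eq_zero_of_notMem_tsupport hx2, zero_mul, add_zero, lieD_congr e1, lieD_const]
      have i1 : IntegrableOn (fun x => lieD v g x +
          g x * divChart v c x) U (riemannianVolume d X) := h1.1.mono_set Set.inter_subset_left
      have i2 : IntegrableOn (fun x => lieD v g x +
          g x * divChart v c' x) U (riemannianVolume d X) := h2.1.mono_set Set.inter_subset_right
      have e1 : ∫ x in U, (lieD v g x +
          g x * divChart v c x) ∂(riemannianVolume d X) = 0 := by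
        rw [setIntegral_eq_integral_of_forall_compl_eq_zero (hz c)]
        rw [setIntegral_eq_integral_of_forall_compl_eq_zero
          fun x hx => hz c x fun h => hx h.1] at h1
        exact h1.2
      have e2 : ∫ x in U, (lieD v g x +
          g x * divChart v c' x) ∂(riemannianVolume d X) = 0 := by
        rw [setIntegral_eq_integral_of_forall_compl_eq_zero (hz c')]
        rw [setIntegral_eq_integral_of_forall_compl_eq_zero
          fun x hx => hz c' x fun h => hx h.2] at h2
        exact h2.2
      have e3 := integral_sub i1 i2
      rw [e1, e2, sub_zero] at e3
      rw [← setIntegral_eq_integral_of_forall_compl_eq_zero (s := U), ← e3]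
      · refine integral_congr_ae (Eventually.of_forall fun x => ?_)
        simp only [smul_eq_mul]
        ring
      · intro x hx
        rw [image_eq_zero_of_notMem_tsupport fun h => hx (hgU h), zero_smul])
  have h1 : divChart v c =ᵐ[(riemannianVolume d X).restrict U] divChart v c' := by
    rw [Filter.EventuallyEq, ae_restrict_iff' hUo.measurableSet]
    filter_upwards [h0] with x hx hxU
    exact sub_eq_zero.1 (hx hxU)
  exact Measure.eqOn_open_of_ae_eq h1 hUo hc hc' ⟨hx, hx'⟩

lemma divX_eq_divChart
    (hv : ContMDiff (𝓡 d) (𝓡 d).tangent ∞ (fun x => (⟨x, v x⟩ : TangentBundle (𝓡 d) X)))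
    {c x : X} (hx : x ∈ (extChartAt (𝓡 d) c).source) : divX v x = divChart v c x :=
  divChart_eq hv (c := x) (mem_extChartAt_source x) hx

lemma continuous_divX
    (hv : ContMDiff (𝓡 d) (𝓡 d).tangent ∞ (fun x => (⟨x, v x⟩ : TangentBundle (𝓡 d) X))) :
    Continuous (divX v) := by
  refine continuous_iff_continuousAt.2 fun c => ?_
  have hS := extChartAt_source_mem_nhds (I := 𝓡 d) c
  exact ((continuousOn_divChart hv c).continuousAt hS).congr
    (Filter.mem_of_superset hS fun x hx => (divX_eq_divChart hv hx).symm)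

omit [IsManifold (𝓡 d) ∞ X] [IsContMDiffRiemannianBundle (𝓡 d) ∞ (EuclideanSpace ℝ (Fin d))
      (fun x : X => TangentSpace (𝓡 d) x)] [MeasurableSpace X] [BorelSpace X]
  [SecondCountableTopology X] in
lemma divX_eq_zero {K : Set X} (hK : IsCompact K) (hKv : ∀ x ∉ K, v x = 0) {x : X} (hx : x ∉ K) :
    divX v x = 0 := by
  simp only [divX]
  rw [Finset.sum_eq_zero fun i _ => ?_, mul_zero]
  have h1 : (fun y => volDensity x y * coords v x y i) =ᶠ[𝓝 (extChartAt (𝓡 d) x x)] fun _ => 0 := by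
    have h2 : (extChartAt (𝓡 d) x).symm ⁻¹' Kᶜ ∈ 𝓝 (extChartAt (𝓡 d) x x) :=
      (continuousAt_extChartAt_symm x).preimage_mem_nhds
        (by rw [extChartAt_to_inv]; exact hK.isClosed.isOpen_compl.mem_nhds hx)
    filter_upwards [h2] with y hy
    have : coords v x y = 0 := by
      simp only [coords]
      rw [hKv _ hy]
      exact map_zero _
    simp [this]
  rw [h1.fderiv_eq]
  simp

/-- The divergence theorem for vector fields with compact support. -/
lemma integral_mfderiv_add_divX {h : X → ℝ} (hh : ContMDiff (𝓡 d) 𝓘(ℝ, ℝ) ∞ h)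
    (hv : ContMDiff (𝓡 d) (𝓡 d).tangent ∞ (fun x => (⟨x, v x⟩ : TangentBundle (𝓡 d) X)))
    {K : Set X} (hK : IsCompact K) (hKv : ∀ x ∉ K, v x = 0) :
    ∫ x, (lieD v h x + h x * divX v x) ∂(riemannianVolume d X) = 0 := by
  have : LocallyCompactSpace X :=
    ChartedSpace.locallyCompactSpace (EuclideanSpace ℝ (Fin d)) X
  obtain ⟨t, ht⟩ := hK.elim_finite_subcover (fun c : X => (extChartAt (𝓡 d) c).source)
    (fun c => isOpen_extChartAt_source c)
    (fun x _ => Set.mem_iUnion.2 ⟨x, mem_extChartAt_source x⟩)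
  obtain ⟨η, hη⟩ := SmoothPartitionOfUnity.exists_isSubordinate (𝓡 d) hK.isClosed
    (fun c : t => (extChartAt (𝓡 d) (c : X)).source) (fun c => isOpen_extChartAt_source _)
    (fun x hx => by
      obtain ⟨c, hc, hxc⟩ := Set.mem_iUnion₂.1 (ht hx)
      exact Set.mem_iUnion.2 ⟨⟨c, hc⟩, hxc⟩)
  have hηs : ∀ c, ContMDiff (𝓡 d) 𝓘(ℝ, ℝ) ∞ (η c) := fun c => (η c).contMDiff
  have h1 : ∀ c : t, Integrable (fun x => lieD v (fun x => η c x * h x) x +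
      (η c x * h x) * divX v x) (riemannianVolume d X) ∧
      ∫ x, (lieD v (fun x => η c x * h x) x +
      (η c x * h x) * divX v x) ∂(riemannianVolume d X) = 0 := fun c => by
    have hS := isOpen_extChartAt_source (I := 𝓡 d) (c : X)
    have h2 := setIntegral_mfderiv_add_divChart (h := fun x => η c x * h x) ((hηs c).mul hh) hv c
      (hK.inter_right (isClosed_tsupport (η c))) (Set.inter_subset_right.trans (hη c)) (by
        intro x hx
        by_cases hxK : x ∈ K
        · left
          rw [image_eq_zero_of_notMem_tsupport fun h => hx ⟨hxK, h⟩, zero_mul]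
        · exact Or.inr (hKv x hxK))
    have hz : ∀ x ∉ (extChartAt (𝓡 d) (c : X)).source,
        lieD v (fun x => η c x * h x) x +
        (η c x * h x) * divX v x = 0 := fun x hx => by
      have hx2 : x ∉ tsupport (η c) := fun h => hx (hη c h)
      have e1 : (fun x => η c x * h x) =ᶠ[𝓝 x] fun _ => 0 := by
        filter_upwards [notMem_tsupport_iff_eventuallyEq.1 hx2] with y hy
        rw [hy]
        simp
      rw [image_eq_zero_of_notMem_tsupport hx2, zero_mul, zero_mul, add_zero, lieD_congr e1, lieD_const]
    have e : Set.EqOn (fun x => lieD v (fun x => η c x * h x) x +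
        (η c x * h x) * divChart v c x)
        (fun x => lieD v (fun x => η c x * h x) x +
        (η c x * h x) * divX v x) (extChartAt (𝓡 d) (c : X)).source := fun x hx => by
      simp only [divX_eq_divChart hv hx]
    rw [integrableOn_congr_fun e hS.measurableSet, setIntegral_congr_fun hS.measurableSet e,
      setIntegral_eq_integral_of_forall_compl_eq_zero hz] at h2
    exact ⟨h2.1.integrable_of_forall_notMem_eq_zero hz, h2.2⟩
  rw [← Finset.sum_eq_zero (s := Finset.univ) fun c _ => (h1 c).2, ← integral_finsetSum _
    fun c _ => (h1 c).1]
  refine integral_congr_ae (Eventually.of_forall fun x => ?_)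
  simp only []
  by_cases hxK : x ∈ K
  · have h2 : ∑ c, η c x = 1 := by
      rw [← finsum_eq_sum_of_fintype]
      exact η.sum_eq_one hxK
    rw [Finset.sum_add_distrib, ← Finset.sum_mul, ← Finset.sum_mul, h2, one_mul,
      ← lieD_sum (g := fun c x => η c x * h x) fun c => (hηs c).mul hh]
    congr 1
    -- The partition sums to one on `K` only, so the sum of the ηh need not equal h near a boundary
    -- point of `K`. If v vanishes at x, both derivatives are zero; otherwise a neighbourhood of x
    -- lies in `K`.
    by_cases hvx : v x = 0
    · rw [lieD_eq_zero hvx, lieD_eq_zero hvx]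
    · have hvo := eventually_ne_zero hv hvx
      refine lieD_congr ?_
      filter_upwards [hvo] with y hy
      have hyK : y ∈ K := by_contra fun h => hy (hKv y h)
      rw [← Finset.sum_mul, ← finsum_eq_sum_of_fintype, η.sum_eq_one hyK, one_mul]
  · simp only [divX_eq_zero hK hKv hxK, lieD_eq_zero (hKv x hxK), mul_zero, add_zero,
      Finset.sum_const_zero]

end Divergence

/-! ### Convergence of products in L². -/

section L2

variable {Ω : Type*} [MeasurableSpace Ω] {μ : Measure Ω}

lemma eLpNorm_two_eq_lintegral_sq (g : Ω → ℝ) :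
    eLpNorm g 2 μ = (∫⁻ z, ENNReal.ofReal (g z ^ 2) ∂μ) ^ (1 / 2 : ℝ) := by
  rw [eLpNorm_eq_lintegral_rpow_enorm_toReal (by simp) (by simp)]
  simp only [ENNReal.toReal_ofNat]
  congr 1
  refine lintegral_congr fun s => ?_
  rw [← ofReal_norm, ENNReal.ofReal_rpow_of_nonneg (norm_nonneg _) (by norm_num)]
  congr 1
  simp

lemma memLp_two_of_lintegral_sq {g : Ω → ℝ} (hg : AEStronglyMeasurable g μ)
    (h : ∫⁻ z, ENNReal.ofReal (g z ^ 2) ∂μ < ⊤) : MemLp g 2 μ := by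
  refine ⟨hg, ?_⟩
  rw [eLpNorm_two_eq_lintegral_sq]
  exact ENNReal.rpow_lt_top_of_nonneg (by norm_num) h.ne

lemma tendsto_eLpNorm_two {g : ℕ → Ω → ℝ}
    (h : Tendsto (fun n => ∫⁻ z, ENNReal.ofReal (g n z ^ 2) ∂μ) atTop (𝓝 0)) :
    Tendsto (fun n => eLpNorm (g n) 2 μ) atTop (𝓝 0) := by
  have h4 := (ENNReal.continuous_rpow_const (y := (1 / 2 : ℝ))).tendsto 0 |>.comp h
  rw [ENNReal.zero_rpow_of_pos (by norm_num)] at h4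
  exact h4.congr fun n => (eLpNorm_two_eq_lintegral_sq _).symm

lemma tendsto_integral_mul_of_eLpNorm_two {α β : ℕ → Ω → ℝ} {α' β' : Ω → ℝ}
    (hα : ∀ n, MemLp (α n) 2 μ) (hβ : ∀ n, MemLp (β n) 2 μ) (hα' : MemLp α' 2 μ)
    (hβ' : MemLp β' 2 μ) (h : Tendsto (fun n => eLpNorm (α n - α') 2 μ) atTop (𝓝 0))
    (h' : Tendsto (fun n => eLpNorm (β n - β') 2 μ) atTop (𝓝 0)) :
    Tendsto (fun n => ∫ z, α n z * β n z ∂μ) atTop (𝓝 (∫ z, α' z * β' z ∂μ)) := by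
  have h1 : Tendsto (fun n => (hα n).toLp (α n)) atTop (𝓝 (hα'.toLp α')) :=
    (Lp.tendsto_Lp_iff_tendsto_eLpNorm'' _ hα _ hα').2 h
  have h2 : Tendsto (fun n => (hβ n).toLp (β n)) atTop (𝓝 (hβ'.toLp β')) :=
    (Lp.tendsto_Lp_iff_tendsto_eLpNorm'' _ hβ _ hβ').2 h'
  have key : ∀ {f g : Ω → ℝ} (hf : MemLp f 2 μ) (hg : MemLp g 2 μ),
      inner ℝ (hf.toLp f) (hg.toLp g) = ∫ z, f z * g z ∂μ := fun hf hg => by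
    rw [L2.inner_def]
    refine integral_congr_ae ?_
    filter_upwards [hf.coeFn_toLp, hg.coeFn_toLp] with z h1 h2
    rw [h1, h2, real_inner_eq_re_inner, RCLike.inner_apply]
    simp [mul_comm]
  have h3 := Filter.Tendsto.inner (𝕜 := ℝ) h1 h2
  simp only [key] at h3
  exact h3

lemma tendsto_eLpNorm_two_mul {α : ℕ → Ω → ℝ} {α' c : Ω → ℝ} {C : ℝ} (hc : ∀ z, |c z| ≤ C)
    (h : Tendsto (fun n => eLpNorm (α n - α') 2 μ) atTop (𝓝 0)) :
    Tendsto (fun n => eLpNorm ((fun z => c z * α n z) - fun z => c z * α' z) 2 μ) atTop (𝓝 0) := by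
  have h1 := ENNReal.Tendsto.const_mul (a := ENNReal.ofReal C) h (Or.inr (by simp))
  rw [mul_zero] at h1
  refine tendsto_of_tendsto_of_tendsto_of_le_of_le tendsto_const_nhds h1 (fun _ => zero_le)
    fun n => ?_
  refine eLpNorm_le_mul_eLpNorm_of_ae_le_mul (Eventually.of_forall fun z => ?_) 2
  simp only [Pi.sub_apply, ← mul_sub, norm_mul]
  exact mul_le_mul_of_nonneg_right (hc z) (norm_nonneg _)

lemma memLp_two_bdd_mul {α c : Ω → ℝ} {C : ℝ} (hα : MemLp α 2 μ) (hc : ∀ z, |c z| ≤ C)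
    (hcm : AEStronglyMeasurable c μ) : MemLp (fun z => c z * α z) 2 μ :=
  MemLp.of_le_mul (c := C) hα (hcm.mul hα.1) (Eventually.of_forall fun z => by
    rw [norm_mul]
    exact mul_le_mul_of_nonneg_right (hc z) (norm_nonneg _))

lemma integral_add_three {f g h : Ω → ℝ} (hf : Integrable f μ) (hg : Integrable g μ)
    (hh : Integrable h μ) : Integrable (fun z => f z + g z + h z) μ ∧
      ∫ z, (f z + g z + h z) ∂μ = ∫ z, f z ∂μ + ∫ z, g z ∂μ + ∫ z, h z ∂μ := by
  refine ⟨(hf.add hg).add hh, ?_⟩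
  rw [← integral_add hf hg]
  exact integral_add (hf.add hg) hh

end L2

/-! ### From Sobolev approximation to L² convergence of directional derivatives. -/

section Sobolev

variable {d e k : ℕ} {X M G : Type*}
  [TopologicalSpace X] [T2Space X] [SecondCountableTopology X]
  [ChartedSpace (EuclideanSpace ℝ (Fin d)) X] [IsManifold (𝓡 d) ∞ X]
  [RiemannianBundle (fun x : X => TangentSpace (𝓡 d) x)]
  [IsContMDiffRiemannianBundle (𝓡 d) ∞ (EuclideanSpace ℝ (Fin d))
    (fun x : X => TangentSpace (𝓡 d) x)]
  [MeasurableSpace X] [BorelSpace X]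
  [TopologicalSpace M] [T2Space M] [SecondCountableTopology M]
  [ChartedSpace (EuclideanSpace ℝ (Fin e)) M] [IsManifold (𝓡 e) ∞ M]
  [MeasurableSpace M] [BorelSpace M]
  [TopologicalSpace G] [T2Space G]
  [ChartedSpace (EuclideanSpace ℝ (Fin k)) G] [Group G] [LieGroup (𝓡 k) ∞ G] [MulAction G M]

/-- The components of a map with values in the Lie algebra. -/
lemma continuous_repr_u (b : Module.Basis (Fin k) ℝ (GroupLieAlgebra (𝓡 k) G))
    (a : CurrentAlgebra d k X G) (i : Fin k) : Continuous fun x => b.repr (a.u x) i := by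
  have h : Continuous fun x => (a.u x : EuclideanSpace ℝ (Fin k)) := a.smooth_u.continuous
  obtain ⟨L, hL⟩ : ∃ L : EuclideanSpace ℝ (Fin k) →ₗ[ℝ] ℝ, ∀ u, L u = b.repr u i :=
    ⟨b.coord i, fun _ => rfl⟩
  exact (L.continuous_of_finiteDimensional.comp h).congr fun x => hL _

/-- Cauchy–Schwarz in both components, with the lengths of v and u bounded on their compact support.
It turns convergence in the Sobolev norm into L² convergence of the derivative along one fixed
element. -/
lemma exists_bound_apply (b : Module.Basis (Fin k) ℝ (GroupLieAlgebra (𝓡 k) G))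
    (a : CurrentAlgebra d k X G) : ∃ C : ℝ, 0 ≤ C ∧ ∀ (x : X) (A : TangentSpace (𝓡 d) x →L[ℝ] ℝ)
      (T : GroupLieAlgebra (𝓡 k) G →L[ℝ] ℝ),
      (A (a.v x) + T (a.u x)) ^ 2 ≤ C * (‖A‖ ^ 2 + normSqG b T) := by
  obtain ⟨K, hK, hKa⟩ := a.compact_support
  have hv : Continuous fun x => (inner ℝ (a.v x) (a.v x) : ℝ) :=
    (ContMDiff.inner_bundle (n := ∞) (IM := 𝓡 d) a.smooth_v a.smooth_v).continuous
  have hu : Continuous fun x => ∑ i, (b.repr (a.u x) i) ^ 2 :=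
    continuous_finsetSum _ fun i _ => (continuous_repr_u b a i).pow 2
  obtain ⟨C₁, hC₁⟩ := hK.exists_bound_of_continuousOn hv.continuousOn
  obtain ⟨C₂, hC₂⟩ := hK.exists_bound_of_continuousOn hu.continuousOn
  refine ⟨2 * (|C₁| + |C₂|), by positivity, fun x A T => ?_⟩
  by_cases hx : x ∈ K
  · have h1 : (A (a.v x)) ^ 2 ≤ ‖A‖ ^ 2 * |C₁| := by
      have e1 : ‖a.v x‖ ^ 2 ≤ |C₁| := by
        rw [← real_inner_self_eq_norm_sq]
        exact (le_abs_self _).trans ((hC₁ x hx).trans (le_abs_self _))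
      calc (A (a.v x)) ^ 2 = ‖A (a.v x)‖ ^ 2 := by rw [Real.norm_eq_abs, sq_abs]
        _ ≤ (‖A‖ * ‖a.v x‖) ^ 2 := by gcongr; exact A.le_opNorm _
        _ = ‖A‖ ^ 2 * ‖a.v x‖ ^ 2 := by ring
        _ ≤ _ := by gcongr
    have h2 : (T (a.u x)) ^ 2 ≤ |C₂| * normSqG b T := by
      have e1 : ∑ i, (b.repr (a.u x) i) ^ 2 ≤ |C₂| :=
        (le_abs_self _).trans ((hC₂ x hx).trans (le_abs_self _))
      have e2 : T (a.u x) = ∑ i, b.repr (a.u x) i * T (b i) := by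
        refine (congrArg T (b.sum_repr (a.u x)).symm).trans ?_
        rw [map_sum]
        exact Finset.sum_congr rfl fun i _ => map_smul T _ _
      rw [e2, normSqG]
      refine (Finset.sum_mul_sq_le_sq_mul_sq _ _ _).trans ?_
      gcongr
    have h3 : 0 ≤ normSqG b T := Finset.sum_nonneg fun i _ => sq_nonneg _
    nlinarith [sq_nonneg (A (a.v x) - T (a.u x)), abs_nonneg C₁, abs_nonneg C₂,
      mul_nonneg (abs_nonneg C₁) h3, mul_nonneg (abs_nonneg C₂) (sq_nonneg ‖A‖)]
  · have h3 : 0 ≤ normSqG b T := Finset.sum_nonneg fun i _ => sq_nonneg _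
    have e1 : A (a.v x) = 0 := by rw [(hKa x hx).1]; exact map_zero _
    have e2 : T (a.u x) = 0 := by rw [(hKa x hx).2]; exact map_zero _
    rw [e1, e2, add_zero, zero_pow two_ne_zero]
    positivity

lemma IsTest.measurable_gradXM
    (hsmooth : ContMDiff ((𝓡 k).prod (𝓡 e)) (𝓡 e) ∞ (fun y : G × M => y.1 • y.2))
    (a : CurrentAlgebra d k X G) {φ : X × M → ℝ}
    (hφ : ContMDiff ((𝓡 d).prod (𝓡 e)) 𝓘(ℝ, ℝ) ∞ φ) : Measurable (gradXM a φ) :=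
  (contMDiff_gradXM hsmooth a hφ).continuous.measurable

/-- A function in the Sobolev space is approximated in `L²` together with its derivative along
an element of the Lie algebra. -/
lemma HasSobolevGradient.exists_approx {lam : Measure M}
    (hsmooth : ContMDiff ((𝓡 k).prod (𝓡 e)) (𝓡 e) ∞ (fun y : G × M => y.1 • y.2))
    {b : Module.Basis (Fin k) ℝ (GroupLieAlgebra (𝓡 k) G)} {h : X × M → ℝ}
    {E : Covectors d k X M G} (hE : HasSobolevGradient e lam b h E) (a : CurrentAlgebra d k X G) :
    ∃ φ : ℕ → X × M → ℝ, (∀ n, IsTest d e k G (φ n)) ∧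
      (∀ n, MemLp (φ n) 2 ((riemannianVolume d X).prod lam)) ∧
      (∀ n, MemLp (gradXM a (φ n)) 2 ((riemannianVolume d X).prod lam)) ∧
      MemLp h 2 ((riemannianVolume d X).prod lam) ∧
      MemLp (E.apply a) 2 ((riemannianVolume d X).prod lam) ∧
      Tendsto (fun n => ∫⁻ z, (ENNReal.ofReal ((φ n z - h z) ^ 2) +
        ENNReal.ofReal ((gradXM a (φ n) z - E.apply a z) ^ 2)) ∂((riemannianVolume d X).prod lam))
        atTop (𝓝 0) := by
  obtain ⟨φ, hφ, hfin, hlim⟩ := hE.approx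
  obtain ⟨C, hC, hCb⟩ := exists_bound_apply b a
  have key : ∀ (ψ f : X × M → ℝ) (D : Covectors d k X M G),
      ∫⁻ z, (ENNReal.ofReal ((ψ z - f z) ^ 2) +
        ENNReal.ofReal ((gradXM a ψ z - D.apply a z) ^ 2)) ∂((riemannianVolume d X).prod lam) ≤
      ENNReal.ofReal (C + 1) * sobolevDistSq lam b ψ f D := fun ψ f D => by
    rw [sobolevDistSq, ← lintegral_const_mul' _ _ ENNReal.ofReal_ne_top]
    refine lintegral_mono fun z => ?_
    simp only []
    rw [← ENNReal.ofReal_mul (by positivity), ← ENNReal.ofReal_add (sq_nonneg _) (sq_nonneg _)]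
    refine ENNReal.ofReal_le_ofReal ?_
    have h1 := hCb z.1 (dX ψ z - D.onX z) (dG k G ψ z - D.onG z)
    have e1 : (dX ψ z - D.onX z : TangentSpace (𝓡 d) z.1 →L[ℝ] ℝ) (a.v z.1) + (dG k G ψ z - D.onG z) (a.u z.1) =
        gradXM a ψ z - D.apply a z := by
      simp only [gradXM, Covectors.apply]
      rw [sub_apply, sub_apply]
      ring
    rw [e1] at h1
    have h3 : 0 ≤ normSqG b (dG k G ψ z - D.onG z) := Finset.sum_nonneg fun i _ => sq_nonneg _
    nlinarith [sq_nonneg (ψ z - f z), sq_nonneg ‖dX ψ z - D.onX z‖,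
      mul_nonneg hC (sq_nonneg (ψ z - f z))]
  have hψm : ∀ n, AEStronglyMeasurable (φ n) ((riemannianVolume d X).prod lam) := fun n =>
    (hφ n).smooth.continuous.measurable.aestronglyMeasurable
  have hgm : ∀ n, AEStronglyMeasurable (gradXM a (φ n)) ((riemannianVolume d X).prod lam) :=
    fun n => (IsTest.measurable_gradXM hsmooth a (hφ n).smooth).aestronglyMeasurable
  have h0 : ∀ n, ∫⁻ z, (ENNReal.ofReal (φ n z ^ 2) +
      ENNReal.ofReal (gradXM a (φ n) z ^ 2)) ∂((riemannianVolume d X).prod lam) < ⊤ := fun n => by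
    have h1 := (key (φ n) 0 ⟨fun _ => 0, fun _ => 0⟩).trans_lt
      (ENNReal.mul_lt_top ENNReal.ofReal_lt_top (hfin n))
    have e1 : ∀ z, (⟨fun _ => 0, fun _ => 0⟩ : Covectors d k X M G).apply a z = 0 := fun z => by
      simp only [Covectors.apply]
      rw [zero_apply, zero_apply, add_zero]
    simpa only [e1, Pi.zero_apply, sub_zero] using h1
  have hlim' : Tendsto (fun n => ∫⁻ z, (ENNReal.ofReal ((φ n z - h z) ^ 2) +
        ENNReal.ofReal ((gradXM a (φ n) z - E.apply a z) ^ 2)) ∂((riemannianVolume d X).prod lam))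
        atTop (𝓝 0) := by
    have h1 := ENNReal.Tendsto.const_mul (a := ENNReal.ofReal (C + 1)) hlim (Or.inr (by simp))
    rw [mul_zero] at h1
    exact tendsto_of_tendsto_of_tendsto_of_le_of_le tendsto_const_nhds h1 (fun _ => zero_le)
      fun n => key _ _ _
  have hφ2 : ∀ n, MemLp (φ n) 2 ((riemannianVolume d X).prod lam) := fun n =>
    memLp_two_of_lintegral_sq (hψm n) ((lintegral_mono fun z => le_self_add).trans_lt (h0 n))
  have hg2 : ∀ n, MemLp (gradXM a (φ n)) 2 ((riemannianVolume d X).prod lam) := fun n =>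
    memLp_two_of_lintegral_sq (hgm n) ((lintegral_mono fun z => le_add_self).trans_lt (h0 n))
  obtain ⟨n, hn⟩ := (hlim'.eventually_lt_const ENNReal.zero_lt_top).exists
  have hh : MemLp h 2 ((riemannianVolume d X).prod lam) := by
    have h1 : MemLp (fun z => φ n z - h z) 2 ((riemannianVolume d X).prod lam) :=
      memLp_two_of_lintegral_sq ((hψm n).sub hE.measurable_fun.aestronglyMeasurable)
        ((lintegral_mono fun z => le_self_add).trans_lt hn)
    exact ((hφ2 n).sub h1).congr_norm hE.measurable_fun.aestronglyMeasurable
      (Eventually.of_forall fun z => by simp)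
  have hE2 : MemLp (E.apply a) 2 ((riemannianVolume d X).prod lam) := by
    have h1 : MemLp (fun z => gradXM a (φ n) z - E.apply a z) 2 ((riemannianVolume d X).prod lam) :=
      memLp_two_of_lintegral_sq ((hgm n).sub (hE.measurable_grad a).aestronglyMeasurable)
        ((lintegral_mono fun z => le_add_self).trans_lt hn)
    exact ((hg2 n).sub h1).congr_norm (hE.measurable_grad a).aestronglyMeasurable
      (Eventually.of_forall fun z => by simp)
  exact ⟨φ, hφ, hφ2, hg2, hh, hE2, hlim'⟩

end Sobolev

/-! ### Integration by parts against squares of Sobolev functions. -/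

section Sobolev

variable {d e k : ℕ} {X M G : Type*}
  [TopologicalSpace X] [T2Space X] [SecondCountableTopology X]
  [ChartedSpace (EuclideanSpace ℝ (Fin d)) X] [IsManifold (𝓡 d) ∞ X]
  [RiemannianBundle (fun x : X => TangentSpace (𝓡 d) x)]
  [IsContMDiffRiemannianBundle (𝓡 d) ∞ (EuclideanSpace ℝ (Fin d))
    (fun x : X => TangentSpace (𝓡 d) x)]
  [MeasurableSpace X] [BorelSpace X]
  [TopologicalSpace M] [T2Space M] [SecondCountableTopology M]
  [ChartedSpace (EuclideanSpace ℝ (Fin e)) M] [IsManifold (𝓡 e) ∞ M]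
  [MeasurableSpace M] [BorelSpace M]
  [TopologicalSpace G] [T2Space G]
  [ChartedSpace (EuclideanSpace ℝ (Fin k)) G] [Group G] [LieGroup (𝓡 k) ∞ G] [MulAction G M]

lemma CurrentAlgebra.exists_bound_divX (a : CurrentAlgebra d k X G) :
    ∃ C, ∀ x, |divX a.v x| ≤ C := by
  obtain ⟨K, hK, h⟩ := a.compact_support
  obtain ⟨C, hC⟩ := hK.exists_bound_of_continuousOn (continuous_divX a.smooth_v).continuousOn
  refine ⟨max C 0, fun x => ?_⟩
  by_cases hx : x ∈ K
  · exact (hC x hx).trans (le_max_left _ _)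
  · rw [divX_eq_zero hK (fun x hx => (h x hx).1) hx, abs_zero]
    exact le_max_right _ _

/-- Integration by parts along a vector field on `X`, for the square of a function in the Sobolev
space. -/
lemma HasSobolevGradient.integral_vPart {lam : Measure M} [SigmaFinite lam]
    (hsmooth : ContMDiff ((𝓡 k).prod (𝓡 e)) (𝓡 e) ∞ (fun y : G × M => y.1 • y.2))
    {b : Module.Basis (Fin k) ℝ (GroupLieAlgebra (𝓡 k) G)} {h : X × M → ℝ}
    {E : Covectors d k X M G} (hE : HasSobolevGradient e lam b h E) (a : CurrentAlgebra d k X G)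
    {f : X × M → ℝ} (hf : ContMDiff ((𝓡 d).prod (𝓡 e)) 𝓘(ℝ, ℝ) ∞ f) {C : ℝ}
    (hfC : ∀ z, |f z| ≤ C) (hfC' : ∀ z, |gradXM a.vPart f z| ≤ C) :
    Integrable (fun z => gradXM a.vPart f z * h z ^ 2 + 2 * f z * h z * E.apply a.vPart z +
      f z * h z ^ 2 * divX a.v z.1) ((riemannianVolume d X).prod lam) ∧
    ∫ z, (gradXM a.vPart f z * h z ^ 2 + 2 * f z * h z * E.apply a.vPart z +
      f z * h z ^ 2 * divX a.v z.1) ∂((riemannianVolume d X).prod lam) = 0 := by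
  obtain ⟨φ, hφ, hφ2, hg2, hh, hE2, hlim⟩ := hE.exists_approx hsmooth a.vPart
  obtain ⟨K, hK, hKa⟩ := a.compact_support
  obtain ⟨C', hC'⟩ := a.exists_bound_divX
  set N := (riemannianVolume d X).prod lam with hN
  have l1 : Tendsto (fun n => eLpNorm (φ n - h) 2 N) atTop (𝓝 0) :=
    tendsto_eLpNorm_two (tendsto_of_tendsto_of_tendsto_of_le_of_le tendsto_const_nhds hlim
      (fun _ => zero_le) fun n => lintegral_mono fun z => le_self_add)
  have l2 : Tendsto (fun n => eLpNorm (gradXM a.vPart (φ n) - E.apply a.vPart) 2 N) atTop (𝓝 0) :=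
    tendsto_eLpNorm_two (tendsto_of_tendsto_of_tendsto_of_le_of_le tendsto_const_nhds hlim
      (fun _ => zero_le) fun n => lintegral_mono fun z => le_add_self)
  set c₁ : X × M → ℝ := gradXM a.vPart f with hc₁
  set c₂ : X × M → ℝ := fun z => 2 * f z with hc₂
  set c₃ : X × M → ℝ := fun z => f z * divX a.v z.1 with hc₃
  have hc₂b : ∀ z, |c₂ z| ≤ 2 * C := fun z => by
    rw [hc₂, abs_mul, abs_two]; exact mul_le_mul_of_nonneg_left (hfC z) zero_le_two
  have hc₃b : ∀ z, |c₃ z| ≤ C * C' := fun z => by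
    rw [hc₃, abs_mul]
    exact mul_le_mul (hfC z) (hC' _) (abs_nonneg _) ((abs_nonneg _).trans (hfC z))
  have hm₁ : AEStronglyMeasurable c₁ N :=
    (IsTest.measurable_gradXM hsmooth a.vPart hf).aestronglyMeasurable
  have hm₂ : AEStronglyMeasurable c₂ N :=
    (hf.continuous.measurable.const_mul 2).aestronglyMeasurable
  have hm₃ : AEStronglyMeasurable c₃ N :=
    (hf.continuous.measurable.mul
      ((continuous_divX a.smooth_v).measurable.comp measurable_fst)).aestronglyMeasurable
  have int : ∀ {c α β : X × M → ℝ} {B : ℝ}, (∀ z, |c z| ≤ B) → AEStronglyMeasurable c N →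
      MemLp α 2 N → MemLp β 2 N → Integrable (fun z => c z * α z * β z) N :=
    fun hc hcm hα hβ => (memLp_two_bdd_mul hα hc hcm).integrable_mul hβ
  -- the identity for the approximating functions
  have hn : ∀ n, ∫ z, c₁ z * φ n z * φ n z ∂N + ∫ z, c₂ z * φ n z * gradXM a.vPart (φ n) z ∂N +
      ∫ z, c₃ z * φ n z * φ n z ∂N = 0 := fun n => by
    have i1 := int hfC' hm₁ (hφ2 n) (hφ2 n)
    have i2 := int hc₂b hm₂ (hφ2 n) (hg2 n)
    have i3 := int hc₃b hm₃ (hφ2 n) (hφ2 n)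
    obtain ⟨i4, e4⟩ := integral_add_three i1 i2 i3
    -- For each fixed mark this is the divergence theorem for fφₙ²; the field v has compact support,
    -- so f itself need not.
    rw [← e4, integral_prod_symm _ i4]
    refine integral_eq_zero_of_ae (Eventually.of_forall fun m => ?_)
    have hs : ContMDiff (𝓡 d) 𝓘(ℝ, ℝ) ∞ fun x : X => f (x, m) * (φ n (x, m) * φ n (x, m)) :=
      (hf.mul ((hφ n).smooth.mul (hφ n).smooth)).comp (contMDiff_id.prodMk contMDiff_const)
    have h1 := integral_mfderiv_add_divX hs a.smooth_v hK fun x hx => (hKa x hx).1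
    refine Eq.trans (integral_congr_ae (Eventually.of_forall fun x => ?_)) h1
    have h2 : lieD a.v (fun x : X => f (x, m) * (φ n (x, m) * φ n (x, m))) x =
        gradXM a.vPart (fun z => f z * (φ n z * φ n z)) (x, m) := 
      (gradXM_vPart a (fun z => f z * (φ n z * φ n z)) (x, m)).symm
    have hf1 := hf.of_le (n := ∞) (m := 1) (by simp)
    have hφ1 := (hφ n).smooth.of_le (m := 1) (by simp)
    simp only []
    rw [h2, gradXM_mul hsmooth _ hf1 (g := fun z => φ n z * φ n z) (hφ1.mul hφ1), gradXM_mul hsmooth _ hφ1 hφ1]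
    simp only [hc₁, hc₂, hc₃]
    ring
  have t1 := tendsto_integral_mul_of_eLpNorm_two (fun n => memLp_two_bdd_mul (hφ2 n) hfC' hm₁) hφ2
    (memLp_two_bdd_mul hh hfC' hm₁) hh (tendsto_eLpNorm_two_mul hfC' l1) l1
  have t2 := tendsto_integral_mul_of_eLpNorm_two (fun n => memLp_two_bdd_mul (hφ2 n) hc₂b hm₂) hg2
    (memLp_two_bdd_mul hh hc₂b hm₂) hE2 (tendsto_eLpNorm_two_mul hc₂b l1) l2
  have t3 := tendsto_integral_mul_of_eLpNorm_two (fun n => memLp_two_bdd_mul (hφ2 n) hc₃b hm₃) hφ2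
    (memLp_two_bdd_mul hh hc₃b hm₃) hh (tendsto_eLpNorm_two_mul hc₃b l1) l1
  -- Each term is an L² pairing with a bounded coefficient, one of them being f div v, so L²
  -- convergence of φₙ and of its derivative suffices.
  have t := ((t1.add t2).add t3).congr hn
  have hlim0 := tendsto_nhds_unique t tendsto_const_nhds
  have i1 := int hfC' hm₁ hh hh
  have i2 := int hc₂b hm₂ hh hE2
  have i3 := int hc₃b hm₃ hh hh
  obtain ⟨i4, e4⟩ := integral_add_three i1 i2 i3
  rw [← e4] at hlim0
  have e : ∀ z, c₁ z * h z ^ 2 + 2 * f z * h z * E.apply a.vPart z + f z * h z ^ 2 * divX a.v z.1 =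
      c₁ z * h z * h z + c₂ z * h z * E.apply a.vPart z + c₃ z * h z * h z := fun z => by
    simp only [hc₂, hc₃]; ring
  simp only [e]
  exact ⟨i4, hlim0⟩

/-- Integration by parts along the orbits of `G`, for the square of a function in the Sobolev
space. -/
lemma HasSobolevGradient.integral_uPart {lam : Measure M} [SigmaFinite lam]
    (hsmooth : ContMDiff ((𝓡 k).prod (𝓡 e)) (𝓡 e) ∞ (fun y : G × M => y.1 • y.2))
    {P : G → M → ℝ} (hP : IsDifferentiableDensity (e := e) (k := k) lam P)
    {b : Module.Basis (Fin k) ℝ (GroupLieAlgebra (𝓡 k) G)} {h : X × M → ℝ}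
    {E : Covectors d k X M G} (hE : HasSobolevGradient e lam b h E) (a : CurrentAlgebra d k X G)
    {f : X × M → ℝ} (hf : ContMDiff ((𝓡 d).prod (𝓡 e)) 𝓘(ℝ, ℝ) ∞ f) {C : ℝ}
    (hfC : ∀ z, |f z| ≤ C) (hfC' : ∀ z, |gradXM a.uPart f z| ≤ C)
    (hhP : Integrable (fun z => h z ^ 2 * (dDensity P z.2 (a.u z.1) : ℝ))
      ((riemannianVolume d X).prod lam)) :
    Integrable (fun z => gradXM a.uPart f z * h z ^ 2 + 2 * f z * h z * E.apply a.uPart z -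
      f z * h z ^ 2 * (dDensity P z.2 (a.u z.1) : ℝ)) ((riemannianVolume d X).prod lam) ∧
    ∫ z, (gradXM a.uPart f z * h z ^ 2 + 2 * f z * h z * E.apply a.uPart z -
      f z * h z ^ 2 * (dDensity P z.2 (a.u z.1) : ℝ)) ∂((riemannianVolume d X).prod lam) = 0 := by
  obtain ⟨φ, hφ, hφ2, hg2, hh, hE2, hlim⟩ := hE.exists_approx hsmooth a.uPart
  set N := (riemannianVolume d X).prod lam with hN
  obtain ⟨r, hr, hhr⟩ := hE.measurable_fun
  obtain ⟨r', hr', hEr⟩ := hE.measurable_grad a.uPart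
  have hfm := hf.continuous.measurable
  have hfm' := IsTest.measurable_gradXM hsmooth a.uPart hf
  have hi : Integrable (fun z => gradXM a.uPart f z * h z ^ 2 + 2 * f z * h z * E.apply a.uPart z -
      f z * h z ^ 2 * (dDensity P z.2 (a.u z.1) : ℝ)) N := by
    have i1 := (memLp_two_bdd_mul hh hfC' hfm'.aestronglyMeasurable).integrable_mul hh
    have i2 := ((memLp_two_bdd_mul hh hfC hfm.aestronglyMeasurable).integrable_mul hE2).const_mul 2
    have i3 := hhP.bdd_mul (c := C) hfm.aestronglyMeasurable (Eventually.of_forall hfC)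
    refine ((i1.add i2).sub i3).congr (Eventually.of_forall fun z => ?_)
    simp only [Pi.add_apply, Pi.sub_apply, Pi.mul_apply]
    ring
  refine ⟨hi, ?_⟩
  have hφm : ∀ n, Measurable (φ n) := fun n => (hφ n).smooth.continuous.measurable
  have hφm' : ∀ n, Measurable (gradXM a.uPart (φ n)) :=
    fun n => IsTest.measurable_gradXM hsmooth a.uPart (hφ n).smooth
  have hmeas : ∀ n, Measurable fun z => ENNReal.ofReal ((φ n z - r z) ^ 2) +
      ENNReal.ofReal ((gradXM a.uPart (φ n) z - r' z) ^ 2) := fun n =>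
    (((hφm n).sub hr).pow_const 2).ennreal_ofReal.add
      (((hφm' n).sub hr').pow_const 2).ennreal_ofReal
  -- Along a subsequence the approximation holds in L² of almost every fibre {x} × M. On such a
  -- fibre u(x) is one fixed element, and the formula along its one-parameter subgroup applies.
  obtain ⟨ns, -, hns⟩ := exists_subseq_ae_tendsto_zero (μ := riemannianVolume d X)
    (f := fun n x => ∫⁻ m, (ENNReal.ofReal ((φ n (x, m) - r (x, m)) ^ 2) +
      ENNReal.ofReal ((gradXM a.uPart (φ n) (x, m) - r' (x, m)) ^ 2)) ∂lam)
    (fun n => (hmeas n).lintegral_prod_right'.aemeasurable) (by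
      refine hlim.congr fun n => ?_
      rw [← lintegral_prod _ (hmeas n).aemeasurable]
      refine lintegral_congr_ae ?_
      filter_upwards [hhr, hEr] with z h1 h2
      rw [h1, h2])
  rw [integral_prod _ hi]
  refine integral_eq_zero_of_ae ?_
  have e1 : Integrable (fun z => r z ^ 2) N :=
    hh.integrable_sq.congr (hhr.mono fun z hz => by simp only [hz])
  have e2 : Integrable (fun z => r' z ^ 2) N :=
    hE2.integrable_sq.congr (hEr.mono fun z hz => by simp only [hz])
  have e3 : Integrable (fun z => r z ^ 2 * (dDensity P z.2 (a.u z.1) : ℝ)) N :=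
    hhP.congr (hhr.mono fun z hz => by simp only [hz])
  filter_upwards [hns, e1.prod_right_ae, e2.prod_right_ae, e3.prod_right_ae,
    Measure.ae_ae_of_ae_prod hhr, Measure.ae_ae_of_ae_prod hEr] with x hx i1 i2 i3 a1 a2
  have hc : Continuous fun m : M => (x, m) := continuous_const.prodMk continuous_id
  have hxm : Measurable fun m : M => (x, m) := measurable_prodMk_left
  have hd : ∀ {ψ : X × M → ℝ}, ContMDiff ((𝓡 d).prod (𝓡 e)) 𝓘(ℝ, ℝ) ∞ ψ → ∀ m s,
      HasDerivAt (fun s => ψ (x, oneParam (a.u x) s • m))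
        (gradXM a.uPart ψ (x, oneParam (a.u x) s • m)) s := fun hψ m s => by
    rw [gradXM_uPart]
    exact hasDerivAt_oneParam_smul hsmooth (a.u x) (hψ.of_le (by simp)) x m s
  have key := hP.integral_byParts hsmooth (a.u x)
    (φ := fun n m => φ (ns n) (x, m)) (φ' := fun n m => gradXM a.uPart (φ (ns n)) (x, m))
    (f := fun m => f (x, m)) (f' := fun m => gradXM a.uPart f (x, m))
    (r := fun m => r (x, m)) (r' := fun m => r' (x, m))
    (fun n => hd (hφ (ns n)).smooth) (fun n => (hφ _).smooth.continuous.comp hc)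
    (fun n => (contMDiff_gradXM hsmooth _ (hφ _).smooth).continuous.comp hc) (hd hf)
    (hf.continuous.comp hc) ((contMDiff_gradXM hsmooth _ hf).continuous.comp hc)
    (fun m => hfC _) (fun m => hfC' _) (hr.comp hxm) (hr'.comp hxm) i1 i2 hx i3
  refine Eq.trans (integral_congr_ae ?_) key.2
  filter_upwards [a1, a2] with m h1 h2
  rw [h1, h2]

end Sobolev

/-! ### The one-point formula for the Lévy measure. -/

section LevyMeasure

variable {d e k : ℕ} {X M G : Type*}
  [TopologicalSpace X] [T2Space X] [SecondCountableTopology X]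
  [ChartedSpace (EuclideanSpace ℝ (Fin d)) X] [IsManifold (𝓡 d) ∞ X]
  [RiemannianBundle (fun x : X => TangentSpace (𝓡 d) x)]
  [IsContMDiffRiemannianBundle (𝓡 d) ∞ (EuclideanSpace ℝ (Fin d))
    (fun x : X => TangentSpace (𝓡 d) x)]
  [MeasurableSpace X] [BorelSpace X]
  [TopologicalSpace M] [T2Space M] [SecondCountableTopology M]
  [ChartedSpace (EuclideanSpace ℝ (Fin e)) M] [IsManifold (𝓡 e) ∞ M]
  [MeasurableSpace M] [BorelSpace M]
  [TopologicalSpace G] [T2Space G]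
  [ChartedSpace (EuclideanSpace ℝ (Fin k)) G] [Group G] [LieGroup (𝓡 k) ∞ G] [MulAction G M]

lemma ae_density_pos {lam : Measure M} [SFinite lam] {ρ : X → ℝ} {p : X → M → ℝ}
    (hρ : Measurable ρ) (hp : Measurable (fun z : X × M => p z.1 z.2))
    (hρ_pos : ∀ᵐ x ∂(riemannianVolume d X), 0 < ρ x)
    (hp_pos : ∀ᵐ x ∂(riemannianVolume d X), ∀ᵐ m ∂lam, 0 < p x m) :
    ∀ᵐ z ∂((riemannianVolume d X).prod lam), 0 < ρ z.1 * p z.1 z.2 := by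
  have hm : MeasurableSet {z : X × M | 0 < ρ z.1 * p z.1 z.2} :=
    measurableSet_lt measurable_const ((hρ.comp measurable_fst).mul hp)
  rw [Measure.ae_prod_iff_ae_ae hm]
  filter_upwards [hρ_pos, hp_pos] with x h1 h2
  filter_upwards [h2] with m h3
  exact mul_pos h1 h3

/-- Over `K` the square root of q coincides with a square-integrable function, so q is integrable
there. In this way the Sobolev hypothesis makes σ finite over compact sets. -/
lemma setIntegrable_density {lam : Measure M} [SFinite lam]
    (hsmooth : ContMDiff ((𝓡 k).prod (𝓡 e)) (𝓡 e) ∞ (fun y : G × M => y.1 • y.2))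
    {b : Module.Basis (Fin k) ℝ (GroupLieAlgebra (𝓡 k) G)} {q : X × M → ℝ} (_hq : Measurable q)
    {D : Covectors d k X M G} (hD : HasLocalSobolevGradient e lam b (fun z => Real.sqrt (q z)) D)
    {K : Set X} (hK : IsCompact K) :
    ∫⁻ z in K ×ˢ Set.univ, ENNReal.ofReal (q z) ∂((riemannianVolume d X).prod lam) < ⊤ := by
  obtain ⟨h, E, hE, hae⟩ := hD K hK
  obtain ⟨-, -, -, -, hh, -⟩ := hE.exists_approx hsmooth
    -- Only square integrability of the function is wanted, so the zero element of the Lie algebra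
    -- serves as direction.
    (⟨fun _ => 0, fun _ => 0, contMDiff_zeroSection ℝ (TangentSpace (𝓡 d) : X → Type _),
      contMDiff_const, ⟨∅, isCompact_empty, fun x _ => ⟨rfl, rfl⟩⟩⟩ : CurrentAlgebra d k X G)
  have hKm : MeasurableSet (K ×ˢ (Set.univ : Set M)) := hK.measurableSet.prod MeasurableSet.univ
  have h1 := hh.integrable_sq.lintegral_lt_top
  refine lt_of_le_of_lt ?_ h1
  refine (setLIntegral_mono_ae' hKm ?_).trans (setLIntegral_le_lintegral (K ×ˢ Set.univ) _)
  filter_upwards [hae] with z hz hzK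
  rw [← (hz hzK.1).1]
  refine ENNReal.ofReal_le_ofReal ?_
  rcases le_total 0 (q z) with h0 | h0
  · rw [Real.sq_sqrt h0]
  · exact h0.trans (sq_nonneg _)

lemma levyMeasure_lt_top {lam : Measure M} [SFinite lam]
    (hsmooth : ContMDiff ((𝓡 k).prod (𝓡 e)) (𝓡 e) ∞ (fun y : G × M => y.1 • y.2))
    {b : Module.Basis (Fin k) ℝ (GroupLieAlgebra (𝓡 k) G)} {ρ : X → ℝ} {p : X → M → ℝ}
    (hρ : Measurable ρ) (hp : Measurable (fun z : X × M => p z.1 z.2))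
    {D : Covectors d k X M G}
    (hD : HasLocalSobolevGradient e lam b (fun z => Real.sqrt (ρ z.1 * p z.1 z.2)) D)
    {K : Set X} (hK : IsCompact K) : levyMeasure d lam ρ p (K ×ˢ Set.univ) < ⊤ := by
  rw [levyMeasure, withDensity_apply _ (hK.measurableSet.prod MeasurableSet.univ)]
  exact setIntegrable_density hsmooth (q := fun z : X × M => ρ z.1 * p z.1 z.2)
    ((hρ.comp measurable_fst).mul hp) hD hK

lemma levyMeasure_fiber [ConnectedSpace X] [NoncompactSpace X] {lam : Measure M} [SigmaFinite lam]
    (ρ : X → ℝ) (p : X → M → ℝ) (x : X) : levyMeasure d lam ρ p ({x} ×ˢ Set.univ) = 0 := by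
  refine withDensity_absolutelyContinuous _ _ ?_
  rw [Measure.prod_prod, riemannianVolume_singleton, zero_mul]

lemma logDeriv_eq_zero {q : X × M → ℝ} {D : Covectors d k X M G} {P : G → M → ℝ}
    {a : CurrentAlgebra d k X G} {K : Set X} (hK : IsCompact K)
    (ha : ∀ x ∉ K, a.v x = 0 ∧ a.u x = 0) {z : X × M} (hz : z.1 ∉ K) :
    logDeriv q D P a z = 0 := by
  have h1 : D.onX z (a.v z.1) = 0 := by rw [(ha _ hz).1]; exact map_zero _
  have h2 : D.onG z (a.u z.1) = 0 := by rw [(ha _ hz).2]; exact map_zero _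
  have h3 : (dDensity P z.2 (-(a.u z.1)) : ℝ) = 0 := by
    rw [(ha _ hz).2, neg_zero]; exact map_zero _
  rw [logDeriv, h1, h2, h3, divX_eq_zero hK (fun x hx => (ha x hx).1) hz]
  simp

lemma IsDifferentiableDensity.measurable_dDensity_apply {lam : Measure M} {P : G → M → ℝ}
    (hP : IsDifferentiableDensity (e := e) (k := k) lam P)
    (b : Module.Basis (Fin k) ℝ (GroupLieAlgebra (𝓡 k) G)) (a : CurrentAlgebra d k X G) :
    Measurable fun z : X × M => (dDensity P z.2 (a.u z.1) : ℝ) := by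
  have h : (fun z : X × M => (dDensity P z.2 (a.u z.1) : ℝ)) =
      fun z => ∑ i, b.repr (a.u z.1) i * (dDensity P z.2 (b i) : ℝ) := by
    ext z
    refine (congrArg (dDensity P z.2) (b.sum_repr (a.u z.1)).symm).trans ?_
    rw [map_sum]
    exact Finset.sum_congr rfl fun i _ => map_smul (dDensity P z.2) _ _
  rw [h]
  exact Finset.measurable_sum _ fun i _ =>
    ((continuous_repr_u b a i).measurable.comp measurable_fst).mul
      ((hP.measurable_dDensity (b i)).comp measurable_snd)

/-- Integration by parts on `X × M`. -/
lemma integral_gradXM_add_logDeriv {lam : Measure M} [SigmaFinite lam]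
    (hsmooth : ContMDiff ((𝓡 k).prod (𝓡 e)) (𝓡 e) ∞ (fun y : G × M => y.1 • y.2))
    {b : Module.Basis (Fin k) ℝ (GroupLieAlgebra (𝓡 k) G)}
    {P : G → M → ℝ} (hP : IsDifferentiableDensity (e := e) (k := k) lam P)
    {ρ : X → ℝ} {p : X → M → ℝ} (hρ : Measurable ρ) (hp : Measurable (fun z : X × M => p z.1 z.2))
    (hρ_pos : ∀ᵐ x ∂(riemannianVolume d X), 0 < ρ x)
    (hp_pos : ∀ᵐ x ∂(riemannianVolume d X), ∀ᵐ m ∂lam, 0 < p x m)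
    {D : Covectors d k X M G}
    (hD : HasLocalSobolevGradient e lam b (fun z => Real.sqrt (ρ z.1 * p z.1 z.2)) D)
    (hPint : ∀ K : Set X, IsCompact K →
      IntegrableOn (fun z : X × M => Real.sqrt (normSqG b (dDensity P z.2))) (K ×ˢ Set.univ)
        (levyMeasure d lam ρ p))
    (a : CurrentAlgebra d k X G) {f : X × M → ℝ}
    (hf : ContMDiff ((𝓡 d).prod (𝓡 e)) 𝓘(ℝ, ℝ) ∞ f) {C : ℝ}
    (hfC : ∀ z, |f z| ≤ C) (hfv : ∀ z, |gradXM a.vPart f z| ≤ C)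
    (hfu : ∀ z, |gradXM a.uPart f z| ≤ C) :
    Integrable (fun z => gradXM a f z + f z * logDeriv (fun z : X × M => ρ z.1 * p z.1 z.2) D P a z)
      (levyMeasure d lam ρ p) ∧
    ∫ z, (gradXM a f z + f z * logDeriv (fun z : X × M => ρ z.1 * p z.1 z.2) D P a z)
      ∂(levyMeasure d lam ρ p) = 0 := by
  obtain ⟨K, hK, hKa⟩ := a.compact_support
  obtain ⟨h, E, hE, hae⟩ := hD K hK
  obtain ⟨q, hq⟩ : ∃ q : X × M → ℝ, q = fun z : X × M => ρ z.1 * p z.1 z.2 := ⟨_, rfl⟩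
  have hqm : Measurable q := hq ▸ (hρ.comp measurable_fst).mul hp
  have hqpos : ∀ᵐ z ∂((riemannianVolume d X).prod lam), 0 < q z :=
    hq ▸ ae_density_pos hρ hp hρ_pos hp_pos
  rw [levyMeasure] at hPint ⊢
  simp only [show ∀ z : X × M, ρ z.1 * p z.1 z.2 = q z from fun z => by rw [hq]] at hae hPint ⊢
  set N := (riemannianVolume d X).prod lam with hN
  have hqm' : Measurable fun z => ENNReal.ofReal (q z) := hqm.ennreal_ofReal
  have hKm : MeasurableSet (K ×ˢ (Set.univ : Set M)) := hK.measurableSet.prod MeasurableSet.univ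
  -- the term with the derivative of the density
  have hhP : Integrable (fun z => h z ^ 2 * (dDensity P z.2 (a.u z.1) : ℝ)) N := by
    obtain ⟨C', hC', hCb⟩ := exists_bound_apply b a
    have h1 := hPint K hK
    rw [IntegrableOn, restrict_withDensity hKm,
      integrable_withDensity_iff_integrable_smul' hqm' (by simp)] at h1
    have h2 : IntegrableOn (fun z => h z ^ 2 * (dDensity P z.2 (a.u z.1) : ℝ)) (K ×ˢ Set.univ) N := by
      refine Integrable.mono' (h1.const_mul (Real.sqrt C')) ?_ ?_
      · exact ((hE.measurable_fun.pow_const 2).mul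
          (hP.measurable_dDensity_apply b a).aemeasurable).aestronglyMeasurable.restrict
      · rw [ae_restrict_iff' hKm]
        filter_upwards [hae, hqpos] with z h1 h2 hz
        have e1 : h z ^ 2 = q z := by rw [← (h1 hz.1).1, Real.sq_sqrt h2.le]
        have e2 := hCb z.1 0 (dDensity P z.2)
        have n0 : (‖(0 : TangentSpace (𝓡 d) z.1 →L[ℝ] ℝ)‖ : ℝ) = 0 := ContinuousLinearMap.opNorm_zero
        have n1 : ((0 : TangentSpace (𝓡 d) z.1 →L[ℝ] ℝ) (a.v z.1) : ℝ) = 0 := rfl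
        rw [n0, n1, zero_add, zero_pow two_ne_zero, zero_add] at e2
        rw [e1, norm_mul, Real.norm_of_nonneg h2.le, ENNReal.toReal_ofReal h2.le, smul_eq_mul,
          mul_left_comm]
        refine mul_le_mul_of_nonneg_left ?_ h2.le
        rw [← Real.sqrt_mul hC']
        exact Real.abs_le_sqrt e2
    refine h2.integrable_of_forall_notMem_eq_zero fun z hz => ?_
    have e1 : (dDensity P z.2 (a.u z.1) : ℝ) = 0 := by
      rw [(hKa z.1 fun h => hz ⟨h, trivial⟩).2]; exact map_zero _
    rw [e1, mul_zero]
  obtain ⟨iv, ev⟩ := hE.integral_vPart hsmooth a hf hfC hfv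
  obtain ⟨iu, eu⟩ := hE.integral_uPart hsmooth hP a hf hfC hfu hhP
  have hsum := integral_add iv iu
  rw [ev, eu, add_zero] at hsum
  -- Over `K` one has h = √q > 0, so h² = q and 2h∇h is q times ∇q/q. Off `K` the function h has
  -- nothing to do with q, but both sides vanish because v, u and div v do.
  have hae2 : ∀ᵐ z ∂N, (gradXM a.vPart f z * h z ^ 2 + 2 * f z * h z * E.apply a.vPart z +
      f z * h z ^ 2 * divX a.v z.1) + (gradXM a.uPart f z * h z ^ 2 +
      2 * f z * h z * E.apply a.uPart z - f z * h z ^ 2 * (dDensity P z.2 (a.u z.1) : ℝ)) =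
      (ENNReal.ofReal (q z)).toReal • (gradXM a f z + f z * logDeriv q D P a z) := by
    filter_upwards [hae, hqpos] with z h1 h2
    have eEv : E.apply a.vPart z = E.onX z (a.v z.1) := by
      have : E.onG z (0 : GroupLieAlgebra (𝓡 k) G) = 0 := map_zero _
      change E.onX z (a.v z.1) + E.onG z (0 : GroupLieAlgebra (𝓡 k) G) = _
      rw [this, add_zero]
    have eEu : E.apply a.uPart z = E.onG z (a.u z.1) := by
      have : E.onX z (0 : TangentSpace (𝓡 d) z.1) = 0 := map_zero _
      change E.onX z (0 : TangentSpace (𝓡 d) z.1) + E.onG z (a.u z.1) = _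
      rw [this, zero_add]
    rw [ENNReal.toReal_ofReal h2.le, smul_eq_mul, gradXM_eq_add a f z, eEv, eEu]
    by_cases hz : z.1 ∈ K
    · obtain ⟨g1, g2, g3⟩ := h1 hz
      have e1 : h z ^ 2 = q z := by rw [← g1, Real.sq_sqrt h2.le]
      have e2 : (dDensity P z.2 (-(a.u z.1)) : ℝ) = -(dDensity P z.2 (a.u z.1) : ℝ) := map_neg _ _
      rw [logDeriv, e2, g1, g2, g3, e1]
      field_simp
      ring
    · rw [logDeriv_eq_zero hK hKa hz, divX_eq_zero hK (fun x hx => (hKa x hx).1) hz,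
        gradXM_vPart a f z, gradXM_uPart a f z]
      rw [(hKa _ hz).1, (hKa _ hz).2]
      have r1 : (dX f z (0 : TangentSpace (𝓡 d) z.1) : ℝ) = 0 := map_zero _
      have r2 : (dG k G f z (0 : GroupLieAlgebra (𝓡 k) G) : ℝ) = 0 := map_zero _
      have r3 : (E.onX z (0 : TangentSpace (𝓡 d) z.1) : ℝ) = 0 := map_zero _
      have r4 : (E.onG z (0 : GroupLieAlgebra (𝓡 k) G) : ℝ) = 0 := map_zero _
      have r5 : (dDensity P z.2 (0 : GroupLieAlgebra (𝓡 k) G) : ℝ) = 0 := map_zero _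
      rw [r1, r2, r3, r4, r5]
      ring
  have hi := (iv.add iu).congr hae2
  constructor
  · rw [integrable_withDensity_iff_integrable_smul' hqm' (by simp)]
    exact hi
  · rw [integral_withDensity_eq_integral_toReal_smul hqm' (by simp), ← integral_congr_ae hae2]
    exact hsum

end LevyMeasure

/-! ### Measurability on the configuration space and tuples of points. -/

section Configurations

variable {X M : Type*} [TopologicalSpace X]

lemma IsConfiguration.injOn {s : Set (X × M)} (h : IsConfiguration s) : Set.InjOn Prod.fst s :=
  fun z hz z' hz' e => by
    by_contra hne
    exact h.1 z hz z' hz' hne e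

lemma IsConfiguration.finite_inter {s : Set (X × M)} (h : IsConfiguration s) {K : Set X}
    (hK : IsCompact K) : (s ∩ K ×ˢ Set.univ).Finite := by
  refine Set.Finite.of_finite_image ((h.2 K hK).subset ?_) (h.injOn.mono Set.inter_subset_left)
  rintro _ ⟨z, hz, rfl⟩
  exact ⟨⟨z, hz.1, rfl⟩, hz.2.1⟩

lemma IsConfiguration.mono {s t : Set (X × M)} (h : IsConfiguration s) (hts : t ⊆ s) :
    IsConfiguration t :=
  ⟨fun z hz z' hz' => h.1 z (hts hz) z' (hts hz'), fun K hK =>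
    (h.2 K hK).subset (Set.inter_subset_inter_left _ (Set.image_mono hts))⟩

lemma toConfiguration_coe {s : Set (X × M)} (h : IsConfiguration s) :
    (toConfiguration s).1 = s := by
  have : toConfiguration s = ⟨s, h⟩ := dif_pos h
  rw [this]

lemma restrictTo_coe (Λ : Set X) (ξ : Configuration X M) :
    (restrictTo Λ ξ).1 = ξ.1 ∩ Λ ×ˢ Set.univ :=
  toConfiguration_coe (ξ.2.mono Set.inter_subset_left)

lemma pairing_eq_sum {f : X × M → ℝ} {K : Set X} (hK : IsCompact K)
    (hf : ∀ z : X × M, z.1 ∉ K → f z = 0) (ξ : Configuration X M) :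
    pairing f ξ = ∑ z ∈ (ξ.2.finite_inter hK).toFinset, f z := by
  refine finsum_mem_eq_sum_of_inter_support_eq f ?_
  ext z
  simp only [Set.mem_inter_iff, Function.mem_support, Set.Finite.coe_toFinset, Set.mem_prod,
    Set.mem_univ, and_true]
  refine ⟨fun h => ⟨⟨h.1, ?_⟩, h.2⟩, fun h => ⟨h.1.1, h.2⟩⟩
  by_contra hz
  exact h.2 (hf z hz)

lemma pairing_restrictTo {f : X × M → ℝ} {Λ : Set X}
    (hf : ∀ z : X × M, z.1 ∉ Λ → f z = 0) (ξ : Configuration X M) :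
    pairing f (restrictTo Λ ξ) = pairing f ξ := by
  rw [pairing, pairing, restrictTo_coe]
  refine finsum_mem_inter_support_eq' f _ _ fun z hz => ?_
  refine ⟨fun h => h.1, fun h => ⟨h, ?_, trivial⟩⟩
  by_contra hz'
  exact hz (hf z hz')

lemma pairing_indicator_one {B : Set (X × M)} {K : Set X} (hK : IsCompact K)
    (hB : B ⊆ K ×ˢ Set.univ) (ξ : Configuration X M) :
    pairing (B.indicator 1) ξ = ((ξ.1 ∩ B).ncard : ℝ) := by
  classical
  have hfin : (ξ.1 ∩ B).Finite := (ξ.2.finite_inter hK).subset (Set.inter_subset_inter_right _ hB)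
  rw [pairing_eq_sum hK fun z hz => Set.indicator_of_notMem (fun h => hz (hB h).1) _,
    Set.ncard_eq_toFinset_card _ hfin]
  simp only [Set.indicator_apply, Pi.one_apply]
  rw [← Finset.sum_filter, Finset.sum_const, nsmul_eq_mul, mul_one]
  congr 2
  ext z
  simp only [Finset.mem_filter, Set.Finite.mem_toFinset, Set.mem_inter_iff]
  exact ⟨fun h => ⟨h.1.1, h.2⟩, fun h => ⟨⟨h.1, hB h.2⟩, h.2⟩⟩

lemma abs_pairing_le {f g : X × M → ℝ} {K : Set X} (hK : IsCompact K)
    (hf : ∀ z : X × M, z.1 ∉ K → f z = 0) (hg : ∀ z : X × M, z.1 ∉ K → g z = 0)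
    (h : ∀ z, |f z| ≤ g z) (ξ : Configuration X M) : |pairing f ξ| ≤ pairing g ξ := by
  rw [pairing_eq_sum hK hf, pairing_eq_sum hK hg]
  exact (Finset.abs_sum_le_sum_abs _ _).trans (Finset.sum_le_sum fun z _ => h z)

variable [MeasurableSpace X] [MeasurableSpace M]

lemma measurable_ncard {B : Set (X × M)} (hB : MeasurableSet B) {K : Set X} (hK : IsCompact K)
    (hBK : B ⊆ K ×ˢ Set.univ) : Measurable fun ξ : Configuration X M => (ξ.1 ∩ B).ncard := by
  refine Measurable.mono (ma := MeasurableSpace.comap _ ⊤) (comap_measurable _) ?_ le_rfl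
  exact le_iSup (fun B : {B : Set (X × M) // MeasurableSet B ∧ ∃ K : Set X, IsCompact K ∧
    B ⊆ K ×ˢ Set.univ} => MeasurableSpace.comap
      (fun ξ : Configuration X M => (ξ.1 ∩ B.1).ncard) ⊤) ⟨B, hB, K, hK, hBK⟩

lemma measurable_configuration {α : Type*} [MeasurableSpace α] {f : α → Configuration X M}
    (h : ∀ (B : Set (X × M)) (K : Set X), MeasurableSet B → IsCompact K → B ⊆ K ×ˢ Set.univ →
      Measurable fun x => ((f x).1 ∩ B).ncard) : Measurable f := by
  rw [measurable_iff_comap_le]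
  refine (MeasurableSpace.comap_iSup).trans_le (iSup_le fun B => ?_)
  obtain ⟨B, hB, K, hK, hBK⟩ := B
  rw [MeasurableSpace.comap_comp]
  exact (h B K hB hK hBK).comap_le

lemma measurable_restrictTo {Λ : Set X} (hΛ : MeasurableSet Λ) :
    Measurable (restrictTo Λ : Configuration X M → Configuration X M) := by
  refine measurable_configuration fun B K hB hK hBK => ?_
  simp only [restrictTo_coe, Set.inter_assoc]
  exact measurable_ncard ((hΛ.prod MeasurableSet.univ).inter hB) hK
    (Set.inter_subset_right.trans hBK)

/-- Pairings with measurable functions are measurable. -/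
lemma measurable_pairing [T2Space X] [OpensMeasurableSpace X] {f : X × M → ℝ} (hf : Measurable f)
    {K : Set X} (hK : IsCompact K) (hfK : ∀ z : X × M, z.1 ∉ K → f z = 0) :
    Measurable (pairing f) := by
  classical
  have hKm : MeasurableSet (K ×ˢ (Set.univ : Set M)) := hK.measurableSet.prod MeasurableSet.univ
  let s : ℕ → SimpleFunc (X × M) ℝ := fun n => SimpleFunc.approxOn f hf Set.univ 0 (Set.mem_univ 0) n
  have hs : ∀ z, Tendsto (fun n => s n z) atTop (𝓝 (f z)) := fun z =>
    SimpleFunc.tendsto_approxOn hf (Set.mem_univ 0) (by simp)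
  refine measurable_of_tendsto_metrizable
    (f := fun n ξ => ∑ z ∈ (ξ.2.finite_inter hK).toFinset, s n z) (fun n => ?_) ?_
  -- For a simple function the pairing is a finite combination of counting functions over its level
  -- sets.
  · have h : (fun ξ : Configuration X M => ∑ z ∈ (ξ.2.finite_inter hK).toFinset, s n z) =
        fun ξ => ∑ c ∈ (s n).range, ((ξ.1 ∩ (K ×ˢ Set.univ ∩ s n ⁻¹' {c})).ncard : ℝ) * c := by
      funext ξ
      rw [← Finset.sum_fiberwise_of_maps_to (g := s n) (t := (s n).range)
        fun z _ => SimpleFunc.mem_range_self _ _]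
      refine Finset.sum_congr rfl fun c _ => ?_
      rw [Finset.sum_congr rfl fun z hz => (Finset.mem_filter.1 hz).2, Finset.sum_const,
        nsmul_eq_mul, ← Set.inter_assoc,
        Set.ncard_eq_toFinset_card _ ((ξ.2.finite_inter hK).subset Set.inter_subset_left)]
      congr 3
      ext z
      simp
    rw [h]
    refine Finset.measurable_sum _ fun c _ => Measurable.mul_const ?_ c
    exact (measurable_from_nat (f := fun n : ℕ => (n : ℝ))).comp (measurable_ncard
      (hKm.inter ((s n).measurableSet_preimage _)) hK Set.inter_subset_left)
  · rw [tendsto_pi_nhds]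
    intro ξ
    rw [pairing_eq_sum hK hfK]
    exact tendsto_finsetSum _ fun z _ => hs z

/-- The tuples with distinct positions. -/
def distinctTuples (X M : Type*) (n : ℕ) : Set (Fin n → X × M) :=
  {z | Function.Injective fun i => (z i).1}

lemma ofTuple_coe {n : ℕ} {z : Fin n → X × M} (hz : z ∈ distinctTuples X M n) :
    (ofTuple n z).1 = Set.range z := by
  refine toConfiguration_coe ⟨?_, fun K _ => ?_⟩
  · rintro _ ⟨i, rfl⟩ _ ⟨j, rfl⟩ hne e
    exact hne (congrArg z (hz e))
  · exact ((Set.finite_range z).image _).subset Set.inter_subset_left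

lemma pairing_ofTuple {n : ℕ} {z : Fin n → X × M} (hz : z ∈ distinctTuples X M n)
    (f : X × M → ℝ) : pairing f (ofTuple n z) = ∑ i, f (z i) := by
  have hinj : Function.Injective z := fun i j h => hz (congrArg Prod.fst h)
  rw [pairing, ofTuple_coe hz, finsum_mem_range hinj, finsum_eq_sum_of_fintype]

variable [T2Space X] [SecondCountableTopology X] [BorelSpace X]

lemma measurableSet_distinctTuples (n : ℕ) : MeasurableSet (distinctTuples X M n) := by
  have : distinctTuples X M n = ⋂ i, ⋂ j, {z | (z i).1 = (z j).1 → i = j} := by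
    ext z
    simp [distinctTuples, Function.Injective]
  rw [this]
  refine MeasurableSet.iInter fun i => MeasurableSet.iInter fun j => ?_
  by_cases h : i = j
  · simp [h]
  · simp only [h, imp_false]
    exact (measurableSet_eq_fun (measurable_fst.comp (measurable_pi_apply i))
      (measurable_fst.comp (measurable_pi_apply j))).compl

/-- Two coordinates share a position with probability zero: coordinate i is split off by Fubini, and
a fibre over one point of X is null. -/
lemma ae_mem_distinctTuples {θ : Measure (X × M)} [SigmaFinite θ]
    (hθ : ∀ x : X, θ ({x} ×ˢ Set.univ) = 0) (n : ℕ) :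
    ∀ᵐ z ∂(Measure.pi fun _ : Fin n => θ), z ∈ distinctTuples X M n := by
  have key : ∀ i j : Fin n, i ≠ j → ∀ᵐ z ∂(Measure.pi fun _ : Fin n => θ), (z i).1 ≠ (z j).1 := by
    intro i j hij
    cases n with
    | zero => exact i.elim0
    | succ n =>
      obtain ⟨l, rfl⟩ := Fin.exists_succAbove_eq hij.symm
      have hmp := measurePreserving_piFinSuccAbove (fun _ : Fin (n + 1) => θ) i
      have hmeas : MeasurableSet {y : (X × M) × (Fin n → X × M) | y.1.1 = (y.2 l).1} :=
        measurableSet_eq_fun (measurable_fst.comp measurable_fst)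
          (measurable_fst.comp ((measurable_pi_apply l).comp measurable_snd))
      have h0 : (θ.prod (Measure.pi fun _ : Fin n => θ))
          {y : (X × M) × (Fin n → X × M) | y.1.1 = (y.2 l).1} = 0 := by
        rw [Measure.prod_apply_symm hmeas]
        refine (lintegral_congr fun y => ?_).trans lintegral_zero
        refine measure_mono_null ?_ (hθ (y l).1)
        intro w hw
        exact ⟨hw, trivial⟩
      have h1 := hmp.measure_preimage hmeas.nullMeasurableSet
      rw [h0] at h1
      rw [ae_iff]
      simp only [not_not]
      exact h1
  have : ∀ᵐ z ∂(Measure.pi fun _ : Fin n => θ), ∀ i j : Fin n, i ≠ j → (z i).1 ≠ (z j).1 := by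
    simp only [ae_all_iff]
    exact key
  filter_upwards [this] with z hz i j hij
  by_contra hne
  exact hz i j hne hij

/-- On tuples with distinct positions the counting functions are sums of indicators of the
coordinates; the other tuples form a null set and may be sent to the empty configuration. -/
lemma aemeasurable_ofTuple {θ : Measure (X × M)} [SigmaFinite θ]
    (hθ : ∀ x : X, θ ({x} ×ˢ Set.univ) = 0) (n : ℕ) :
    AEMeasurable (ofTuple n) (Measure.pi fun _ : Fin n => θ) := by
  classical
  refine ⟨fun z => if z ∈ distinctTuples X M n then ofTuple n z else toConfiguration ∅, ?_, ?_⟩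
  · refine measurable_configuration fun B K hB hK hBK => ?_
    have h : (fun z : Fin n → X × M => ((if z ∈ distinctTuples X M n then ofTuple n z
        else toConfiguration ∅ : Configuration X M).1 ∩ B).ncard) = fun z =>
        if z ∈ distinctTuples X M n then ∑ i, B.indicator (1 : X × M → ℕ) (z i) else 0 := by
      funext z
      split_ifs with hz
      · have h1 := pairing_ofTuple hz (B.indicator 1)
        rw [pairing_indicator_one hK hBK] at h1
        have h2 : ∀ w, (B.indicator (1 : X × M → ℝ) w) = ((B.indicator (1 : X × M → ℕ) w : ℕ) : ℝ) :=
          fun w => by by_cases hw : w ∈ B <;> simp [hw]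
        simp only [h2] at h1
        exact_mod_cast h1
      · rw [toConfiguration_coe (by simp [IsConfiguration])]
        simp
    rw [h]
    refine Measurable.ite (measurableSet_distinctTuples n) ?_ measurable_const
    exact Finset.measurable_sum _ fun i _ =>
      ((measurable_const.indicator hB).comp (measurable_pi_apply i))
  · filter_upwards [ae_mem_distinctTuples hθ n] with z hz
    rw [if_pos hz]

end Configurations

lemma tsum_inv_factorial_mul_pow_lt_top {c : ENNReal} (hc : c ≠ ⊤) :
    ∑' n : ℕ, ((n.factorial : ENNReal)⁻¹) * c ^ n < ⊤ := by
  have h := Real.summable_pow_div_factorial c.toReal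
  have : ∀ n : ℕ, ((n.factorial : ENNReal)⁻¹) * c ^ n =
      ENNReal.ofReal (c.toReal ^ n / n.factorial) := fun n => by
    have hn : (0 : ℝ) < n.factorial := by exact_mod_cast n.factorial_pos
    rw [ENNReal.ofReal_div_of_pos hn, ENNReal.ofReal_pow ENNReal.toReal_nonneg,
      ENNReal.ofReal_toReal hc, ENNReal.ofReal_natCast, mul_comm]
    rfl
  simp only [this]
  rw [← ENNReal.ofReal_tsum_of_nonneg (fun n => by positivity) h]
  exact ENNReal.ofReal_lt_top

/-! ### Integrals with respect to the marked Poisson measure. -/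

section Poisson

variable {X M : Type*} [TopologicalSpace X] [T2Space X] [SecondCountableTopology X]
  [MeasurableSpace X] [BorelSpace X] [MeasurableSpace M]
  {σ : Measure (X × M)} {μ : Measure (Configuration X M)}

lemma isFiniteMeasure_restrict (hσ : ∀ K : Set X, IsCompact K → σ (K ×ˢ Set.univ) < ⊤) {Λ : Set X}
    (hΛ : IsCompact (closure Λ)) : IsFiniteMeasure (σ.restrict (Λ ×ˢ (Set.univ : Set M))) :=
  ⟨by
    rw [Measure.restrict_apply_univ]
    exact (measure_mono (Set.prod_mono_left subset_closure)).trans_lt (hσ _ hΛ)⟩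

lemma restrict_fiber (hσ₀ : ∀ x : X, σ ({x} ×ˢ Set.univ) = 0) (Λ : Set X) (x : X) :
    σ.restrict (Λ ×ˢ (Set.univ : Set M)) ({x} ×ˢ Set.univ) = 0 :=
  nonpos_iff_eq_zero.1 ((Measure.restrict_apply_le _ _).trans (hσ₀ x).le)

lemma IsMarkedPoisson.lintegral_eq (hμ : IsMarkedPoisson σ μ)
    (hσ : ∀ K : Set X, IsCompact K → σ (K ×ˢ Set.univ) < ⊤)
    (hσ₀ : ∀ x : X, σ ({x} ×ˢ Set.univ) = 0) {Λ : Set X} (hΛ : IsOpen Λ)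
    (hΛc : IsCompact (closure Λ)) {H : Configuration X M → ENNReal} (hH : Measurable H)
    (hHΛ : ∀ ξ, H (restrictTo Λ ξ) = H ξ) :
    ∫⁻ ξ, H ξ ∂μ = ENNReal.ofReal (Real.exp (-(σ (Λ ×ˢ Set.univ)).toReal)) *
      ∑' n : ℕ, ((n.factorial : ENNReal)⁻¹) * ∫⁻ z, H (ofTuple n z)
        ∂(Measure.pi fun _ : Fin n => σ.restrict (Λ ×ˢ (Set.univ : Set M))) := by
  have := isFiniteMeasure_restrict hσ hΛc
  have h1 : ∫⁻ ξ, H ξ ∂μ = ∫⁻ ξ, H ξ ∂(μ.map (restrictTo Λ)) := by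
    rw [lintegral_map hH (measurable_restrictTo hΛ.measurableSet)]
    simp only [hHΛ]
  rw [h1, hμ.map_restrictTo Λ hΛ hΛc, localPoisson, lintegral_smul_measure, lintegral_sum_measure,
    smul_eq_mul]
  congr 2
  funext n
  rw [lintegral_smul_measure, smul_eq_mul, lintegral_map' hH.aemeasurable
    (aemeasurable_ofTuple (restrict_fiber hσ₀ Λ) n)]

/-- For an integrable functional that depends only on the points over Λ, the integral is a series
over the numbers of points; it vanishes if it does so on every n-point sector. -/
lemma IsMarkedPoisson.integral_eq_zero (hμ : IsMarkedPoisson σ μ)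
    (hσ : ∀ K : Set X, IsCompact K → σ (K ×ˢ Set.univ) < ⊤)
    (hσ₀ : ∀ x : X, σ ({x} ×ˢ Set.univ) = 0) {Λ : Set X} (hΛ : IsOpen Λ)
    (hΛc : IsCompact (closure Λ)) {H : Configuration X M → ℝ} (hH : Measurable H)
    (hHi : Integrable H μ) (hHΛ : ∀ ξ, H (restrictTo Λ ξ) = H ξ)
    (h0 : ∀ n, ∫ z, H (ofTuple n z)
        ∂(Measure.pi fun _ : Fin n => σ.restrict (Λ ×ˢ (Set.univ : Set M))) = 0) :
    ∫ ξ, H ξ ∂μ = 0 := by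
  have := isFiniteMeasure_restrict hσ hΛc
  have hm := measurable_restrictTo (M := M) hΛ.measurableSet
  have h1 : ∫ ξ, H ξ ∂μ = ∫ ξ, H ξ ∂(μ.map (restrictTo Λ)) := by
    rw [integral_map hm.aemeasurable hH.aestronglyMeasurable]
    simp only [hHΛ]
  have h2 : Integrable H (μ.map (restrictTo Λ)) := by
    rw [integrable_map_measure hH.aestronglyMeasurable hm.aemeasurable]
    exact hHi.congr (ae_of_all _ fun ξ => (hHΛ ξ).symm)
  rw [h1]
  rw [hμ.map_restrictTo Λ hΛ hΛc, localPoisson] at h2 ⊢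
  rw [integrable_smul_measure (by simp [Real.exp_pos]) (by simp)] at h2
  rw [integral_smul_measure, integral_sum_measure h2]
  have : ∀ n : ℕ, ∫ ξ, H ξ ∂(((n.factorial : ENNReal)⁻¹) • Measure.map (ofTuple n)
      (Measure.pi (fun _ : Fin n => σ.restrict (Λ ×ˢ (Set.univ : Set M))))) = 0 := fun n => by
    rw [integral_smul_measure, integral_map (aemeasurable_ofTuple (restrict_fiber hσ₀ Λ) n)
      hH.aestronglyMeasurable, h0 n, smul_zero]
  simp only [this, tsum_zero, smul_zero]

/-- The n - 1 other coordinates contribute powers of the total mass. Adding one to the mass allows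
the exponent n and avoids a distinction between small and large mass. -/
lemma lintegral_pi_eval {Z : Type*} [MeasurableSpace Z] {θ : Measure Z} [IsFiniteMeasure θ] {n : ℕ}
    (i : Fin n) {f : Z → ENNReal} (hf : Measurable f) :
    ∫⁻ z, f (z i) ∂(Measure.pi fun _ : Fin n => θ) ≤ (θ Set.univ + 1) ^ n * ∫⁻ w, f w ∂θ := by
  have he : Measurable (Function.eval i : (Fin n → Z) → Z) := measurable_pi_apply i
  have h : ∫⁻ z, f (z i) ∂(Measure.pi fun _ : Fin n => θ) =
      ∫⁻ w, f w ∂(Measure.map (Function.eval i) (Measure.pi fun _ : Fin n => θ)) :=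
    (lintegral_map hf he).symm
  have h2 := Measure.pi_map_eval (μ := fun _ : Fin n => θ) i
  rw [h, h2, lintegral_smul_measure, smul_eq_mul, Finset.prod_const]
  refine mul_le_mul_left ?_ _
  refine (pow_le_pow_left' (le_self_add : θ Set.univ ≤ θ Set.univ + 1) _).trans
    (pow_le_pow_right₀ (le_add_self : 1 ≤ θ Set.univ + 1) ?_)
  exact (Finset.card_le_univ _).trans (by simp)

/-- A form of Campbell's formula. -/
lemma IsMarkedPoisson.exists_lintegral_pairing_le (hμ : IsMarkedPoisson σ μ)
    (hσ : ∀ K : Set X, IsCompact K → σ (K ×ˢ Set.univ) < ⊤)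
    (hσ₀ : ∀ x : X, σ ({x} ×ˢ Set.univ) = 0) {Λ : Set X} (hΛ : IsOpen Λ)
    (hΛc : IsCompact (closure Λ)) : ∃ C : ENNReal, C ≠ ⊤ ∧ ∀ f : X × M → ℝ, Measurable f →
      (∀ z, 0 ≤ f z) → (∀ z : X × M, z.1 ∉ Λ → f z = 0) →
      ∫⁻ ξ, ENNReal.ofReal (pairing f ξ) ∂μ ≤ C * ∫⁻ z, ENNReal.ofReal (f z) ∂σ := by
  have := isFiniteMeasure_restrict hσ hΛc
  set θ := σ.restrict (Λ ×ˢ (Set.univ : Set M)) with hθ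
  -- The sharp constant is one. A cruder one suffices: the factor n from summing over the points is
  -- bounded by 2ⁿ and absorbed into the exponential series.
  refine ⟨ENNReal.ofReal (Real.exp (-(σ (Λ ×ˢ Set.univ)).toReal)) *
    ∑' n : ℕ, ((n.factorial : ENNReal)⁻¹) * (2 * (θ Set.univ + 1)) ^ n, ?_, ?_⟩
  · refine ENNReal.mul_ne_top ENNReal.ofReal_ne_top (tsum_inv_factorial_mul_pow_lt_top ?_).ne
    exact ENNReal.mul_ne_top (by simp) (ENNReal.add_ne_top.2 ⟨measure_ne_top θ _, by simp⟩)
  intro f hf hf0 hfΛ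
  have hfΛ' : ∀ z : X × M, z.1 ∉ closure Λ → f z = 0 := fun z hz =>
    hfΛ z fun h => hz (subset_closure h)
  rw [hμ.lintegral_eq hσ hσ₀ hΛ hΛc (measurable_pairing hf hΛc hfΛ').ennreal_ofReal
    fun ξ => by rw [pairing_restrictTo hfΛ], mul_assoc, ← ENNReal.tsum_mul_right]
  refine mul_le_mul_right (ENNReal.tsum_le_tsum fun n => ?_) _
  rw [mul_assoc]
  refine mul_le_mul_right ?_ _
  have h1 : ∫⁻ z, ENNReal.ofReal (pairing f (ofTuple n z)) ∂(Measure.pi fun _ : Fin n => θ) =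
      ∑ i, ∫⁻ z, ENNReal.ofReal (f (z i)) ∂(Measure.pi fun _ : Fin n => θ) := by
    rw [← lintegral_finsetSum (f := fun i (z : Fin n → X × M) => ENNReal.ofReal (f (z i))) _
      fun i _ => (hf.comp (measurable_pi_apply i)).ennreal_ofReal]
    refine lintegral_congr_ae ?_
    filter_upwards [ae_mem_distinctTuples (restrict_fiber hσ₀ Λ) n] with z hz
    rw [pairing_ofTuple hz, ENNReal.ofReal_sum_of_nonneg fun i _ => hf0 _]
  rw [h1]
  refine (Finset.sum_le_sum fun i _ => lintegral_pi_eval i hf.ennreal_ofReal).trans ?_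
  rw [Finset.sum_const, Finset.card_univ, Fintype.card_fin, nsmul_eq_mul, mul_pow, mul_assoc]
  gcongr
  · exact_mod_cast Nat.lt_two_pow_self.le
  · exact Measure.restrict_le_self

/-- The squared number of points is at most (2ⁿ)² = 4ⁿ on the n-point sector, which the factorials
absorb. This second moment is what puts the derivatives of cylinder functions into L². -/
lemma IsMarkedPoisson.lintegral_card_sq_lt_top (hμ : IsMarkedPoisson σ μ)
    (hσ : ∀ K : Set X, IsCompact K → σ (K ×ˢ Set.univ) < ⊤)
    (hσ₀ : ∀ x : X, σ ({x} ×ˢ Set.univ) = 0) {Λ : Set X} (hΛ : IsOpen Λ)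
    (hΛc : IsCompact (closure Λ)) :
    ∫⁻ ξ, ENNReal.ofReal (pairing ((Λ ×ˢ (Set.univ : Set M)).indicator 1) ξ ^ 2) ∂μ < ⊤ := by
  have := isFiniteMeasure_restrict hσ hΛc
  set θ := σ.restrict (Λ ×ˢ (Set.univ : Set M)) with hθ
  have hm : MeasurableSet (Λ ×ˢ (Set.univ : Set M)) := hΛ.measurableSet.prod MeasurableSet.univ
  have hf : Measurable ((Λ ×ˢ (Set.univ : Set M)).indicator (1 : X × M → ℝ)) :=
    measurable_one.indicator hm
  have hfΛ : ∀ z : X × M, z.1 ∉ Λ → (Λ ×ˢ (Set.univ : Set M)).indicator (1 : X × M → ℝ) z = 0 :=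
    fun z hz => Set.indicator_of_notMem (fun h => hz h.1) _
  have hfΛ' : ∀ z : X × M, z.1 ∉ closure Λ →
      (Λ ×ˢ (Set.univ : Set M)).indicator (1 : X × M → ℝ) z = 0 := fun z hz =>
    hfΛ z fun h => hz (subset_closure h)
  rw [hμ.lintegral_eq hσ hσ₀ hΛ hΛc
    ((measurable_pairing hf hΛc hfΛ').pow_const 2).ennreal_ofReal
    fun ξ => by rw [pairing_restrictTo hfΛ]]
  refine ENNReal.mul_lt_top ENNReal.ofReal_lt_top ?_
  have hc : 4 * θ Set.univ ≠ ⊤ := ENNReal.mul_ne_top (by simp) (measure_ne_top θ _)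
  refine (ENNReal.tsum_le_tsum fun n => ?_).trans_lt (tsum_inv_factorial_mul_pow_lt_top hc)
  refine mul_le_mul_right ?_ _
  have h1 : ∀ z ∈ distinctTuples X M n,
      ENNReal.ofReal (pairing ((Λ ×ˢ (Set.univ : Set M)).indicator 1) (ofTuple n z) ^ 2) ≤
        (4 : ENNReal) ^ n := fun z hz => by
    rw [pairing_ofTuple hz]
    have h2 : ∑ i, (Λ ×ˢ (Set.univ : Set M)).indicator (1 : X × M → ℝ) (z i) ≤ n := by
      refine (Finset.sum_le_sum fun i _ => Set.indicator_le_self' (fun _ _ => zero_le_one) _).trans ?_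
      simp
    have h3 : 0 ≤ ∑ i, (Λ ×ˢ (Set.univ : Set M)).indicator (1 : X × M → ℝ) (z i) :=
      Finset.sum_nonneg fun i _ => Set.indicator_nonneg (fun _ _ => zero_le_one) _
    have h4 : (n : ℝ) ≤ 2 ^ n := by exact_mod_cast Nat.lt_two_pow_self.le
    calc _ ≤ ENNReal.ofReal ((2 ^ n) ^ 2) :=
          ENNReal.ofReal_le_ofReal (pow_le_pow_left₀ h3 (h2.trans h4) 2)
      _ = _ := by
          rw [← pow_mul, mul_comm, pow_mul, ENNReal.ofReal_pow (by norm_num)]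
          norm_num
  calc _ ≤ ∫⁻ _, (4 : ENNReal) ^ n ∂(Measure.pi fun _ : Fin n => θ) := by
        refine lintegral_mono_ae ?_
        filter_upwards [ae_mem_distinctTuples (restrict_fiber hσ₀ Λ) n] with z hz
        exact h1 z hz
    _ = _ := by
        rw [lintegral_const, Measure.pi_univ, Finset.prod_const, Finset.card_univ,
          Fintype.card_fin, mul_pow]

/-- By the Campbell bound for an indicator, almost surely no point falls into a given null set lying
over a compact set. The lemma allows an almost everywhere measurable logarithmic derivative to be
replaced by a measurable one. -/
lemma IsMarkedPoisson.pairing_congr_ae [LocallyCompactSpace X] (hμ : IsMarkedPoisson σ μ)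
    (hσ : ∀ K : Set X, IsCompact K → σ (K ×ˢ Set.univ) < ⊤)
    (hσ₀ : ∀ x : X, σ ({x} ×ˢ Set.univ) = 0) {K : Set X} (hK : IsCompact K) {f g : X × M → ℝ}
    (hf : ∀ z : X × M, z.1 ∉ K → f z = 0) (hg : ∀ z : X × M, z.1 ∉ K → g z = 0)
    (hfg : f =ᵐ[σ] g) : pairing f =ᵐ[μ] pairing g := by
  obtain ⟨Λ, hΛ, hKΛ, hΛc⟩ := exists_isOpen_superset_and_isCompact_closure hK
  obtain ⟨C, hC, hCb⟩ := hμ.exists_lintegral_pairing_le hσ hσ₀ hΛ hΛc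
  obtain ⟨N, hN, hNm, hN0⟩ := exists_measurable_superset_of_null (ae_iff.1 hfg)
  have hKm : MeasurableSet (K ×ˢ (Set.univ : Set M)) := hK.measurableSet.prod MeasurableSet.univ
  set B := N ∩ K ×ˢ (Set.univ : Set M) with hB
  have hBK : B ⊆ K ×ˢ Set.univ := Set.inter_subset_right
  have hBm : MeasurableSet B := hNm.inter hKm
  have hB0 : σ B = 0 := measure_mono_null Set.inter_subset_left hN0
  have hi : Measurable (B.indicator (1 : X × M → ℝ)) := measurable_one.indicator hBm
  have h1 := hCb (B.indicator 1) hi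
    (fun z => Set.indicator_nonneg (fun _ _ => zero_le_one) _)
    fun z hz => Set.indicator_of_notMem (fun h => hz (hKΛ (hBK h).1)) _
  have h2 : ∫⁻ z, ENNReal.ofReal (B.indicator 1 z) ∂σ = 0 := by
    rw [lintegral_eq_zero_iff hi.ennreal_ofReal]
    have : ∀ᵐ z ∂σ, z ∉ B := measure_eq_zero_iff_ae_notMem.1 hB0
    filter_upwards [this] with z hz
    simp [hz]
  rw [h2, mul_zero, nonpos_iff_eq_zero, lintegral_eq_zero_iff] at h1
  · filter_upwards [h1] with ξ hξ
    rw [pairing_indicator_one hK hBK] at hξ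
    have h3 : (ξ.1 ∩ B).ncard = 0 := by simpa using hξ
    rw [Set.ncard_eq_zero ((ξ.2.finite_inter hK).subset (Set.inter_subset_inter_right _ hBK))] at h3
    rw [pairing_eq_sum hK hf, pairing_eq_sum hK hg]
    refine Finset.sum_congr rfl fun z hz => ?_
    by_contra hne
    have hz' := (Set.Finite.mem_toFinset _).1 hz
    exact (Set.eq_empty_iff_forall_notMem.1 h3) z ⟨hz'.1, hN hne, hz'.2⟩
  · exact (measurable_pairing hi hK fun z hz =>
      Set.indicator_of_notMem (fun h => hz (hBK h).1) _).ennreal_ofReal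

end Poisson

/-! ### Derivatives of cylinder functions. -/

section Cylinder

variable {d e k : ℕ} {X M G : Type*}
  [TopologicalSpace X] [T2Space X]
  [ChartedSpace (EuclideanSpace ℝ (Fin d)) X] [IsManifold (𝓡 d) ∞ X]
  [TopologicalSpace M] [ChartedSpace (EuclideanSpace ℝ (Fin e)) M] [IsManifold (𝓡 e) ∞ M]
  [TopologicalSpace G] [T2Space G]
  [ChartedSpace (EuclideanSpace ℝ (Fin k)) G] [Group G] [LieGroup (𝓡 k) ∞ G] [MulAction G M]

lemma act_injOn (a : CurrentAlgebra d k X G) (t : ℝ) (ξ : Configuration X M) :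
    Set.InjOn (act a t) ξ.1 := fun z hz z' hz' h =>
  ξ.2.injOn hz hz' (a.flow_injective t (congrArg Prod.fst h))

/-- The flow is injective, which keeps positions distinct. It fixes every point outside `K`, so a
position that lands in L comes from the compact set L ∪ K, which keeps the positions locally finite.
-/
lemma isConfiguration_act_image (a : CurrentAlgebra d k X G) (t : ℝ) (ξ : Configuration X M) :
    IsConfiguration (act a t '' ξ.1) := by
  obtain ⟨K, hK, hKa⟩ := a.compact_support
  constructor
  · rintro _ ⟨z, hz, rfl⟩ _ ⟨z', hz', rfl⟩ hne h
    refine hne (congrArg (act a t) (ξ.2.injOn hz hz' (a.flow_injective t h)))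
  · intro L hL
    refine ((ξ.2.2 (L ∪ K) (hL.union hK)).image (flow a.v t)).subset ?_
    rintro _ ⟨⟨_, ⟨z, hz, rfl⟩, rfl⟩, hzL⟩
    refine ⟨z.1, ⟨⟨z, hz, rfl⟩, ?_⟩, rfl⟩
    by_cases h : z.1 ∈ K
    · exact Or.inr h
    · left
      have : flow a.v t z.1 = z.1 := a.flow_eq_self (hKa _ h).1 t
      have h2 : flow a.v t z.1 ∈ L := hzL
      rwa [this] at h2

lemma actOmega_coe (a : CurrentAlgebra d k X G) (t : ℝ) (ξ : Configuration X M) :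
    (actOmega a t ξ).1 = act a t '' ξ.1 :=
  toConfiguration_coe (isConfiguration_act_image a t ξ)

lemma actOmega_zero (a : CurrentAlgebra d k X G) (ξ : Configuration X M) : actOmega a 0 ξ = ξ := by
  refine Subtype.ext ?_
  rw [actOmega_coe]
  have : (act a 0 : X × M → X × M) = id := funext fun z => act_zero a z
  rw [this, Set.image_id]

lemma gradXM_eq_zero_of_notMem
    (hsmooth : ContMDiff ((𝓡 k).prod (𝓡 e)) (𝓡 e) ∞ (fun y : G × M => y.1 • y.2))
    (a : CurrentAlgebra d k X G) {φ : X × M → ℝ}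
    (hφ : ContMDiff ((𝓡 d).prod (𝓡 e)) 𝓘(ℝ, ℝ) ∞ φ) {K : Set X} (hK : IsCompact K)
    (hφK : ∀ z : X × M, z.1 ∉ K → φ z = 0) {z : X × M} (hz : z.1 ∉ K) : gradXM a φ z = 0 := by
  refine gradXM_eq_zero_of_eventuallyEq hsmooth a (hφ.of_le (by simp)) ?_
  have h : ∀ᶠ w : X × M in 𝓝 z, w.1 ∈ Kᶜ :=
    continuous_fst.continuousAt.preimage_mem_nhds (hK.isClosed.isOpen_compl.mem_nhds hz)
  filter_upwards [h] with w hw using hφK w hw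

/-- At all times the sum runs over the same finitely many points, those over the support of φ or of
the field, so it may be differentiated term by term. -/
lemma hasDerivAt_pairing_actOmega
    (hsmooth : ContMDiff ((𝓡 k).prod (𝓡 e)) (𝓡 e) ∞ (fun y : G × M => y.1 • y.2))
    (a : CurrentAlgebra d k X G) {φ : X × M → ℝ}
    (hφ : ContMDiff ((𝓡 d).prod (𝓡 e)) 𝓘(ℝ, ℝ) ∞ φ) {K : Set X} (hK : IsCompact K)
    (hφK : ∀ z : X × M, z.1 ∉ K → φ z = 0) (ξ : Configuration X M) :
    HasDerivAt (fun t => pairing φ (actOmega a t ξ)) (pairing (gradXM a φ) ξ) 0 := by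
  obtain ⟨L, hL, hLa⟩ := a.compact_support
  have h1 : (fun t => pairing φ (actOmega a t ξ)) =
      fun t => ∑ z ∈ (ξ.2.finite_inter (hK.union hL)).toFinset, φ (act a t z) := by
    funext t
    rw [pairing, actOmega_coe, finsum_mem_image (act_injOn a t ξ)]
    refine pairing_eq_sum (f := fun z => φ (act a t z)) (hK.union hL) (fun z hz => ?_) ξ
    refine hφK _ ?_
    have : flow a.v t z.1 = z.1 := a.flow_eq_self (hLa _ fun h => hz (Or.inr h)).1 t
    change flow a.v t z.1 ∉ K
    rw [this]
    exact fun h => hz (Or.inl h)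
  rw [h1, pairing_eq_sum (hK.union hL) fun z hz =>
    gradXM_eq_zero_of_notMem hsmooth a hφ hK hφK fun h => hz (Or.inl h)]
  exact HasDerivAt.fun_sum fun z _ => hasDerivAt_act hsmooth a (hφ.of_le (by simp)) z

lemma exists_compact_support {ι : Type*} [Fintype ι] {φ : ι → X × M → ℝ}
    (hφ : ∀ i, IsTest d e k G (φ i)) :
    ∃ K : Set X, IsCompact K ∧ ∀ i, ∀ z : X × M, z.1 ∉ K → φ i z = 0 := by
  choose K hK hφK using fun i => (hφ i).support
  exact ⟨⋃ i, K i, isCompact_iUnion hK, fun i z hz =>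
    hφK i z fun h => hz (Set.mem_iUnion.2 ⟨i, h⟩)⟩

lemma exists_bound_gradXM {ι : Type*} [Fintype ι] {φ : ι → X × M → ℝ}
    (hφ : ∀ i, IsTest d e k G (φ i)) (a : CurrentAlgebra d k X G) :
    ∃ C : ℝ, 0 ≤ C ∧ ∀ i z, |gradXM a (φ i) z| ≤ C := by
  choose C hC using fun i => (hφ i).bounded [a]
  refine ⟨∑ i, |C i|, Finset.sum_nonneg fun i _ => abs_nonneg _, fun i z => ?_⟩
  refine ((hC i z).trans (le_abs_self _)).trans ?_
  exact Finset.single_le_sum (f := fun i => |C i|) (fun i _ => abs_nonneg _) (Finset.mem_univ i)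

lemma hasDerivAt_cylinder
    (hsmooth : ContMDiff ((𝓡 k).prod (𝓡 e)) (𝓡 e) ∞ (fun y : G × M => y.1 • y.2))
    (a : CurrentAlgebra d k X G) {ι : Type*} [Fintype ι] {φ : ι → X × M → ℝ}
    (hφ : ∀ i, IsTest d e k G (φ i)) {g : (ι → ℝ) → ℝ} (hg : ContDiff ℝ ∞ g)
    (ξ : Configuration X M) :
    HasDerivAt (fun t => g fun i => pairing (φ i) (actOmega a t ξ))
      (fderiv ℝ g (fun i => pairing (φ i) ξ) fun i => pairing (gradXM a (φ i)) ξ) 0 := by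
  obtain ⟨K, hK, hφK⟩ := exists_compact_support hφ
  have h1 : HasDerivAt (fun t i => pairing (φ i) (actOmega a t ξ))
      (fun i => pairing (gradXM a (φ i)) ξ) 0 :=
    hasDerivAt_pi.2 fun i => hasDerivAt_pairing_actOmega hsmooth a (hφ i).smooth hK (hφK i) ξ
  have h2 : HasFDerivAt g (fderiv ℝ g fun i => pairing (φ i) (actOmega a 0 ξ))
      fun i => pairing (φ i) (actOmega a 0 ξ) := (hg.differentiable (by simp) _).hasFDerivAt
  have h3 := h2.comp_hasDerivAt (0 : ℝ) h1
  rw [actOmega_zero] at h3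
  exact h3

lemma gradOmega_cylinder
    (hsmooth : ContMDiff ((𝓡 k).prod (𝓡 e)) (𝓡 e) ∞ (fun y : G × M => y.1 • y.2))
    (a : CurrentAlgebra d k X G) {ι : Type*} [Fintype ι] {φ : ι → X × M → ℝ}
    (hφ : ∀ i, IsTest d e k G (φ i)) {g : (ι → ℝ) → ℝ} (hg : ContDiff ℝ ∞ g)
    (ξ : Configuration X M) :
    gradOmega a (fun ξ => g fun i => pairing (φ i) ξ) ξ =
      fderiv ℝ g (fun i => pairing (φ i) ξ) fun i => pairing (gradXM a (φ i)) ξ :=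
  (hasDerivAt_cylinder hsmooth a hφ hg ξ).deriv

variable [SecondCountableTopology X] [MeasurableSpace X] [BorelSpace X]
  [SecondCountableTopology M] [MeasurableSpace M] [BorelSpace M]

lemma measurable_cylinder_arg {ι : Type*} [Fintype ι] {φ : ι → X × M → ℝ}
    (hφ : ∀ i, IsTest d e k G (φ i)) :
    Measurable fun (ξ : Configuration X M) i => pairing (φ i) ξ := by
  refine measurable_pi_iff.2 fun i => ?_
  obtain ⟨K, hK, hφK⟩ := (hφ i).support
  exact measurable_pairing (hφ i).smooth.continuous.measurable hK hφK

lemma measurable_gradOmega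
    (hsmooth : ContMDiff ((𝓡 k).prod (𝓡 e)) (𝓡 e) ∞ (fun y : G × M => y.1 • y.2))
    (a : CurrentAlgebra d k X G) {ι : Type*} [Fintype ι] {φ : ι → X × M → ℝ}
    (hφ : ∀ i, IsTest d e k G (φ i)) {g : (ι → ℝ) → ℝ} (hg : ContDiff ℝ ∞ g) :
    Measurable (gradOmega a fun ξ : Configuration X M => g fun i => pairing (φ i) ξ) := by
  have h : (gradOmega a fun ξ : Configuration X M => g fun i => pairing (φ i) ξ) = fun ξ =>
      fderiv ℝ g (fun i => pairing (φ i) ξ) fun i => pairing (gradXM a (φ i)) ξ :=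
    funext fun ξ => gradOmega_cylinder hsmooth a hφ hg ξ
  rw [h]
  obtain ⟨K, hK, hφK⟩ := exists_compact_support hφ
  have h1 : Measurable fun (ξ : Configuration X M) i => pairing (gradXM a (φ i)) ξ :=
    measurable_pi_iff.2 fun i => measurable_pairing
      (contMDiff_gradXM hsmooth a (hφ i).smooth).continuous.measurable hK
      fun z hz => gradXM_eq_zero_of_notMem hsmooth a (hφ i).smooth hK (hφK i) hz
  have h2 : Continuous fun y : (ι → ℝ) × (ι → ℝ) => fderiv ℝ g y.1 y.2 :=
    ((hg.continuous_fderiv (by simp)).comp continuous_fst).clm_apply continuous_snd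
  exact h2.measurable.comp ((measurable_cylinder_arg hφ).prodMk h1)

/-- The directional derivative of a cylinder function is bounded by a multiple of the number of
points in a bounded set. -/
lemma exists_abs_gradOmega_le
    (hsmooth : ContMDiff ((𝓡 k).prod (𝓡 e)) (𝓡 e) ∞ (fun y : G × M => y.1 • y.2))
    (a : CurrentAlgebra d k X G) {ι : Type*} [Fintype ι] {φ : ι → X × M → ℝ}
    (hφ : ∀ i, IsTest d e k G (φ i)) {g : (ι → ℝ) → ℝ} (hg : ContDiff ℝ ∞ g) {C : ℝ}
    (hC : ∀ r, ‖fderiv ℝ g r‖ ≤ C) {Λ : Set X} (hΛc : IsCompact (closure Λ))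
    (hφΛ : ∀ i, ∀ z : X × M, z.1 ∉ Λ → gradXM a (φ i) z = 0) :
    ∃ C' : ℝ, 0 ≤ C' ∧ ∀ ξ : Configuration X M,
      |gradOmega a (fun ξ => g fun i => pairing (φ i) ξ) ξ| ≤
        C' * pairing ((Λ ×ˢ (Set.univ : Set M)).indicator 1) ξ := by
  obtain ⟨c, hc, hcφ⟩ := exists_bound_gradXM hφ a
  have hC0 : 0 ≤ C := (norm_nonneg _).trans (hC 0)
  refine ⟨C * c, mul_nonneg hC0 hc, fun ξ => ?_⟩
  rw [gradOmega_cylinder hsmooth a hφ hg]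
  refine ((fderiv ℝ g fun i => pairing (φ i) ξ).le_opNorm _).trans ?_
  rw [mul_assoc]
  have h0 : ∀ z : X × M, z.1 ∉ closure Λ → (Λ ×ˢ (Set.univ : Set M)).indicator (1 : X × M → ℝ) z = 0 :=
    fun z hz => Set.indicator_of_notMem (fun h => hz (subset_closure h.1)) _
  have hN : 0 ≤ pairing ((Λ ×ˢ (Set.univ : Set M)).indicator 1) ξ := by
    rw [pairing_eq_sum hΛc h0]
    exact Finset.sum_nonneg fun z _ => Set.indicator_nonneg (fun _ _ => zero_le_one) _
  refine mul_le_mul (hC _) ?_ (norm_nonneg _) hC0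
  refine (pi_norm_le_iff_of_nonneg (mul_nonneg hc hN)).2 fun i => ?_
  have h1 : c * pairing ((Λ ×ˢ (Set.univ : Set M)).indicator 1) ξ =
      pairing (fun z => c * (Λ ×ˢ (Set.univ : Set M)).indicator 1 z) ξ := by
    rw [pairing_eq_sum hΛc h0, pairing_eq_sum hΛc fun z hz => by rw [h0 z hz, mul_zero],
      Finset.mul_sum]
  rw [h1, Real.norm_eq_abs]
  refine abs_pairing_le hΛc (fun z hz => hφΛ i z fun h => hz (subset_closure h))
    (fun z hz => by rw [h0 z hz, mul_zero]) (fun z => ?_) ξ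
  by_cases hz : z.1 ∈ Λ
  · rw [Set.indicator_of_mem (show z ∈ Λ ×ˢ (Set.univ : Set M) from ⟨hz, trivial⟩)]
    simpa using hcφ i z
  · rw [hφΛ i z hz, abs_zero]
    exact mul_nonneg hc (Set.indicator_nonneg (fun _ _ => zero_le_one) _)

/-- The derivative is at most a constant times the number of points in a bounded set. An arbitrary
finite index type and a bound on the first differential suffice, which permits index types other
than `Fin N`. -/
lemma memLp_gradOmega [LocallyCompactSpace X] {σ : Measure (X × M)} {μ : Measure (Configuration X M)}
    (hμ : IsMarkedPoisson σ μ) (hσ : ∀ K : Set X, IsCompact K → σ (K ×ˢ Set.univ) < ⊤)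
    (hσ₀ : ∀ x : X, σ ({x} ×ˢ Set.univ) = 0)
    (hsmooth : ContMDiff ((𝓡 k).prod (𝓡 e)) (𝓡 e) ∞ (fun y : G × M => y.1 • y.2))
    (a : CurrentAlgebra d k X G) {ι : Type*} [Fintype ι] {φ : ι → X × M → ℝ}
    (hφ : ∀ i, IsTest d e k G (φ i)) {g : (ι → ℝ) → ℝ} (hg : ContDiff ℝ ∞ g) {C : ℝ}
    (hC : ∀ r, ‖fderiv ℝ g r‖ ≤ C) :
    MemLp (gradOmega a fun ξ => g fun i => pairing (φ i) ξ) 2 μ := by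
  obtain ⟨K, hK, hφK⟩ := exists_compact_support hφ
  obtain ⟨Λ, hΛ, hKΛ, hΛc⟩ := exists_isOpen_superset_and_isCompact_closure hK
  obtain ⟨C', hC', hb⟩ := exists_abs_gradOmega_le hsmooth a hφ hg hC hΛc fun i z hz =>
    gradXM_eq_zero_of_notMem hsmooth a (hφ i).smooth hK (hφK i) fun h => hz (hKΛ h)
  have hm := measurable_gradOmega hsmooth a hφ hg
  have hN : MemLp (pairing ((Λ ×ˢ (Set.univ : Set M)).indicator 1)) 2 μ := by
    refine memLp_two_of_lintegral_sq ?_ (hμ.lintegral_card_sq_lt_top hσ hσ₀ hΛ hΛc)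
    refine (measurable_pairing (measurable_one.indicator (hΛ.measurableSet.prod MeasurableSet.univ))
      hΛc fun z hz => Set.indicator_of_notMem (fun h => hz (subset_closure h.1)) _).aestronglyMeasurable
  refine (hN.const_mul C').mono hm.aestronglyMeasurable (ae_of_all _ fun ξ => ?_)
  exact (hb ξ).trans (le_abs_self _)

end Cylinder

/-! ### From the one-point formula to configurations. -/

section Cylinder

variable {d e k : ℕ} {X M G : Type*}
  [TopologicalSpace X] [T2Space X]
  [ChartedSpace (EuclideanSpace ℝ (Fin d)) X] [IsManifold (𝓡 d) ∞ X]
  [TopologicalSpace M] [ChartedSpace (EuclideanSpace ℝ (Fin e)) M] [IsManifold (𝓡 e) ∞ M]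
  [TopologicalSpace G] [T2Space G]
  [ChartedSpace (EuclideanSpace ℝ (Fin k)) G] [Group G] [LieGroup (𝓡 k) ∞ G] [MulAction G M]
  [SecondCountableTopology X] [MeasurableSpace X] [BorelSpace X]
  [SecondCountableTopology M] [MeasurableSpace M] [BorelSpace M]

variable (e) in
/-- `β` is a logarithmic derivative of `σ` along `a`. -/
structure IsLogDerivative (σ : Measure (X × M)) (a : CurrentAlgebra d k X G) (β : X × M → ℝ) :
    Prop where
  integrable : Integrable β σ
  support : ∃ K : Set X, IsCompact K ∧ ∀ z : X × M, z.1 ∉ K → β z = 0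
  integral_eq_zero : ∀ (f : X × M → ℝ) (C : ℝ), ContMDiff ((𝓡 d).prod (𝓡 e)) 𝓘(ℝ, ℝ) ∞ f →
    (∀ z, |f z| ≤ C) → (∀ z, |gradXM a.vPart f z| ≤ C) → (∀ z, |gradXM a.uPart f z| ≤ C) →
    ∫ z, (gradXM a f z + f z * β z) ∂σ = 0

variable {σ : Measure (X × M)} {a : CurrentAlgebra d k X G} {β : X × M → ℝ}

lemma IsLogDerivative.congr_ae {β' : X × M → ℝ} (h : IsLogDerivative e σ a β) (hβ : β =ᵐ[σ] β')
    (hs : ∃ K : Set X, IsCompact K ∧ ∀ z : X × M, z.1 ∉ K → β' z = 0) :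
    IsLogDerivative e σ a β' where
  integrable := h.integrable.congr hβ
  support := hs
  integral_eq_zero f C hf h1 h2 h3 := by
    rw [← h.integral_eq_zero f C hf h1 h2 h3]
    refine integral_congr_ae ?_
    filter_upwards [hβ] with z hz
    rw [hz]

lemma fderiv_comp_translate {ι : Type*} [Fintype ι] {g : (ι → ℝ) → ℝ} (hg : ContDiff ℝ ∞ g)
    (c r : ι → ℝ) : fderiv ℝ (fun r => g (r + c)) r = fderiv ℝ g (r + c) :=
  fderiv_comp_add_right c

/-- The one-point formula for f(z) = g(φ(z) + c), where the vector `c` stands for the contribution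
of all other points. -/
lemma IsLogDerivative.integral_translate (h : IsLogDerivative e σ a β)
    (hsmooth : ContMDiff ((𝓡 k).prod (𝓡 e)) (𝓡 e) ∞ (fun y : G × M => y.1 • y.2))
    {ι : Type*} [Fintype ι] {φ : ι → X × M → ℝ}
    (hφ : ∀ i, IsTest d e k G (φ i)) {g : (ι → ℝ) → ℝ} (hg : ContDiff ℝ ∞ g) {C : ℝ}
    (hgC : ∀ r, |g r| ≤ C) (hC : ∀ r, ‖fderiv ℝ g r‖ ≤ C) (c : ι → ℝ) :
    ∫ z, (fderiv ℝ g ((fun i => φ i z) + c) (fun i => gradXM a (φ i) z) +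
      g ((fun i => φ i z) + c) * β z) ∂σ = 0 := by
  have hC0 : 0 ≤ C := (norm_nonneg _).trans (hC 0)
  obtain ⟨c1, hc1, hb1⟩ := exists_bound_gradXM hφ a.vPart
  obtain ⟨c2, hc2, hb2⟩ := exists_bound_gradXM hφ a.uPart
  have hgc : ContDiff ℝ ∞ fun r => g (r + c) := hg.comp (contDiff_id.add contDiff_const)
  have hgr : ∀ (a' : CurrentAlgebra d k X G) (z : X × M),
      gradXM a' (fun z => g ((fun i => φ i z) + c)) z =
        fderiv ℝ g ((fun i => φ i z) + c) fun i => gradXM a' (φ i) z := fun a' z => by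
    rw [← fderiv_comp_translate hg]
    exact gradXM_comp hsmooth a' (hgc.of_le (by simp)) (fun i => (hφ i).smooth.of_le (by simp)) z
  have hbd : ∀ (a' : CurrentAlgebra d k X G) (c' : ℝ), 0 ≤ c' → (∀ i z, |gradXM a' (φ i) z| ≤ c') →
      ∀ z, |gradXM a' (fun z => g ((fun i => φ i z) + c)) z| ≤ C * c' := by
    intro a' c' hc' hb z
    rw [hgr]
    refine ((fderiv ℝ g ((fun i => φ i z) + c)).le_opNorm _).trans ?_
    exact mul_le_mul (hC _) ((pi_norm_le_iff_of_nonneg hc').2 fun i => hb i z) (norm_nonneg _) hC0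
  have hsm : ContMDiff ((𝓡 d).prod (𝓡 e)) 𝓘(ℝ, ℝ) ∞ fun z => g ((fun i => φ i z) + c) :=
    hgc.contMDiff.comp (contMDiff_pi_space.2 fun i => (hφ i).smooth)
  have := h.integral_eq_zero _ (C + C * c1 + C * c2) hsm
    (fun z => (hgC _).trans (by nlinarith [mul_nonneg hC0 hc1, mul_nonneg hC0 hc2]))
    (fun z => (hbd _ c1 hc1 hb1 z).trans (by nlinarith [mul_nonneg hC0 hc1, mul_nonneg hC0 hc2]))
    (fun z => (hbd _ c2 hc2 hb2 z).trans (by nlinarith [mul_nonneg hC0 hc1, mul_nonneg hC0 hc2]))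
  simpa only [hgr] using this

/-- In the j-th summand only the j-th point is differentiated. Freezing the others and integrating
over that point first gives zero by the one-point formula. -/
lemma IsLogDerivative.integral_tuple (h : IsLogDerivative e σ a β) (hβ : Measurable β)
    (hsmooth : ContMDiff ((𝓡 k).prod (𝓡 e)) (𝓡 e) ∞ (fun y : G × M => y.1 • y.2))
    {ι : Type*} [Fintype ι] {φ : ι → X × M → ℝ}
    (hφ : ∀ i, IsTest d e k G (φ i)) {g : (ι → ℝ) → ℝ} (hg : ContDiff ℝ ∞ g) {C : ℝ}
    (hgC : ∀ r, |g r| ≤ C) (hC : ∀ r, ‖fderiv ℝ g r‖ ≤ C) {Λ : Set X}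
    [IsFiniteMeasure (σ.restrict (Λ ×ˢ (Set.univ : Set M)))]
    (hβΛ : ∀ z : X × M, z.1 ∉ Λ → β z = 0)
    (hφΛ : ∀ i, ∀ z : X × M, z.1 ∉ Λ → gradXM a (φ i) z = 0) (n : ℕ) :
    ∫ z : Fin n → X × M, ∑ j, (fderiv ℝ g (fun i => ∑ l, φ i (z l)) (fun i => gradXM a (φ i) (z j)) +
      g (fun i => ∑ l, φ i (z l)) * β (z j))
      ∂(Measure.pi fun _ : Fin n => σ.restrict (Λ ×ˢ (Set.univ : Set M))) = 0 := by
  set θ := σ.restrict (Λ ×ˢ (Set.univ : Set M)) with hθ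
  have hC0 : 0 ≤ C := (norm_nonneg _).trans (hC 0)
  cases n with
  | zero => simp
  | succ n =>
    obtain ⟨c, hc, hb⟩ := exists_bound_gradXM hφ a
    let Q : (X × M) × (Fin n → X × M) → ℝ := fun y =>
      fderiv ℝ g ((fun i => φ i y.1) + fun i => ∑ l, φ i (y.2 l)) (fun i => gradXM a (φ i) y.1) +
        g ((fun i => φ i y.1) + fun i => ∑ l, φ i (y.2 l)) * β y.1
    have hφm : ∀ i, Measurable (φ i) := fun i => (hφ i).smooth.continuous.measurable
    have harg : Measurable fun y : (X × M) × (Fin n → X × M) =>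
        ((fun i => φ i y.1) + fun i => ∑ l, φ i (y.2 l) : ι → ℝ) := by
      refine measurable_pi_iff.2 fun i => ((hφm i).comp measurable_fst).add ?_
      exact Finset.measurable_sum _ fun l _ =>
        (hφm i).comp ((measurable_pi_apply l).comp measurable_snd)
    have hgr : Measurable fun y : (X × M) × (Fin n → X × M) => (fun i => gradXM a (φ i) y.1 : ι → ℝ) :=
      measurable_pi_iff.2 fun i =>
        (contMDiff_gradXM hsmooth a (hφ i).smooth).continuous.measurable.comp measurable_fst
    have hfd : Continuous fun y : (ι → ℝ) × (ι → ℝ) => fderiv ℝ g y.1 y.2 :=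
      ((hg.continuous_fderiv (by simp)).comp continuous_fst).clm_apply continuous_snd
    have hQm : Measurable Q := (hfd.measurable.comp (harg.prodMk hgr)).add
      ((hg.continuous.measurable.comp harg).mul (hβ.comp measurable_fst))
    have hQi : Integrable Q (θ.prod (Measure.pi fun _ : Fin n => θ)) := by
      have h1 : Integrable (fun w => C * c + C * |β w|) θ :=
        (integrable_const _).add (h.integrable.restrict.abs.const_mul C)
      refine (h1.comp_fst (Measure.pi fun _ : Fin n => θ)).mono' hQm.aestronglyMeasurable
        (ae_of_all _ fun y => ?_)
      refine (norm_add_le _ _).trans (add_le_add ?_ ?_)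
      · refine ((fderiv ℝ g _).le_opNorm _).trans ?_
        exact mul_le_mul (hC _) ((pi_norm_le_iff_of_nonneg hc).2 fun i => hb i y.1)
          (norm_nonneg _) hC0
      · rw [norm_mul]
        exact mul_le_mul_of_nonneg_right (hgC _) (abs_nonneg _)
    have hQ0 : ∫ y, Q y ∂(θ.prod (Measure.pi fun _ : Fin n => θ)) = 0 := by
      rw [integral_prod_symm _ hQi]
      refine (integral_congr_ae (ae_of_all _ fun y => ?_)).trans (integral_zero _ _)
      change ∫ w, Q (w, y) ∂θ = 0
      -- Restricting σ to Λ × M creates no boundary term, because β and the derivatives of the φ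
      -- vanish off Λ.
      rw [hθ, setIntegral_eq_integral_of_forall_compl_eq_zero]
      · exact h.integral_translate hsmooth hφ hg hgC hC fun i => ∑ l, φ i (y l)
      · intro w hw
        have hw' : w.1 ∉ Λ := fun h => hw ⟨h, trivial⟩
        have : (fun i => gradXM a (φ i) w) = 0 := funext fun i => hφΛ i w hw'
        simp only [Q, this, hβΛ w hw', map_zero, mul_zero, add_zero]
    have key : ∀ j : Fin (n + 1), (fun z : Fin (n + 1) → X × M =>
        fderiv ℝ g (fun i => ∑ l, φ i (z l)) (fun i => gradXM a (φ i) (z j)) +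
          g (fun i => ∑ l, φ i (z l)) * β (z j)) =
        Q ∘ (MeasurableEquiv.piFinSuccAbove (fun _ : Fin (n + 1) => X × M) j) := by
      intro j
      funext z
      have h1 : (fun i => ∑ l, φ i (z l)) =
          (fun i => φ i (z j)) + fun i => ∑ l, φ i (z (j.succAbove l)) :=
        funext fun i => Fin.sum_univ_succAbove _ j
      rw [h1]
      rfl
    have hmp := fun j : Fin (n + 1) => measurePreserving_piFinSuccAbove (fun _ : Fin (n + 1) => θ) j
    rw [integral_finsetSum]
    · refine Finset.sum_eq_zero fun j _ => ?_
      rw [key j]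
      exact ((hmp j).integral_comp' Q).trans hQ0
    · intro j _
      rw [key j]
      exact (hmp j).integrable_comp_of_integrable hQi

variable {μ : Measure (Configuration X M)} [LocallyCompactSpace X]

lemma IsMarkedPoisson.integrable_pairing (hμ : IsMarkedPoisson σ μ)
    (hσ : ∀ K : Set X, IsCompact K → σ (K ×ˢ Set.univ) < ⊤)
    (hσ₀ : ∀ x : X, σ ({x} ×ˢ Set.univ) = 0) (hβ : Measurable β) (hi : Integrable β σ)
    (hs : ∃ K : Set X, IsCompact K ∧ ∀ z : X × M, z.1 ∉ K → β z = 0) :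
    Integrable (pairing β) μ := by
  obtain ⟨K, hK, hβK⟩ := hs
  obtain ⟨Λ, hΛ, hKΛ, hΛc⟩ := exists_isOpen_superset_and_isCompact_closure hK
  obtain ⟨C, hC, hCb⟩ := hμ.exists_lintegral_pairing_le hσ hσ₀ hΛ hΛc
  have hβK' : ∀ z : X × M, z.1 ∉ K → |β z| = 0 := fun z hz => by rw [hβK z hz, abs_zero]
  have h1 := hCb (fun z => |β z|) hβ.abs (fun _ => abs_nonneg _)
    fun z hz => hβK' z fun h => hz (hKΛ h)
  have h2 : Integrable (pairing fun z => |β z|) μ := by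
    refine ⟨(measurable_pairing hβ.abs hK hβK').aestronglyMeasurable, ?_⟩
    rw [hasFiniteIntegral_iff_ofReal]
    · refine h1.trans_lt (ENNReal.mul_lt_top hC.lt_top ?_)
      rw [← hasFiniteIntegral_iff_ofReal (ae_of_all _ fun _ => abs_nonneg _)]
      exact hi.abs.2
    · refine ae_of_all _ fun ξ => ?_
      change 0 ≤ pairing _ _
      rw [pairing_eq_sum hK hβK']
      exact Finset.sum_nonneg fun _ _ => abs_nonneg _
  exact h2.mono' (measurable_pairing hβ hK hβK).aestronglyMeasurable
    (ae_of_all _ fun ξ => abs_pairing_le hK hβK hβK' (fun _ => le_rfl) ξ)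

/-- Integration by parts for one cylinder function. -/
lemma IsMarkedPoisson.integral_gradOmega_add (hμ : IsMarkedPoisson σ μ)
    (hσ : ∀ K : Set X, IsCompact K → σ (K ×ˢ Set.univ) < ⊤)
    (hσ₀ : ∀ x : X, σ ({x} ×ˢ Set.univ) = 0)
    (h : IsLogDerivative e σ a β) (hβ : Measurable β)
    (hsmooth : ContMDiff ((𝓡 k).prod (𝓡 e)) (𝓡 e) ∞ (fun y : G × M => y.1 • y.2))
    {ι : Type*} [Fintype ι] {φ : ι → X × M → ℝ}
    (hφ : ∀ i, IsTest d e k G (φ i)) {g : (ι → ℝ) → ℝ} (hg : ContDiff ℝ ∞ g) {C : ℝ}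
    (hgC : ∀ r, |g r| ≤ C) (hC : ∀ r, ‖fderiv ℝ g r‖ ≤ C) :
    Integrable (fun ξ => g (fun i => pairing (φ i) ξ) * pairing β ξ) μ ∧
    ∫ ξ, (gradOmega a (fun ξ => g fun i => pairing (φ i) ξ) ξ +
      g (fun i => pairing (φ i) ξ) * pairing β ξ) ∂μ = 0 := by
  have := hμ.prob
  obtain ⟨K₁, hK₁, hφK⟩ := exists_compact_support hφ
  obtain ⟨K₂, hK₂, hβK⟩ := h.support
  obtain ⟨Λ, hΛ, hKΛ, hΛc⟩ := exists_isOpen_superset_and_isCompact_closure (hK₁.union hK₂)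
  have := isFiniteMeasure_restrict hσ hΛc
  have hβΛ : ∀ z : X × M, z.1 ∉ Λ → β z = 0 := fun z hz => hβK z fun h => hz (hKΛ (Or.inr h))
  have hφΛ : ∀ i, ∀ z : X × M, z.1 ∉ Λ → φ i z = 0 := fun i z hz =>
    hφK i z fun h => hz (hKΛ (Or.inl h))
  have hgΛ : ∀ i, ∀ z : X × M, z.1 ∉ Λ → gradXM a (φ i) z = 0 := fun i z hz =>
    gradXM_eq_zero_of_notMem hsmooth a (hφ i).smooth hK₁ (hφK i) fun h => hz (hKΛ (Or.inl h))
  have hgm : Measurable fun ξ : Configuration X M => g fun i => pairing (φ i) ξ :=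
    hg.continuous.measurable.comp (measurable_cylinder_arg hφ)
  have hBi := hμ.integrable_pairing hσ hσ₀ hβ h.integrable h.support
  have hBm : Measurable (pairing β : Configuration X M → ℝ) := measurable_pairing hβ hK₂ hβK
  have hFB : Integrable (fun ξ => g (fun i => pairing (φ i) ξ) * pairing β ξ) μ :=
    hBi.bdd_mul hgm.aestronglyMeasurable (c := C) (ae_of_all _ fun ξ => hgC _)
  refine ⟨hFB, ?_⟩
  have hgi := (memLp_gradOmega hμ hσ hσ₀ hsmooth a hφ hg hC).integrable (by norm_num)
  refine hμ.integral_eq_zero hσ hσ₀ hΛ hΛc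
    ((measurable_gradOmega hsmooth a hφ hg).add (hgm.mul hBm)) (hgi.add hFB) (fun ξ => ?_) fun n => ?_
  · rw [gradOmega_cylinder hsmooth a hφ hg, gradOmega_cylinder hsmooth a hφ hg,
      pairing_restrictTo hβΛ]
    simp only [pairing_restrictTo (hφΛ _), pairing_restrictTo (hgΛ _)]
  · refine (integral_congr_ae ?_).trans
      (h.integral_tuple hβ hsmooth hφ hg hgC hC hβΛ hgΛ n)
    filter_upwards [ae_mem_distinctTuples (restrict_fiber hσ₀ Λ) n] with z hz
    rw [gradOmega_cylinder hsmooth a hφ hg]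
    simp only [pairing_ofTuple hz]
    rw [Finset.sum_add_distrib, ← Finset.mul_sum, ← map_sum]
    congr 2
    ext i
    rw [Finset.sum_apply]

end Cylinder

lemma IsCbInfty.exists_bound {N : ℕ} {g : (Fin N → ℝ) → ℝ} (hg : IsCbInfty g) :
    ∃ C : ℝ, (∀ r, |g r| ≤ C) ∧ ∀ r, ‖fderiv ℝ g r‖ ≤ C := by
  obtain ⟨C₀, h0⟩ := hg.2 0
  obtain ⟨C₁, h1⟩ := hg.2 1
  refine ⟨max C₀ C₁, fun r => ?_, fun r => ?_⟩
  · have := h0 r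
    rw [norm_iteratedFDeriv_zero] at this
    exact this.trans (le_max_left _ _)
  · have := h1 r
    rw [norm_iteratedFDeriv_one] at this
    exact this.trans (le_max_right _ _)

/-- A product of two functions of different groups of variables is bounded together with its
differential if the factors are. -/
lemma exists_bound_mul_sum {ι κ : Type*} [Fintype ι] [Fintype κ] {g : (ι → ℝ) → ℝ}
    {h : (κ → ℝ) → ℝ} (hg : ContDiff ℝ ∞ g) (hh : ContDiff ℝ ∞ h) {C D : ℝ}
    (hgC : ∀ r, |g r| ≤ C) (hgC' : ∀ r, ‖fderiv ℝ g r‖ ≤ C) (hhD : ∀ r, |h r| ≤ D)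
    (hhD' : ∀ r, ‖fderiv ℝ h r‖ ≤ D) :
    ContDiff ℝ ∞ (fun r : ι ⊕ κ → ℝ => g (fun i => r (.inl i)) * h (fun j => r (.inr j))) ∧
    ∃ E : ℝ, (∀ r : ι ⊕ κ → ℝ, |g (fun i => r (.inl i)) * h (fun j => r (.inr j))| ≤ E) ∧
      ∀ r, ‖fderiv ℝ (fun r : ι ⊕ κ → ℝ => g (fun i => r (.inl i)) * h (fun j => r (.inr j))) r‖
        ≤ E := by
  let A : (ι ⊕ κ → ℝ) →L[ℝ] (ι → ℝ) := ContinuousLinearMap.pi fun i => ContinuousLinearMap.proj (.inl i)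
  let B : (ι ⊕ κ → ℝ) →L[ℝ] (κ → ℝ) := ContinuousLinearMap.pi fun i => ContinuousLinearMap.proj (.inr i)
  have hC0 : 0 ≤ C := (abs_nonneg _).trans (hgC 0)
  have hD0 : 0 ≤ D := (abs_nonneg _).trans (hhD 0)
  refine ⟨(hg.comp A.contDiff).mul (hh.comp B.contDiff),
    C * D + (C * (D * ‖B‖) + D * (C * ‖A‖)), fun r => ?_, fun r => ?_⟩
  · rw [abs_mul]
    refine (mul_le_mul (hgC _) (hhD _) (abs_nonneg _) hC0).trans (le_add_of_nonneg_right ?_)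
    positivity
  · have h1 : HasFDerivAt (fun r => g (A r)) ((fderiv ℝ g (A r)).comp A) r :=
      ((hg.differentiable (by simp)) (A r)).hasFDerivAt.comp r A.hasFDerivAt
    have h2 : HasFDerivAt (fun r => h (B r)) ((fderiv ℝ h (B r)).comp B) r :=
      ((hh.differentiable (by simp)) (B r)).hasFDerivAt.comp r B.hasFDerivAt
    have h3 := (h1.mul h2).fderiv
    change ‖fderiv ℝ (fun r => g (A r) * h (B r)) r‖ ≤ _
    refine (congrArg norm h3).trans_le ((norm_add_le _ _).trans ?_)
    rw [norm_smul, norm_smul]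
    refine (add_le_add (mul_le_mul (hgC _) (((fderiv ℝ h (B r)).opNorm_comp_le B).trans
      (mul_le_mul_of_nonneg_right (hhD' _) (norm_nonneg _))) (norm_nonneg _) hC0)
      (mul_le_mul (hhD _) (((fderiv ℝ g (A r)).opNorm_comp_le A).trans
      (mul_le_mul_of_nonneg_right (hgC' _) (norm_nonneg _))) (norm_nonneg _) hD0)).trans ?_
    exact le_add_of_nonneg_left (by positivity)

/-! ### Integration by parts for products of cylinder functions. -/

section Cylinder

variable {d e k : ℕ} {X M G : Type*}
  [TopologicalSpace X] [T2Space X]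
  [ChartedSpace (EuclideanSpace ℝ (Fin d)) X] [IsManifold (𝓡 d) ∞ X]
  [TopologicalSpace M] [ChartedSpace (EuclideanSpace ℝ (Fin e)) M] [IsManifold (𝓡 e) ∞ M]
  [TopologicalSpace G] [T2Space G]
  [ChartedSpace (EuclideanSpace ℝ (Fin k)) G] [Group G] [LieGroup (𝓡 k) ∞ G] [MulAction G M]

lemma isCylinder_const (c : ℝ) : IsCylinder d e k G (fun _ : Configuration X M => c) :=
  ⟨0, fun i => i.elim0, fun _ => c, fun i => i.elim0, ⟨contDiff_const, fun j => by
    obtain ⟨C, hC⟩ : ∃ C : ℝ, ‖iteratedFDeriv ℝ j (fun _ : Fin 0 → ℝ => c) 0‖ ≤ C := ⟨_, le_rfl⟩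
    exact ⟨C, fun r => Subsingleton.elim 0 r ▸ hC⟩⟩, fun _ => rfl⟩

lemma IsCylinder.differentiableAt
    (hsmooth : ContMDiff ((𝓡 k).prod (𝓡 e)) (𝓡 e) ∞ (fun y : G × M => y.1 • y.2))
    (a : CurrentAlgebra d k X G) {F : Configuration X M → ℝ} (hF : IsCylinder d e k G F)
    (ξ : Configuration X M) : DifferentiableAt ℝ (fun t : ℝ => F (actOmega a t ξ)) 0 := by
  obtain ⟨N, φ, g, hφ, hg, h⟩ := hF
  obtain rfl : F = _ := funext h
  exact (hasDerivAt_cylinder hsmooth a hφ hg.1 ξ).differentiableAt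

variable [SecondCountableTopology X] [MeasurableSpace X] [BorelSpace X]
  [SecondCountableTopology M] [MeasurableSpace M] [BorelSpace M]
  {σ : Measure (X × M)} {a : CurrentAlgebra d k X G} {β : X × M → ℝ}
  {μ : Measure (Configuration X M)}

lemma IsCylinder.exists_bound {F : Configuration X M → ℝ} (hF : IsCylinder d e k G F) :
    Measurable F ∧ ∃ C : ℝ, ∀ ξ, ‖F ξ‖ ≤ C := by
  obtain ⟨N, φ, g, hφ, hg, h⟩ := hF
  obtain rfl : F = _ := funext h
  obtain ⟨C, hC, -⟩ := hg.exists_bound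
  exact ⟨hg.1.continuous.measurable.comp (measurable_cylinder_arg hφ), C, fun ξ => hC _⟩

lemma IsCylinder.memLp [IsFiniteMeasure μ] {F : Configuration X M → ℝ}
    (hF : IsCylinder d e k G F) (q : ENNReal) : MemLp F q μ := by
  obtain ⟨hm, C, hC⟩ := hF.exists_bound
  exact MemLp.of_bound hm.aestronglyMeasurable C (ae_of_all _ hC)

lemma IsCylinder.integrable_mul {F W : Configuration X M → ℝ} (hF : IsCylinder d e k G F)
    (hW : Integrable W μ) : Integrable (fun ξ => F ξ * W ξ) μ := by
  obtain ⟨hm, C, hC⟩ := hF.exists_bound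
  exact hW.bdd_mul hm.aestronglyMeasurable (c := C) (ae_of_all _ hC)

variable [LocallyCompactSpace X]

lemma IsCylinder.memLp_gradOmega (hμ : IsMarkedPoisson σ μ)
    (hσ : ∀ K : Set X, IsCompact K → σ (K ×ˢ Set.univ) < ⊤)
    (hσ₀ : ∀ x : X, σ ({x} ×ˢ Set.univ) = 0)
    (hsmooth : ContMDiff ((𝓡 k).prod (𝓡 e)) (𝓡 e) ∞ (fun y : G × M => y.1 • y.2))
    (a : CurrentAlgebra d k X G) {F : Configuration X M → ℝ} (hF : IsCylinder d e k G F) :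
    MemLp (gradOmega a F) 2 μ := by
  obtain ⟨N, φ, g, hφ, hg, h⟩ := hF
  obtain rfl : F = _ := funext h
  obtain ⟨C, -, hC⟩ := hg.exists_bound
  exact MarkedConfig.memLp_gradOmega hμ hσ hσ₀ hsmooth a hφ hg.1 hC

/-- A measurable version may be nonzero far away; cutting it off by the indicator of the compact
support keeps its pairings finite sums. -/
lemma IsLogDerivative.exists_measurable (h : IsLogDerivative e σ a β) :
    ∃ β' : X × M → ℝ, Measurable β' ∧ β =ᵐ[σ] β' ∧ ∃ K : Set X, IsCompact K ∧
      (∀ z : X × M, z.1 ∉ K → β z = 0) ∧ ∀ z : X × M, z.1 ∉ K → β' z = 0 := by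
  obtain ⟨K, hK, hβK⟩ := h.support
  have hm := h.integrable.1.aemeasurable
  refine ⟨(K ×ˢ Set.univ).indicator (hm.mk β),
    hm.measurable_mk.indicator (hK.measurableSet.prod MeasurableSet.univ), ?_, K, hK, hβK,
    fun z hz => Set.indicator_of_notMem (fun h => hz h.1) _⟩
  filter_upwards [hm.ae_eq_mk] with z hz
  by_cases h : z.1 ∈ K
  · rw [Set.indicator_of_mem (show z ∈ K ×ˢ Set.univ from ⟨h, trivial⟩), hz]
  · rw [Set.indicator_of_notMem fun h' => h h'.1, hβK z h]

/-- Integration by parts for cylinder functions. -/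
lemma IsMarkedPoisson.integral_byParts (hμ : IsMarkedPoisson σ μ)
    (hσ : ∀ K : Set X, IsCompact K → σ (K ×ˢ Set.univ) < ⊤)
    (hσ₀ : ∀ x : X, σ ({x} ×ˢ Set.univ) = 0) (h : IsLogDerivative e σ a β)
    (hsmooth : ContMDiff ((𝓡 k).prod (𝓡 e)) (𝓡 e) ∞ (fun y : G × M => y.1 • y.2))
    {F₁ F₂ : Configuration X M → ℝ} (hF₁ : IsCylinder d e k G F₁) (hF₂ : IsCylinder d e k G F₂) :
    Integrable (fun ξ => F₁ ξ * F₂ ξ * pairing β ξ) μ ∧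
    ∫ ξ, gradOmega a F₁ ξ * F₂ ξ ∂μ =
      -(∫ ξ, F₁ ξ * gradOmega a F₂ ξ ∂μ) - ∫ ξ, F₁ ξ * F₂ ξ * pairing β ξ ∂μ := by
  have := hμ.prob
  obtain ⟨β', hβ', hββ', K, hK, hβK, hβK'⟩ := h.exists_measurable
  have h' := h.congr_ae hββ' ⟨K, hK, hβK'⟩
  have hp : pairing β =ᵐ[μ] pairing β' := hμ.pairing_congr_ae hσ hσ₀ hK hβK hβK' hββ'
  have hd : ∀ ξ, gradOmega a (fun ξ => F₁ ξ * F₂ ξ) ξ =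
      gradOmega a F₁ ξ * F₂ ξ + F₁ ξ * gradOmega a F₂ ξ := fun ξ => by
    have := (hF₁.differentiableAt hsmooth a ξ).hasDerivAt.mul
      (hF₂.differentiableAt hsmooth a ξ).hasDerivAt
    rw [actOmega_zero] at this
    exact this.deriv
  have i1 : Integrable (fun ξ => gradOmega a F₁ ξ * F₂ ξ) μ := by
    simpa only [mul_comm] using hF₂.integrable_mul
      ((hF₁.memLp_gradOmega hμ hσ hσ₀ hsmooth a).integrable (by norm_num))
  have i2 : Integrable (fun ξ => F₁ ξ * gradOmega a F₂ ξ) μ :=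
    hF₁.integrable_mul ((hF₂.memLp_gradOmega hμ hσ hσ₀ hsmooth a).integrable (by norm_num))
  obtain ⟨i3, e3⟩ : Integrable (fun ξ => F₁ ξ * F₂ ξ * pairing β' ξ) μ ∧
      ∫ ξ, (gradOmega a (fun ξ => F₁ ξ * F₂ ξ) ξ + F₁ ξ * F₂ ξ * pairing β' ξ) ∂μ = 0 := by
    obtain ⟨N₁, φ₁, g₁, hφ₁, hg₁, e₁⟩ := hF₁
    obtain ⟨N₂, φ₂, g₂, hφ₂, hg₂, e₂⟩ := hF₂
    obtain rfl : F₁ = _ := funext e₁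
    obtain rfl : F₂ = _ := funext e₂
    obtain ⟨C₁, h1, h1'⟩ := hg₁.exists_bound
    obtain ⟨C₂, h2, h2'⟩ := hg₂.exists_bound
    -- F₁F₂ is a smooth bounded function of the combined list of pairings, indexed by a sum type, so
    -- the formula for a single function applies to it.
    obtain ⟨hc, E, hE, hE'⟩ := exists_bound_mul_sum hg₁.1 hg₂.1 h1 h1' h2 h2'
    have hφ : ∀ i, IsTest d e k G (Sum.elim φ₁ φ₂ i) := by
      rintro (i | i)
      exacts [hφ₁ i, hφ₂ i]
    exact hμ.integral_gradOmega_add hσ hσ₀ h' hβ' hsmooth hφ hc hE hE'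
  have hp' : (fun ξ => F₁ ξ * F₂ ξ * pairing β ξ) =ᵐ[μ] fun ξ => F₁ ξ * F₂ ξ * pairing β' ξ := by
    filter_upwards [hp] with ξ hξ
    rw [hξ]
  refine ⟨i3.congr hp'.symm, ?_⟩
  rw [integral_congr_ae hp']
  simp only [hd] at e3
  have e4 : ∫ ξ, (gradOmega a F₁ ξ * F₂ ξ + F₁ ξ * gradOmega a F₂ ξ +
      F₁ ξ * F₂ ξ * pairing β' ξ) ∂μ = ∫ ξ, gradOmega a F₁ ξ * F₂ ξ ∂μ +
      ∫ ξ, F₁ ξ * gradOmega a F₂ ξ ∂μ + ∫ ξ, F₁ ξ * F₂ ξ * pairing β' ξ ∂μ :=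
    (integral_add (i1.add i2) i3).trans (congrArg (· + _) (integral_add i1 i2))
  linarith

end Cylinder

/-! ### Counting functions of open sets generate the σ-algebra. -/

section Generation

variable {X M : Type*} [TopologicalSpace X] [T2Space X] [SecondCountableTopology X]
  [LocallyCompactSpace X] [MeasurableSpace X] [BorelSpace X]
  [TopologicalSpace M] [T2Space M] [SecondCountableTopology M] [MeasurableSpace M] [BorelSpace M]

/-- Measurability of a map into the marked configurations can be checked on open sets. -/
lemma measurable_configuration_of_isOpen {α : Type*} [MeasurableSpace α]
    {T : α → Configuration X M}
    (h : ∀ U : Set (X × M), IsOpen U → (∃ K : Set X, IsCompact K ∧ U ⊆ K ×ˢ Set.univ) →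
      Measurable fun x => ((T x).1 ∩ U).ncard) : Measurable T := by
  refine measurable_configuration fun B K hB hK hBK => ?_
  obtain ⟨Λ, hΛ, hKΛ, hΛc⟩ := exists_isOpen_superset_and_isCompact_closure hK
  set V := Λ ×ˢ (Set.univ : Set M) with hV
  have hVo : IsOpen V := hΛ.prod isOpen_univ
  have hVc : V ⊆ closure Λ ×ˢ Set.univ := Set.prod_mono_left subset_closure
  have hfin : ∀ x, ((T x).1 ∩ V).Finite := fun x =>
    ((T x).2.finite_inter hΛc).subset (Set.inter_subset_inter_right _ hVc)
  have happ : ∀ (x : α) (s : Set (X × M)), MeasurableSet s →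
      Measure.count.restrict ((T x).1 ∩ V) s = (((T x).1 ∩ (s ∩ V)).ncard : ENNReal) := by
    intro x s hs
    have h2 : ((T x).1 ∩ (s ∩ V)).Finite := (hfin x).subset fun z hz => ⟨hz.1, hz.2.2⟩
    rw [Measure.restrict_apply hs, show s ∩ ((T x).1 ∩ V) = (T x).1 ∩ (s ∩ V) by
      rw [Set.inter_left_comm], Measure.count_apply_finite _ h2, Set.ncard_eq_toFinset_card _ h2]
  have : ∀ x, IsFiniteMeasure (Measure.count.restrict ((T x).1 ∩ V)) := fun x =>
    ⟨by rw [happ x _ MeasurableSet.univ]; exact ENNReal.natCast_lt_top _⟩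
  -- The configuration over a bounded set is read as a finite random counting measure; the π-λ
  -- theorem extends measurability of its values from open to Borel sets.
  have hm : Measurable fun x => Measure.count.restrict ((T x).1 ∩ V) := by
    have hU : ∀ s : Set (X × M), IsOpen s →
        Measurable fun x => Measure.count.restrict ((T x).1 ∩ V) s := fun s hs => by
      simp only [happ _ s hs.measurableSet]
      exact (measurable_from_nat (f := fun n : ℕ => (n : ENNReal))).comp
        (h _ (hs.inter hVo) ⟨closure Λ, hΛc, Set.inter_subset_right.trans hVc⟩)
    exact Measurable.measure_of_isPiSystem (BorelSpace.measurable_eq (α := X × M)) isPiSystem_isOpen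
      (fun s hs => hU s hs) (hU _ isOpen_univ)
  have hmB := (Measure.measurable_coe hB).comp hm
  refine measurable_to_countable' fun n => ?_
  have h3 := hmB (measurableSet_singleton (n : ENNReal))
  convert h3 using 1
  ext x
  have hBV : B ∩ V = B := Set.inter_eq_left.2 (hBK.trans (Set.prod_mono_left hKΛ))
  simp only [Set.mem_preimage, Set.mem_singleton_iff, Function.comp_apply, happ x B hB, hBV,
    Nat.cast_inj]

/-- The sets `{ξ | #(ξ ∩ U₁) = n₁, …, #(ξ ∩ U_N) = n_N}` with open sets `U_i`. -/
def countingSets (X M : Type*) [TopologicalSpace X] [TopologicalSpace M] :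
    Set (Set (Configuration X M)) :=
  {A | ∃ l : List (Set (X × M) × ℕ),
    (∀ y ∈ l, IsOpen y.1 ∧ ∃ K : Set X, IsCompact K ∧ y.1 ⊆ K ×ˢ Set.univ) ∧
    A = {ξ | ∀ y ∈ l, (ξ.1 ∩ y.1).ncard = y.2}}

lemma isPiSystem_countingSets : IsPiSystem (countingSets X M) := by
  rintro _ ⟨l, hl, rfl⟩ _ ⟨l', hl', rfl⟩ -
  refine ⟨l ++ l', fun y hy => ?_, ?_⟩
  · rcases List.mem_append.1 hy with h | h
    exacts [hl y h, hl' y h]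
  · ext ξ
    simp only [Set.mem_inter_iff, Set.mem_ofPred_eq, List.mem_append]
    exact ⟨fun h y hy => hy.elim (h.1 y) (h.2 y), fun h =>
      ⟨fun y hy => h y (Or.inl hy), fun y hy => h y (Or.inr hy)⟩⟩

/-- One inclusion is the preceding criterion applied to the identity map. Open sets are used because
their indicators are pointwise limits of test functions. -/
lemma generateFrom_countingSets :
    (inferInstance : MeasurableSpace (Configuration X M)) =
      MeasurableSpace.generateFrom (countingSets X M) := by
  refine le_antisymm ?_ (MeasurableSpace.generateFrom_le ?_)
  · have h : @Measurable _ _ (MeasurableSpace.generateFrom (countingSets X M)) _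
        (id : Configuration X M → Configuration X M) := by
      refine @measurable_configuration_of_isOpen X M _ _ _ _ _ _ _ _ _ _ _ _
        (MeasurableSpace.generateFrom (countingSets X M)) _ fun U hU hK => ?_
      refine @measurable_to_countable' _ _ _ _ (MeasurableSpace.generateFrom (countingSets X M)) _
        fun n => ?_
      refine MeasurableSpace.measurableSet_generateFrom ⟨[(U, n)], ?_, ?_⟩
      · simp only [List.mem_singleton, forall_eq]
        exact ⟨hU, hK⟩
      · ext ξ
        simp
    exact fun s hs => h hs
  · rintro _ ⟨l, hl, rfl⟩
    have : {ξ : Configuration X M | ∀ y ∈ l, (ξ.1 ∩ y.1).ncard = y.2} =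
        ⋂ i : Fin l.length, {ξ | (ξ.1 ∩ (l.get i).1).ncard = (l.get i).2} := by
      ext ξ
      simp only [Set.mem_ofPred_eq, Set.mem_iInter, List.forall_mem_iff_get]
    rw [this]
    refine MeasurableSet.iInter fun i => ?_
    obtain ⟨hU, K, hK, hUK⟩ := hl _ (l.get_mem i)
    exact measurable_ncard hU.measurableSet hK hUK (measurableSet_singleton _)

lemma measurableSet_of_mem_countingSets {A : Set (Configuration X M)}
    (hA : A ∈ countingSets X M) : MeasurableSet A := by
  have h := MeasurableSpace.measurableSet_generateFrom hA
  rwa [← generateFrom_countingSets] at h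

/-- An integrable function with vanishing integrals over the counting sets vanishes. -/
lemma ae_eq_zero_of_forall_countingSets {μ : Measure (Configuration X M)}
    {W : Configuration X M → ℝ} (hW : Integrable W μ)
    (h : ∀ A ∈ countingSets X M, ∫ ξ in A, W ξ ∂μ = 0) : W =ᵐ[μ] 0 := by
  have huniv : ∫ ξ, W ξ ∂μ = 0 := by
    rw [← setIntegral_univ]
    exact h _ ⟨[], by simp, by simp⟩
  have key : ∀ s : Set (Configuration X M), MeasurableSet s → ∫ ξ in s, W ξ ∂μ = 0 := by
    refine MeasurableSpace.induction_on_inter generateFrom_countingSets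
      isPiSystem_countingSets ?_ ?_ ?_ ?_
    · rw [setIntegral_empty]
    · exact h
    · intro t ht ih
      rw [setIntegral_compl ht hW, ih, huniv, sub_zero]
    · intro f hd hm ih
      rw [integral_iUnion hm hd hW.integrableOn]
      simp only [ih, tsum_zero]
  exact hW.ae_eq_zero_of_forall_setIntegral_eq_zero fun s hs _ => key s hs

end Generation

/-! ### Cylinder functions determine integrable functions. -/

section Density

variable {d e k : ℕ} {X M G : Type*}
  [TopologicalSpace X] [T2Space X]
  [ChartedSpace (EuclideanSpace ℝ (Fin d)) X] [IsManifold (𝓡 d) ∞ X]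
  [TopologicalSpace M] [T2Space M]
  [ChartedSpace (EuclideanSpace ℝ (Fin e)) M] [IsManifold (𝓡 e) ∞ M]
  [TopologicalSpace G] [T2Space G]
  [ChartedSpace (EuclideanSpace ℝ (Fin k)) G] [Group G] [LieGroup (𝓡 k) ∞ G] [MulAction G M]
  [SecondCountableTopology X] [LocallyCompactSpace X] [MeasurableSpace X] [BorelSpace X]
  [SecondCountableTopology M] [LocallyCompactSpace M] [MeasurableSpace M] [BorelSpace M]

/-- Approximation of the indicator of an open set by test functions. -/
lemma exists_isTest_tendsto_indicator
    (hsmooth : ContMDiff ((𝓡 k).prod (𝓡 e)) (𝓡 e) ∞ (fun y : G × M => y.1 • y.2))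
    {U : Set (X × M)} (hU : IsOpen U) : ∃ φ : ℕ → X × M → ℝ, (∀ n, IsTest d e k G (φ n)) ∧
      (∀ n, ∀ z ∉ U, φ n z = 0) ∧ ∀ z ∈ U, ∀ᶠ n in atTop, φ n z = 1 := by
  letI := TopologicalSpace.metrizableSpaceMetric (X × M)
  obtain ⟨F, hF, hFU, hFeq, hFm⟩ := hU.exists_iUnion_isClosed
  let L := CompactExhaustion.choice (X × M)
  -- U is exhausted by increasing closed sets `F n` and the whole space by compact sets `L n`. The
  -- n-th function is one on F n ∩ L n and zero off U ∩ L (n + 1), hence a test function.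
  have h : ∀ n, ∃ f : C^∞⟮(𝓡 d).prod (𝓡 e), X × M; 𝓘(ℝ), ℝ⟯,
      (∀ᶠ x in 𝓝ˢ (F n ∩ L n), f x = 1) ∧ (∀ x ∉ U ∩ L (n + 1), f x = 0) ∧
        ∀ x, f x ∈ Set.Icc (0 : ℝ) 1 := fun n => by
    refine exists_contMDiffMap_one_nhds_of_subset_interior ((𝓡 d).prod (𝓡 e)) (n := ⊤)
      ((hF n).inter (L.isCompact n).isClosed) ?_
    rw [interior_inter, hU.interior_eq]
    exact Set.inter_subset_inter (hFU n) (L.subset_interior_succ n)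
  choose f hf1 hf0 _ using h
  refine ⟨fun n => f n, fun n => ?_, fun n z hz => hf0 n z fun h => hz h.1, fun z hz => ?_⟩
  · exact isTest_of_compactSupport hsmooth (f n).contMDiff (L.isCompact (n + 1))
      fun z hz => hf0 n z fun h => hz h.2
  · rw [← hFeq] at hz
    obtain ⟨n₁, hn₁⟩ := Set.mem_iUnion.1 hz
    obtain ⟨n₂, hn₂⟩ := L.exists_mem z
    filter_upwards [eventually_ge_atTop (max n₁ n₂)] with n hn
    exact (hf1 n).self_of_nhdsSet z ⟨hFm ((le_max_left _ _).trans hn) hn₁,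
      L.subset ((le_max_right _ _).trans hn) hn₂⟩

lemma tendsto_pairing_ncard {U : Set (X × M)} {K : Set X} (hK : IsCompact K)
    (hUK : U ⊆ K ×ˢ Set.univ) {φ : ℕ → X × M → ℝ} (h0 : ∀ n, ∀ z ∉ U, φ n z = 0)
    (h1 : ∀ z ∈ U, ∀ᶠ n in atTop, φ n z = 1) (ξ : Configuration X M) :
    Tendsto (fun n => pairing (φ n) ξ) atTop (𝓝 ((ξ.1 ∩ U).ncard : ℝ)) := by
  rw [← pairing_indicator_one hK hUK, pairing_eq_sum hK fun z hz =>
    Set.indicator_of_notMem (fun h => hz (hUK h).1) _]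
  simp only [fun n => pairing_eq_sum hK (f := φ n) fun z hz => h0 n z fun h => hz (hUK h).1]
  refine tendsto_finsetSum _ fun z _ => ?_
  by_cases hz : z ∈ U
  · rw [Set.indicator_of_mem hz]
    exact tendsto_const_nhds.congr' ((h1 z hz).mono fun n hn => hn.symm)
  · rw [Set.indicator_of_notMem hz]
    exact tendsto_const_nhds.congr fun n => (h0 n z hz).symm

lemma isCbInfty_bump {N : ℕ} {c : Fin N → ℝ} (f : ContDiffBump c) : IsCbInfty f :=
  ⟨f.contDiff, fun j => (f.contDiff.continuous_iteratedFDeriv (n := ∞)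
    (WithTop.coe_le_coe.2 le_top)).bounded_above_of_compact_support
      (f.hasCompactSupport.iteratedFDeriv j)⟩

/-- An integrable function that is orthogonal to the cylinder functions vanishes. -/
lemma ae_eq_zero_of_forall_integral_cylinder {μ : Measure (Configuration X M)}
    (hsmooth : ContMDiff ((𝓡 k).prod (𝓡 e)) (𝓡 e) ∞ (fun y : G × M => y.1 • y.2))
    {W : Configuration X M → ℝ} (hW : Integrable W μ)
    (h : ∀ F : Configuration X M → ℝ, IsCylinder d e k G F → ∫ ξ, F ξ * W ξ ∂μ = 0) :
    W =ᵐ[μ] 0 := by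
  refine ae_eq_zero_of_forall_countingSets hW fun A hA => ?_
  have hAm := measurableSet_of_mem_countingSets hA
  obtain ⟨l, hl, hAl⟩ := hA
  have hmem : ∀ ξ, ξ ∈ A ↔ ∀ y ∈ l, (ξ.1 ∩ y.1).ncard = y.2 := fun ξ => by rw [hAl]; rfl
  have hφ := fun i : Fin l.length =>
    exists_isTest_tendsto_indicator (d := d) hsmooth (hl _ (l.get_mem i)).1
  choose φ hφt hφ0 hφ1 using hφ
  choose K hK hUK using fun i : Fin l.length => (hl _ (l.get_mem i)).2
  let c : Fin l.length → ℝ := fun i => (l.get i).2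
  -- Distinct integer vectors are at sup-distance at least one, so with outer radius 1/2 the bump
  -- function of the counts is exactly the indicator of the counting set.
  let f : ContDiffBump c := ⟨1 / 4, 1 / 2, by norm_num, by norm_num⟩
  have hlim : ∀ ξ : Configuration X M, Tendsto (fun n => f (fun i => pairing (φ i n) ξ)) atTop
      (𝓝 (A.indicator 1 ξ)) := by
    intro ξ
    have h1 : Tendsto (fun n i => pairing (φ i n) ξ) atTop
        (𝓝 fun i => ((ξ.1 ∩ (l.get i).1).ncard : ℝ)) :=
      tendsto_pi_nhds.2 fun i => tendsto_pairing_ncard (hK i) (hUK i) (hφ0 i) (hφ1 i) ξ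
    have h2 := (f.continuous.tendsto _).comp h1
    have h3 : f (fun i => ((ξ.1 ∩ (l.get i).1).ncard : ℝ)) = A.indicator 1 ξ := by
      by_cases hξ : ξ ∈ A
      · rw [Set.indicator_of_mem hξ]
        have : (fun i => ((ξ.1 ∩ (l.get i).1).ncard : ℝ)) = c :=
          funext fun i => congrArg Nat.cast ((hmem ξ).1 hξ _ (l.get_mem i))
        rw [this]
        exact f.one_of_mem_closedBall (Metric.mem_closedBall_self f.rIn_pos.le)
      · rw [Set.indicator_of_notMem hξ]
        refine f.zero_of_le_dist ?_
        rw [hmem, List.forall_mem_iff_get] at hξ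
        obtain ⟨i, hi⟩ := not_forall.1 hξ
        refine le_trans ?_ (dist_le_pi_dist _ _ i)
        change (1 / 2 : ℝ) ≤ dist (((ξ.1 ∩ (l.get i).1).ncard : ℝ)) ((l.get i).2 : ℝ)
        rw [Nat.dist_cast_real]
        exact le_trans (by norm_num) (Nat.pairwise_one_le_dist hi)
    rw [← h3]
    exact h2
  have hcyl : ∀ n, IsCylinder d e k G fun ξ : Configuration X M =>
      f (fun i => pairing (φ i n) ξ) := fun n =>
    ⟨l.length, fun i => φ i n, f, fun i => hφt i n, isCbInfty_bump f, fun _ => rfl⟩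
  have hdct := tendsto_integral_of_dominated_convergence
    (F := fun n ξ => f (fun i => pairing (φ i n) ξ) * W ξ) (fun ξ => ‖W ξ‖)
    (fun n => ((hcyl n).integrable_mul hW).1) hW.norm
    (fun n => ae_of_all μ fun ξ => by
      rw [norm_mul, Real.norm_of_nonneg f.nonneg]
      exact mul_le_of_le_one_left (norm_nonneg _) f.le_one)
    (ae_of_all μ fun ξ => (hlim ξ).mul_const (W ξ))
  simp only [h _ (hcyl _)] at hdct
  have h3 := tendsto_nhds_unique hdct tendsto_const_nhds
  rw [← integral_indicator hAm]
  refine Eq.trans (integral_congr_ae (ae_of_all _ fun ξ => ?_)) h3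
  by_cases hξ : ξ ∈ A
  · simp only [Set.indicator_of_mem hξ, Pi.one_apply, one_mul]
  · simp only [Set.indicator_of_notMem hξ, zero_mul]

end Density

/-! ### Identification of the adjoint, and the logarithmic derivative. -/

section Adjoint

variable {d e k : ℕ} {X M G : Type*}
  [TopologicalSpace X] [T2Space X]
  [ChartedSpace (EuclideanSpace ℝ (Fin d)) X] [IsManifold (𝓡 d) ∞ X]
  [TopologicalSpace M] [T2Space M]
  [ChartedSpace (EuclideanSpace ℝ (Fin e)) M] [IsManifold (𝓡 e) ∞ M]
  [TopologicalSpace G] [T2Space G]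
  [ChartedSpace (EuclideanSpace ℝ (Fin k)) G] [Group G] [LieGroup (𝓡 k) ∞ G] [MulAction G M]
  [SecondCountableTopology X] [MeasurableSpace X] [BorelSpace X]
  [SecondCountableTopology M] [MeasurableSpace M] [BorelSpace M]

/-- The integration by parts formula determines the adjoint on the cylinder functions. -/
lemma isAdjointValue_iff [LocallyCompactSpace X] [LocallyCompactSpace M]
    (hsmooth : ContMDiff ((𝓡 k).prod (𝓡 e)) (𝓡 e) ∞ (fun y : G × M => y.1 • y.2))
    {μ : Measure (Configuration X M)} [IsProbabilityMeasure μ] {a : CurrentAlgebra d k X G}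
    {B : Configuration X M → ℝ}
    (hgrad : ∀ F : Configuration X M → ℝ, IsCylinder d e k G F → MemLp (gradOmega a F) 2 μ)
    (hibp : ∀ F₁ F₂ : Configuration X M → ℝ, IsCylinder d e k G F₁ → IsCylinder d e k G F₂ →
      Integrable (fun ξ => F₁ ξ * F₂ ξ * B ξ) μ ∧
      ∫ ξ, gradOmega a F₁ ξ * F₂ ξ ∂μ =
        -(∫ ξ, F₁ ξ * gradOmega a F₂ ξ ∂μ) - ∫ ξ, F₁ ξ * F₂ ξ * B ξ ∂μ)
    {F H : Configuration X M → ℝ} (hF : IsCylinder d e k G F) :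
    IsAdjointValue e μ a F H ↔
      MemLp H 2 μ ∧ H =ᵐ[μ] fun ξ => -gradOmega a F ξ - B ξ * F ξ := by
  have hgi := (hgrad F hF).integrable (by norm_num)
  have hformula : ∀ F₁ : Configuration X M → ℝ, IsCylinder d e k G F₁ →
      Integrable (fun ξ => F₁ ξ * (-gradOmega a F ξ - B ξ * F ξ)) μ ∧
      ∫ ξ, gradOmega a F₁ ξ * F ξ ∂μ = ∫ ξ, F₁ ξ * (-gradOmega a F ξ - B ξ * F ξ) ∂μ := by
    intro F₁ h₁
    obtain ⟨i1, e1⟩ := hibp F₁ F h₁ hF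
    have i2 := h₁.integrable_mul hgi
    have hs : (fun ξ => F₁ ξ * (-gradOmega a F ξ - B ξ * F ξ)) =
        fun ξ => -(F₁ ξ * gradOmega a F ξ) - F₁ ξ * F ξ * B ξ := by
      funext ξ
      ring
    rw [hs]
    refine ⟨i2.neg.sub i1, e1.trans ?_⟩
    rw [← integral_neg]
    exact (integral_sub i2.neg i1).symm
  constructor
  · rintro ⟨-, hH, hadj⟩
    refine ⟨hH, ?_⟩
    -- The constant function one is a cylinder function, which makes the candidate -∇F - BF
    -- integrable. It may fail to be in L², so its difference to `H` is treated as an element of L¹.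
    have hone := (hformula _ (isCylinder_const 1)).1
    simp only [one_mul] at hone
    have hHi := hH.integrable (by norm_num)
    have hW := ae_eq_zero_of_forall_integral_cylinder hsmooth (hHi.sub hone) fun F₁ h₁ => by
      obtain ⟨i1, e1⟩ := hformula F₁ h₁
      have e2 := hadj F₁ h₁
      have e3 := integral_sub (h₁.integrable_mul hHi) i1
      rw [← e2, ← e1, sub_self] at e3
      simpa only [Pi.sub_apply, mul_sub] using e3
    filter_upwards [hW] with ξ hξ
    exact sub_eq_zero.1 hξ
  · rintro ⟨hH, hHe⟩
    refine ⟨hF.memLp 2, hH, fun F₁ h₁ => (hformula F₁ h₁).2.trans (integral_congr_ae ?_)⟩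
    filter_upwards [hHe] with ξ hξ
    rw [hξ]

variable [RiemannianBundle (fun x : X => TangentSpace (𝓡 d) x)]
  [IsContMDiffRiemannianBundle (𝓡 d) ∞ (EuclideanSpace ℝ (Fin d))
    (fun x : X => TangentSpace (𝓡 d) x)]

lemma isLogDerivative_logDeriv {lam : Measure M} [SigmaFinite lam]
    (hsmooth : ContMDiff ((𝓡 k).prod (𝓡 e)) (𝓡 e) ∞ (fun y : G × M => y.1 • y.2))
    {b : Module.Basis (Fin k) ℝ (GroupLieAlgebra (𝓡 k) G)}
    {P : G → M → ℝ} (hP : IsDifferentiableDensity (e := e) (k := k) lam P)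
    {ρ : X → ℝ} {p : X → M → ℝ} (hρ : Measurable ρ) (hp : Measurable (fun z : X × M => p z.1 z.2))
    (hρ_pos : ∀ᵐ x ∂(riemannianVolume d X), 0 < ρ x)
    (hp_pos : ∀ᵐ x ∂(riemannianVolume d X), ∀ᵐ m ∂lam, 0 < p x m)
    {D : Covectors d k X M G}
    (hD : HasLocalSobolevGradient e lam b (fun z => Real.sqrt (ρ z.1 * p z.1 z.2)) D)
    (hPint : ∀ K : Set X, IsCompact K →
      IntegrableOn (fun z : X × M => Real.sqrt (normSqG b (dDensity P z.2))) (K ×ˢ Set.univ)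
        (levyMeasure d lam ρ p))
    (a : CurrentAlgebra d k X G) :
    IsLogDerivative e (levyMeasure d lam ρ p) a
      (logDeriv (fun z : X × M => ρ z.1 * p z.1 z.2) D P a) where
  integrable := by
    -- Taking f = 1 in the one-point formula isolates β and yields its integrability.
    have h0 : ∀ (a : CurrentAlgebra d k X G) (z : X × M),
        gradXM a (fun _ : X × M => (1 : ℝ)) z = 0 := fun a z =>
      (hasDerivAt_act hsmooth a contMDiff_const z).unique (hasDerivAt_const _ _)
    have h := (integral_gradXM_add_logDeriv hsmooth hP hρ hp hρ_pos hp_pos hD hPint a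
      (f := fun _ => 1) contMDiff_const (C := 1) (fun z => by simp)
      (fun z => by rw [h0]; simp) (fun z => by rw [h0]; simp)).1
    simpa only [h0, zero_add, one_mul] using h
  support := by
    obtain ⟨K, hK, hKa⟩ := a.compact_support
    exact ⟨K, hK, fun z hz => logDeriv_eq_zero hK hKa hz⟩
  integral_eq_zero f C hf h1 h2 h3 :=
    (integral_gradXM_add_logDeriv hsmooth hP hρ hp hρ_pos hp_pos hD hPint a hf h1 h2 h3).2

end Adjoint

end MarkedConfig

end

/-! ### The theorem, assembled from the one-point formula and the Poisson calculus. -/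

theorem theorem3p1 {d e k : ℕ} {X M G : Type*}
    -- the Riemannian manifold `X`
    [TopologicalSpace X] [T2Space X] [SecondCountableTopology X] [ConnectedSpace X]
    [NoncompactSpace X] [ChartedSpace (EuclideanSpace ℝ (Fin d)) X] [IsManifold (𝓡 d) ∞ X]
    [RiemannianBundle (fun x : X => TangentSpace (𝓡 d) x)]
    [IsContMDiffRiemannianBundle (𝓡 d) ∞ (EuclideanSpace ℝ (Fin d))
      (fun x : X => TangentSpace (𝓡 d) x)]
    [MeasurableSpace X] [BorelSpace X]
    -- the manifold `M` of marks
    [TopologicalSpace M] [T2Space M] [SecondCountableTopology M] [ConnectedSpace M]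
    [ChartedSpace (EuclideanSpace ℝ (Fin e)) M] [IsManifold (𝓡 e) ∞ M]
    [MeasurableSpace M] [BorelSpace M]
    -- the Lie group `G`, which acts smoothly and transitively on `M`
    [TopologicalSpace G] [T2Space G] [SecondCountableTopology G]
    [ChartedSpace (EuclideanSpace ℝ (Fin k)) G] [Group G] [LieGroup (𝓡 k) ∞ G]
    [MulAction G M] [MulAction.IsPretransitive G M]
    (hsmooth : ContMDiff ((𝓡 k).prod (𝓡 e)) (𝓡 e) ∞ (fun y : G × M => y.1 • y.2))
    -- an inner product on the Lie algebra of `G`, given by an orthonormal basis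
    (b : Module.Basis (Fin k) ℝ (GroupLieAlgebra (𝓡 k) G))
    -- the quasiinvariant measure on `M` and its differentiable density
    (lam : Measure M) [IsLocallyFiniteMeasure lam] (P : G → M → ℝ)
    (hP : MarkedConfig.IsDifferentiableDensity (e := e) (k := k) lam P)
    -- the densities
    (ρ : X → ℝ) (p : X → M → ℝ) (hρ : Measurable ρ)
    (hp : Measurable (fun z : X × M => p z.1 z.2))
    (hρ_pos : ∀ᵐ x ∂(MarkedConfig.riemannianVolume d X), 0 < ρ x)
    (hp_pos : ∀ᵐ x ∂(MarkedConfig.riemannianVolume d X), ∀ᵐ m ∂lam, 0 < p x m)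
    -- `q^{1/2}` is in the local Sobolev space, with gradient `D`
    (D : MarkedConfig.Covectors d k X M G)
    (hD : MarkedConfig.HasLocalSobolevGradient e lam b
      (fun z => Real.sqrt (ρ z.1 * p z.1 z.2)) D)
    -- `|∇^G P(e, ·)|` is locally integrable
    (hPint : ∀ K : Set X, IsCompact K →
      IntegrableOn (fun z : X × M => Real.sqrt (MarkedConfig.normSqG b
        (MarkedConfig.dDensity P z.2))) (K ×ˢ Set.univ) (MarkedConfig.levyMeasure d lam ρ p))
    -- the marked Poisson measure
    (μ : Measure (MarkedConfig.Configuration X M))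
    (hμ : MarkedConfig.IsMarkedPoisson (MarkedConfig.levyMeasure d lam ρ p) μ)
    (a : MarkedConfig.CurrentAlgebra d k X G) :
    let B := MarkedConfig.logDerivPoisson (fun z : X × M => ρ z.1 * p z.1 z.2) D P a
    (∀ F : MarkedConfig.Configuration X M → ℝ, MarkedConfig.IsCylinder d e k G F →
      (∀ ξ, DifferentiableAt ℝ (fun t : ℝ => F (MarkedConfig.actOmega a t ξ)) 0) ∧
      MemLp F 2 μ ∧ MemLp (MarkedConfig.gradOmega a F) 2 μ) ∧
    (∀ F₁ F₂ : MarkedConfig.Configuration X M → ℝ,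
      MarkedConfig.IsCylinder d e k G F₁ → MarkedConfig.IsCylinder d e k G F₂ →
      Integrable (fun ξ => F₁ ξ * F₂ ξ * B ξ) μ ∧
      ∫ ξ, MarkedConfig.gradOmega a F₁ ξ * F₂ ξ ∂μ =
        -(∫ ξ, F₁ ξ * MarkedConfig.gradOmega a F₂ ξ ∂μ) - ∫ ξ, F₁ ξ * F₂ ξ * B ξ ∂μ) ∧
    (∀ F H : MarkedConfig.Configuration X M → ℝ, MarkedConfig.IsCylinder d e k G F →
      (MarkedConfig.IsAdjointValue e μ a F H ↔
        MemLp H 2 μ ∧ H =ᵐ[μ] fun ξ => -MarkedConfig.gradOmega a F ξ - B ξ * F ξ)) := by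
  intro B
  have : LocallyCompactSpace X := Manifold.locallyCompact_of_finiteDimensional (𝓡 d)
  have : LocallyCompactSpace M := Manifold.locallyCompact_of_finiteDimensional (𝓡 e)
  have := hμ.prob
  have hσ := fun (K : Set X) (hK : IsCompact K) =>
    MarkedConfig.levyMeasure_lt_top hsmooth hρ hp hD hK
  have hσ₀ : ∀ x : X, MarkedConfig.levyMeasure d lam ρ p ({x} ×ˢ Set.univ) = 0 :=
    MarkedConfig.levyMeasure_fiber ρ p
  have hβ := MarkedConfig.isLogDerivative_logDeriv hsmooth hP hρ hp hρ_pos hp_pos hD hPint a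
  have hibp := fun (F₁ F₂ : MarkedConfig.Configuration X M → ℝ)
    (h₁ : MarkedConfig.IsCylinder d e k G F₁) (h₂ : MarkedConfig.IsCylinder d e k G F₂) =>
    hμ.integral_byParts hσ hσ₀ hβ hsmooth h₁ h₂
  exact ⟨fun F hF => ⟨hF.differentiableAt hsmooth a, hF.memLp 2,
    hF.memLp_gradOmega hμ hσ hσ₀ hsmooth a⟩, hibp,
    fun F H hF => MarkedConfig.isAdjointValue_iff hsmooth
      (fun F hF => hF.memLp_gradOmega hμ hσ hσ₀ hsmooth a) hibp hF⟩
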